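/- Throughout, all systems are finite-dimensional, Boltzmann's constant is $1$, $S(\rho)=-\mathrm{Tr}(\rho\log\rho)$ is the von Neumann entropy, $\|\cdot\|_1$ is the trace norm, and $T=1/\beta$. **Setting.** Let $\mathcal Q=(Q^1,\dots,Q^n)$, $n\ge 1$, be pairwise commuting Hermitian observables on a finite-dimensional system, and $\mathbf v\in\mathbb R^n$. The class $[\mathbf v]_{\mathcal Q}$ of the macrostate $(\mathbf v,\mathcal Q)$ is the set of all density matrices $\rho$ with $\mathrm{Tr}(\rho Q^j)=v^j$ for all $j$; it is assumed to be non-empty. For $\mathbf b\in\mathbb R^n$ put $\gamma_{\mathbf b}(\mathcal Q)=e^{-\sum_j b_jQ^j}/\mathrm{Tr}(e^{-\sum_j b_jQ^j})$. The ensemble $\gamma_{\mathbf v}(\mathcal Q)$ of the macrostate is the element of $[\mathbf v]_{\mathcal Q}$ that is of this form or, if $\mathbf v$ lies on the boundary of the set of attainable values, a limit of states of this form. An environment at inverse temperatures $\boldsymbol\beta=(\beta_1,\dots,\beta_n)$ consists of $N\geq 0$ finite-dimensional systems $E^l$, each with $n$ commuting observables $Q^j_{E^l}$; its microstates are all products $\bigotimes_l\sigma^l$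 of density matrices with the thermal expectation values $\mathrm{Tr}(\sigma^lQ^j_{E^l})=\mathrm{Tr}(\gamma_{\boldsymbol\beta}(\mathcal Q_{E^l})\,Q^j_{E^l})$. The total observables are $Q^j_{SE}=Q^j+\sum_lQ^j_{E^l}$. One writes $(\mathbf v,\mathcal Q)\xrightarrow{\boldsymbol\beta\text{-mac}}\rho_f$ if for all $\epsilon,\epsilon'>0$ there are an environment and one unitary $U$ on $SE$ such that for all $\rho\in[\mathbf v]_{\mathcal Q}$ and all microstates $\sigma$ of the environment $$\|\mathrm{Tr}_E(U(\rho\otimes\sigma)U^\dagger)-\rho_f\|_1\le\epsilon,\qquad |\mathrm{Tr}(U(\rho\otimes\sigma)U^\dagger Q^j_{SE})-\mathrm{Tr}((\rho\otimes\sigma)Q^j_{SE})|\le\epsilon'\ \ (j=1,\dots,n).$$ For $n=1$, with a Hamiltonian $H$ as the only observable, one writes $(e,H)$, $\gamma_e(H)$, $\gamma_\beta(H)$ and $\xrightarrow{\beta\text{-mac}}$. **Second law and Clausius inequality.** Let $H$ be Hermitian, $\beta>0$ and $[e]_H\neq\emptyset$. Let $\mathcal F(\rho)=\mathrm{Tr}(\rho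 H)-TS(\rho)$. 1. The canonical ensemble $\gamma_e(H)$ exists and is unique, so that $F(e,H):=\mathcal F(\gamma_e(H))$ and $S(e,H):=(e-F(e,H))/T$ are functions of the macrostate; moreover $S(e,H)=S(\gamma_e(H))$. 2. For every density matrix $\rho_f$ of the system, $(e,H)\xrightarrow{\beta\text{-mac}}\rho_f$ if and only if $\mathcal F(\gamma_e(H))\ge\mathcal F(\rho_f)$. 3. For every $e'$ with $[e']_H\ne\emptyset$ the following are equivalent: (a) $(e,H)\xrightarrow{\beta\text{-mac}}\gamma_{e'}(H)$; (b) $(e,H)\xrightarrow{\beta\text{-mac}}\rho_f$ for some $\rho_f\in[e']_H$; (c) for all $\epsilon,\epsilon'>0$ there are an environment and one unitary on $SE$ that changes the mean total energy by at most $\epsilon'$ and takes the system to within $\epsilon$, in trace norm, of $[e']_H$, for all $\rho\in[e]_H$ and all microstates of the environment; (d) $\Delta Q\ge T\Delta S$, where $\Delta Q=e-e'$ and $\Delta S=S(e,H)-S(e',H)$ (here $\Delta$ means initial minus final value). 4. For every density matrix $\rho_f$ the greatest $W$ such that for all $\epsilon,\epsilon'>0$ there are an environment and one unitary on $SE$ that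 takes the system to $\rho_f$ up to $\epsilon$ in trace norm and decreases the mean total energy by $W$ up to $\epsilon'$, for all $\rho\in[e]_H$ and all microstates of the environment, is $\Delta\mathcal F_S=F(e,H)-\mathcal F(\rho_f)$. If the final state of the system is not prescribed, the greatest such $W$ is $F(e,H)-\mathcal F(\gamma_\beta(H))$. The latter is also the supremum over all environments and unitaries of the mean energy extracted when the system starts in $\gamma_e(H)$ and each environment system in its Gibbs state at inverse temperature $\beta$. **Several observables.** Let $\mathcal Q$ be as above, $\beta_j\ne0$ for all $j$ and $[\mathbf v]_{\mathcal Q}\ne\emptyset$. Then $\gamma_{\mathbf v}(\mathcal Q)$ exists and is unique, and for every density matrix $\rho_f$ $$(\mathbf v,\mathcal Q)\xrightarrow{\boldsymbol\beta\text{-mac}}\rho_f\iff\mathcal G(\gamma_{\mathbf v}(\mathcal Q))\ge\mathcal G(\rho_f),\qquad \mathcal G(\rho)=\sum_j\beta_j\mathrm{Tr}(\rho Q^j)-S(\rho).$$ -/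

import Mathlib

open scoped Kronecker ComplexOrder

noncomputable section

namespace MacroThermo

/-! Finite-dimensional quantum systems are described by complex matrices over a finite index set.
Boltzmann's constant is set to one, so that an environment at inverse temperature `β` has
temperature `T = 1 / β`. -/

/-! ### States, entropy and ensembles -/

/-- Density matrices (microstates). -/
def IsDensity {d : Type*} [Fintype d] (ρ : Matrix d d ℂ) : Prop :=
  ρ.PosSemidef ∧ ρ.trace = 1

/-- The expectation value `tr (ρ A)` (which is real for Hermitian `ρ` and `A`). -/
def expect {d : Type*} [Fintype d] (ρ A : Matrix d d ℂ) : ℝ := (ρ * A).trace.re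

/-- The trace norm `tr √(Aᴴ A)`, that is, the sum of the singular values of `A`. -/
def traceNorm {d : Type*} [Fintype d] [DecidableEq d] (A : Matrix d d ℂ) : ℝ :=
  ∑ i, √((Matrix.isHermitian_conjTranspose_mul_self A).eigenvalues i)

/-- The von Neumann entropy `- tr (ρ log ρ)`, through the functional calculus of the
Hermitian matrix `ρ` (with `0 log 0 = 0`). -/
def vonNeumannEntropy {d : Type*} [Fintype d] [DecidableEq d] (ρ : Matrix d d ℂ) : ℝ :=
  (cfc Real.negMulLog ρ).trace.re

/-- The generalised Gibbs state `exp (- ∑ j, b j Q j) / tr (exp (- ∑ j, b j Q j))`. -/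
def gibbs {ι d : Type*} [Fintype ι] [Fintype d] [DecidableEq d]
    (b : ι → ℝ) (Q : ι → Matrix d d ℂ) : Matrix d d ℂ :=
  (NormedSpace.exp (-∑ j, (b j : ℂ) • Q j)).trace⁻¹ • NormedSpace.exp (-∑ j, (b j : ℂ) • Q j)

/-- The class `[v]_Q` of the microstates compatible with the macrostate `(v, Q)`: all density
matrices `ρ` with `tr (ρ Q j) = v j` for all `j`. -/
def microstates {ι d : Type*} [Fintype d]
    (Q : ι → Matrix d d ℂ) (v : ι → ℝ) : Set (Matrix d d ℂ) :=
  {ρ | IsDensity ρ ∧ ∀ j, expect ρ (Q j) = v j}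

/-- `γ` is the maximum-entropy (generalised Gibbs) ensemble of the macrostate `(v, Q)`: it has the
expectation values `v` and it is of the form `gibbs b Q`, where the inverse temperatures `b` may
also be infinite, that is, a limit of such states is allowed. (Infinite inverse temperatures are
needed for the values `v` on the boundary of the set of attainable values; for the energy, these are
the ground state energy and the highest energy.) -/
def IsEnsemble {ι d : Type*} [Fintype ι] [Fintype d] [DecidableEq d]
    (Q : ι → Matrix d d ℂ) (v : ι → ℝ) (γ : Matrix d d ℂ) : Prop :=
  γ ∈ closure (Set.range fun b : ι → ℝ => gibbs b Q) ∧ ∀ j, expect γ (Q j) = v j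

open Classical in
/-- The ensemble `γ_v(Q)` of the macrostate `(v, Q)` (zero if there is none). -/
def ensemble {ι d : Type*} [Fintype ι] [Fintype d] [DecidableEq d]
    (Q : ι → Matrix d d ℂ) (v : ι → ℝ) : Matrix d d ℂ :=
  if h : ∃ γ, IsEnsemble Q v γ then h.choose else 0

/-! ### Composite systems -/

/-- The tensor product `⨂ l, A l` of matrices. -/
def piTensor {N : ℕ} {D : Fin N → ℕ} (A : (l : Fin N) → Matrix (Fin (D l)) (Fin (D l)) ℂ) :
    Matrix ((l : Fin N) → Fin (D l)) ((l : Fin N) → Fin (D l)) ℂ :=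
  Matrix.of fun a b => ∏ l, A l (a l) (b l)

/-- The partial trace over the second factor. -/
def partialTrace {d e : Type*} [Fintype e] (A : Matrix (d × e) (d × e) ℂ) : Matrix d d ℂ :=
  Matrix.of fun i j => ∑ k, A (i, k) (j, k)

/-- An environment: `N` finite-dimensional systems, each with its commuting conserved
observables `Q l j`. -/
structure Environment (ι : Type*) where
  N : ℕ
  dim : Fin N → ℕ
  dim_pos : ∀ l, 0 < dim l
  Q : (l : Fin N) → ι → Matrix (Fin (dim l)) (Fin (dim l)) ℂ
  hermitian : ∀ l j, (Q l j).IsHermitian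
  commute : ∀ l i j, Commute (Q l i) (Q l j)

namespace Environment

variable {ι : Type*} (E : Environment ι)

/-- The index set of the basis of the Hilbert space of the environment. -/
abbrev Idx : Type := (l : Fin E.N) → Fin (E.dim l)

/-- Families of matrices, one for each of the systems of the environment. -/
abbrev Family : Type := (l : Fin E.N) → Matrix (Fin (E.dim l)) (Fin (E.dim l)) ℂ

/-- The `j`-th observable of the environment: the sum over `l` of
`1 ⊗ ⋯ ⊗ Q l j ⊗ ⋯ ⊗ 1`. -/
def charge (j : ι) : Matrix E.Idx E.Idx ℂ :=
  ∑ l, piTensor (Function.update (fun _ => 1) l (E.Q l j))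

/-- The `j`-th observable of the compound of the system and the environment. -/
def totalCharge {d : Type*} [DecidableEq d] (Q : ι → Matrix d d ℂ) (j : ι) :
    Matrix (d × E.Idx) (d × E.Idx) ℂ :=
  Q j ⊗ₖ (1 : Matrix E.Idx E.Idx ℂ) + (1 : Matrix d d ℂ) ⊗ₖ E.charge j

/-- The microstates of the `N` systems compatible with the macrostates in which each
observable has its thermal expectation value at the inverse temperatures `β`. -/
def thermalMicrostates [Fintype ι] (β : ι → ℝ) : Set E.Family :=
  {σ | ∀ l, σ l ∈ microstates (E.Q l) fun j => expect (gibbs β (E.Q l)) (E.Q l j)}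

/-- The Gibbs states of the `N` systems at the inverse temperatures `β`. -/
def gibbsFamily [Fintype ι] (β : ι → ℝ) : E.Family := fun l => gibbs β (E.Q l)

/-- The initial state `ρ ⊗ ⨂ l, σ l` of the compound. -/
def initial {d : Type*} (ρ : Matrix d d ℂ) (σ : E.Family) :
    Matrix (d × E.Idx) (d × E.Idx) ℂ :=
  ρ ⊗ₖ piTensor σ

/-- The final state `U (ρ ⊗ ⨂ l, σ l) U†` of the compound. -/
def final {d : Type*} [Fintype d] [DecidableEq d] (U : Matrix.unitaryGroup (d × E.Idx) ℂ)
    (ρ : Matrix d d ℂ) (σ : E.Family) : Matrix (d × E.Idx) (d × E.Idx) ℂ :=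
  (U : Matrix (d × E.Idx) (d × E.Idx) ℂ) * E.initial ρ σ *
    (U : Matrix (d × E.Idx) (d × E.Idx) ℂ).conjTranspose

/-- The decrease of the expectation value of the `j`-th total observable under `U`. -/
def decrease {d : Type*} [Fintype d] [DecidableEq d] (Q : ι → Matrix d d ℂ)
    (U : Matrix.unitaryGroup (d × E.Idx) ℂ) (ρ : Matrix d d ℂ) (σ : E.Family) (j : ι) : ℝ :=
  expect (E.initial ρ σ) (E.totalCharge Q j) - expect (E.final U ρ σ) (E.totalCharge Q j)

end Environment

/-! ### Macrostate operations -/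

/-- `(v, Q) → ρf` by macrostate operations at the inverse temperatures `β`: up to arbitrarily small
errors, a single unitary on the system and some environment takes all microstates compatible with
the macrostates to `ρf`, while preserving the expectation values of all total observables. -/
def MacReach {ι d : Type*} [Fintype ι] [Fintype d] [DecidableEq d]
    (β : ι → ℝ) (Q : ι → Matrix d d ℂ) (v : ι → ℝ) (ρf : Matrix d d ℂ) : Prop :=
  ∀ ε > (0 : ℝ), ∀ ε' > (0 : ℝ),
    ∃ (E : Environment ι) (U : Matrix.unitaryGroup (d × E.Idx) ℂ),
      ∀ ρ ∈ microstates Q v, ∀ σ ∈ E.thermalMicrostates β,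
        traceNorm (partialTrace (E.final U ρ σ) - ρf) ≤ ε ∧
        ∀ j, |E.decrease Q U ρ σ j| ≤ ε'

/-- `(v, Q) → (v', Q)` by macrostate operations: up to arbitrarily small errors, a single unitary on
the system and some environment takes all microstates compatible with the initial macrostates to
(possibly different) microstates compatible with the final one, while preserving the expectation
values of all total observables. -/
def MacToMac {ι d : Type*} [Fintype ι] [Fintype d] [DecidableEq d]
    (β : ι → ℝ) (Q : ι → Matrix d d ℂ) (v v' : ι → ℝ) : Prop :=
  ∀ ε > (0 : ℝ), ∀ ε' > (0 : ℝ),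
    ∃ (E : Environment ι) (U : Matrix.unitaryGroup (d × E.Idx) ℂ),
      ∀ ρ ∈ microstates Q v, ∀ σ ∈ E.thermalMicrostates β,
        (∃ ρ' ∈ microstates Q v', traceNorm (partialTrace (E.final U ρ σ) - ρ') ≤ ε) ∧
        ∀ j, |E.decrease Q U ρ σ j| ≤ ε'

/-- The free entropy `∑ j, β j tr (ρ Q j) - S(ρ)`. -/
def freeEntropy {ι d : Type*} [Fintype ι] [Fintype d] [DecidableEq d]
    (β : ι → ℝ) (Q : ι → Matrix d d ℂ) (ρ : Matrix d d ℂ) : ℝ :=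
  ∑ j, β j * expect ρ (Q j) - vonNeumannEntropy ρ

/-! ### The energy as the only observable -/

section Energy

variable {d : Type*} [Fintype d] [DecidableEq d]

/-- The microstates of mean energy `e`. -/
def energyMicrostates (H : Matrix d d ℂ) (e : ℝ) : Set (Matrix d d ℂ) :=
  microstates (fun _ : Unit => H) fun _ => e

/-- `γ` is the canonical ensemble of the macrostate `(e, H)`. -/
def IsCanonical (H : Matrix d d ℂ) (e : ℝ) (γ : Matrix d d ℂ) : Prop :=
  IsEnsemble (fun _ : Unit => H) (fun _ => e) γ

/-- The canonical ensemble `γ_e(H)`. -/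
def canonical (H : Matrix d d ℂ) (e : ℝ) : Matrix d d ℂ :=
  ensemble (fun _ : Unit => H) fun _ => e

/-- The Gibbs state `γ_β(H)` at inverse temperature `β`. -/
def thermal (β : ℝ) (H : Matrix d d ℂ) : Matrix d d ℂ :=
  gibbs (fun _ : Unit => β) fun _ => H

/-- `(e, H) → ρf` by macrostate operations at inverse temperature `β`. -/
def EnergyMacReach (β : ℝ) (H : Matrix d d ℂ) (e : ℝ) (ρf : Matrix d d ℂ) : Prop :=
  MacReach (fun _ : Unit => β) (fun _ => H) (fun _ => e) ρf

/-- `(e, H) → (e', H)` by macrostate operations at inverse temperature `β`. -/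
def EnergyMacToMac (β : ℝ) (H : Matrix d d ℂ) (e e' : ℝ) : Prop :=
  MacToMac (fun _ : Unit => β) (fun _ => H) (fun _ => e) fun _ => e'

/-- The nonequilibrium free energy `tr (ρ H) - S(ρ) / β`. -/
def freeEnergy (β : ℝ) (H ρ : Matrix d d ℂ) : ℝ :=
  expect ρ H - vonNeumannEntropy ρ / β

/-- The free energy `F(e, H)` of a macrostate. -/
def macroFreeEnergy (β : ℝ) (H : Matrix d d ℂ) (e : ℝ) : ℝ := freeEnergy β H (canonical H e)

/-- The Gibbs entropy `S(e, H) = (e - F(e, H)) / T` of a macrostate, with `T = 1 / β`. -/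
def macroEntropy (β : ℝ) (H : Matrix d d ℂ) (e : ℝ) : ℝ :=
  (e - macroFreeEnergy β H e) / (1 / β)

/-- The energy decrease of the system with an environment under `U`, that is, the work extracted
by `U`. -/
def work (H : Matrix d d ℂ) (E : Environment Unit) (U : Matrix.unitaryGroup (d × E.Idx) ℂ)
    (ρ : Matrix d d ℂ) (σ : E.Family) : ℝ :=
  E.decrease (fun _ => H) U ρ σ ()

/-- The amounts of work that can be extracted from the macrostate `(e, H)`: up to arbitrarily small
errors, a single unitary on the system and some environment extracts the work `W` for all
microstates compatible with the macrostates. -/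
def extractableWork (β : ℝ) (H : Matrix d d ℂ) (e : ℝ) : Set ℝ :=
  {W | ∀ ε > (0 : ℝ), ∃ (E : Environment Unit) (U : Matrix.unitaryGroup (d × E.Idx) ℂ),
    ∀ ρ ∈ energyMicrostates H e, ∀ σ ∈ E.thermalMicrostates (fun _ => β),
      |work H E U ρ σ - W| ≤ ε}

/-- The amounts of work that can be extracted from the macrostate `(e, H)` while the system is taken
to the state `ρf`. -/
def extractableWorkTo (β : ℝ) (H : Matrix d d ℂ) (e : ℝ) (ρf : Matrix d d ℂ) : Set ℝ :=
  {W | ∀ ε > (0 : ℝ), ∀ ε' > (0 : ℝ),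
    ∃ (E : Environment Unit) (U : Matrix.unitaryGroup (d × E.Idx) ℂ),
      ∀ ρ ∈ energyMicrostates H e, ∀ σ ∈ E.thermalMicrostates (fun _ => β),
        traceNorm (partialTrace (E.final U ρ σ) - ρf) ≤ ε ∧ |work H E U ρ σ - W| ≤ ε'}

/-- The amounts of work that unitaries can extract from the system in the microstate `ρ` together
with environments in their Gibbs states. -/
def microWork (β : ℝ) (H ρ : Matrix d d ℂ) : Set ℝ :=
  {W | ∃ (E : Environment Unit) (U : Matrix.unitaryGroup (d × E.Idx) ℂ),
    W = work H E U ρ (E.gibbsFamily fun _ => β)}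

end Energy

end MacroThermo

end

noncomputable section

namespace MacroThermo

set_option linter.unusedSectionVars false

/-! ### Unitarily diagonalised matrices -/

section Basics

variable {d : Type*} [Fintype d] [DecidableEq d]

/-! Write G for `freeEntropy`. Everything reduces to one statement: with final state `ρf`,
prescribed decreases `w j` of the total observables can be approached for all microstates at once
exactly when `∑ j, β j * w j` is at most G(γ_v) - G(ρf). The second law is the case `w = 0`; the
work statements are the case of one observable, where G is `β` times the free energy.

Necessity. The Gibbs states of the environment and γ_v itself are admissible microstates. A unitary
preserves the total entropy, and minus the logarithm of the Gibbs state is `∑ j, β j • charge j`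
plus a constant. Klein's inequality (`sum_negMulLog_le`) between the final state and the product of
its system marginal with the Gibbs state therefore bounds the weighted decrease by the drop of G
(`Environment.sum_mul_decrease_le`). The errors are removed by bounding the entropy from above by
functionals linear in the state, which are Lipschitz and nearly tight where needed
(`le_freeEntropy_sub`).

Sufficiency. The environment consists of qubits with charges `0` and `h j`. Their mean charges fix
their populations, and the gates never use their unknown coherences. Exchanging a transition of the
system with a sequence of fresh qubits of slowly varying gap is reversible: the gap `logOdds u` is
the derivative of the binary entropy, so the cost integrates to an entropy difference
(`Drives.quasistatic`). Merging all levels and populating them anew turns unknown populations `p`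
into `r` at the cost `∑ p (-log q) - S(r)`, for any fixed positive distribution `q`
(`drives_const`). This cost is linear in `p`. If `q` is a Gibbs distribution with parameters `b`,
then `-log q` is a combination of the observables and a constant, so the cost depends only on the
macrostate: it is `dual lam v b - S(r)`, the same for every microstate. Since `dual lam v b` comes
arbitrarily close to the entropy of γ_v (`IsEnsemble.exists_dual_le`), nothing is lost in the limit.
Nearly unbiased qubits dephase the result, the inversion of one qubit redistributes the observables
(`exists_inversion`), and a rotation into the eigenbasis of `ρf` completes the process
(`exists_process`).

The ensemble exists because regularised minimisers of `dual` are Gibbs states with nearly the right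
expectation values (`exists_expect_gibbs_near`), and it is unique by strict concavity of the
entropy. -/

/-- The matrix with eigenvalues `p` and with the columns of `W` as eigenvectors. -/
def conjDiag (W : Matrix d d ℂ) (p : d → ℝ) : Matrix d d ℂ :=
  W * Matrix.diagonal (fun i => (p i : ℂ)) * W.conjTranspose

/-- The diagonal of a matrix in the basis given by the columns of `W`. -/
def pop (W A : Matrix d d ℂ) (i : d) : ℝ := ((W.conjTranspose * A * W) i i).re

theorem conjTranspose_mul_self_of_mem {W : Matrix d d ℂ} (hW : W ∈ Matrix.unitaryGroup d ℂ) :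
    W.conjTranspose * W = 1 := Matrix.mem_unitaryGroup_iff'.1 hW

theorem mul_conjTranspose_self_of_mem {W : Matrix d d ℂ} (hW : W ∈ Matrix.unitaryGroup d ℂ) :
    W * W.conjTranspose = 1 := Matrix.mem_unitaryGroup_iff.1 hW

theorem conjTranspose_mem {W : Matrix d d ℂ} (hW : W ∈ Matrix.unitaryGroup d ℂ) :
    W.conjTranspose ∈ Matrix.unitaryGroup d ℂ :=
  Matrix.mem_unitaryGroup_iff.2 (by
    simpa [Matrix.star_eq_conjTranspose] using conjTranspose_mul_self_of_mem hW)

theorem sum_normSq_col {Y : Matrix d d ℂ} (hY : Y ∈ Matrix.unitaryGroup d ℂ) (a : d) :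
    ∑ b, Complex.normSq (Y b a) = 1 := by
  have h := congrFun (congrFun (conjTranspose_mul_self_of_mem hY) a) a
  simp only [Matrix.mul_apply, Matrix.conjTranspose_apply, Matrix.one_apply_eq] at h
  have h2 := congrArg Complex.re h
  simp only [Complex.re_sum, Complex.one_re] at h2
  rw [← h2]
  refine Finset.sum_congr rfl fun b _ => ?_
  simp [Complex.normSq_apply]

theorem sum_normSq_row {Y : Matrix d d ℂ} (hY : Y ∈ Matrix.unitaryGroup d ℂ) (b : d) :
    ∑ a, Complex.normSq (Y b a) = 1 := by
  have h := sum_normSq_col (conjTranspose_mem hY) b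
  simpa [Matrix.conjTranspose_apply, Complex.normSq_conj] using h

theorem conj_conjDiag (W X : Matrix d d ℂ) (p : d → ℝ) :
    W * conjDiag X p * W.conjTranspose = conjDiag (W * X) p := by
  simp [conjDiag, Matrix.mul_assoc]

theorem pop_conjDiag (W X : Matrix d d ℂ) (p : d → ℝ) (b : d) :
    pop W (conjDiag X p) b =
      ∑ a, p a * Complex.normSq ((W.conjTranspose * X) b a) := by
  have : W.conjTranspose * conjDiag X p * W = conjDiag (W.conjTranspose * X) p := by
    simp [conjDiag, Matrix.mul_assoc]
  rw [pop, this, conjDiag, Matrix.mul_apply, Complex.re_sum]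
  refine Finset.sum_congr rfl fun a _ => ?_
  rw [Matrix.mul_diagonal, Matrix.conjTranspose_apply, Complex.star_def,
    mul_right_comm, Complex.mul_conj, ← Complex.ofReal_mul, Complex.ofReal_re, mul_comm]

theorem pop_conjDiag_self {W : Matrix d d ℂ} (hW : W ∈ Matrix.unitaryGroup d ℂ) (p : d → ℝ)
    (b : d) : pop W (conjDiag W p) b = p b := by
  rw [pop_conjDiag, conjTranspose_mul_self_of_mem hW]
  simp [Matrix.one_apply, apply_ite]

theorem sum_pop {W : Matrix d d ℂ} (hW : W ∈ Matrix.unitaryGroup d ℂ) (A : Matrix d d ℂ) :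
    ∑ b, pop W A b = A.trace.re := by
  have : (W.conjTranspose * A * W).trace = A.trace := by
    rw [Matrix.trace_mul_comm, ← Matrix.mul_assoc, mul_conjTranspose_self_of_mem hW,
      Matrix.one_mul]
  rw [← this, Matrix.trace, Complex.re_sum]
  rfl

theorem pop_nonneg (W : Matrix d d ℂ) {A : Matrix d d ℂ} (hA : A.PosSemidef) (b : d) :
    0 ≤ pop W A b := by
  have h := hA.conjTranspose_mul_mul_same W
  exact (Complex.le_def.1 (h.diag_nonneg (i := b))).1

theorem expect_conjDiag (W ρ : Matrix d d ℂ) (p : d → ℝ) :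
    expect ρ (conjDiag W p) = ∑ i, pop W ρ i * p i := by
  have : (ρ * conjDiag W p).trace =
      (W.conjTranspose * ρ * W * Matrix.diagonal (fun i => (p i : ℂ))).trace := by
    rw [conjDiag, ← Matrix.mul_assoc, Matrix.trace_mul_comm]
    simp [Matrix.mul_assoc]
  rw [expect, this, Matrix.trace, Complex.re_sum]
  refine Finset.sum_congr rfl fun i _ => ?_
  rw [Matrix.diag_apply, Matrix.mul_diagonal, Complex.re_mul_ofReal]
  rfl

theorem isHermitian_conjDiag (W : Matrix d d ℂ) (p : d → ℝ) : (conjDiag W p).IsHermitian := by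
  refine Matrix.isHermitian_mul_mul_conjTranspose W ?_
  rw [Matrix.isHermitian_diagonal_iff]
  intro i
  exact Complex.conj_ofReal _

theorem trace_conjDiag {W : Matrix d d ℂ} (hW : W ∈ Matrix.unitaryGroup d ℂ) (p : d → ℝ) :
    (conjDiag W p).trace = ((∑ i, p i : ℝ) : ℂ) := by
  rw [conjDiag, Matrix.trace_mul_comm, ← Matrix.mul_assoc, conjTranspose_mul_self_of_mem hW,
    Matrix.one_mul, Matrix.trace_diagonal, Complex.ofReal_sum]

theorem isDensity_conjDiag {W : Matrix d d ℂ} (hW : W ∈ Matrix.unitaryGroup d ℂ) {p : d → ℝ}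
    (hp : ∀ i, 0 ≤ p i) (hp1 : ∑ i, p i = 1) : IsDensity (conjDiag W p) := by
  refine ⟨Matrix.PosSemidef.mul_mul_conjTranspose_same ?_ W, ?_⟩
  · rw [Matrix.posSemidef_diagonal_iff]
    intro i
    exact_mod_cast hp i
  · rw [trace_conjDiag hW, hp1, Complex.ofReal_one]

theorem exists_conjDiag_of_isHermitian {A : Matrix d d ℂ} (hA : A.IsHermitian) :
    ∃ W ∈ Matrix.unitaryGroup d ℂ, A = conjDiag W hA.eigenvalues := by
  refine ⟨hA.eigenvectorUnitary, hA.eigenvectorUnitary.2, ?_⟩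
  conv_lhs => rw [hA.spectral_theorem]
  rfl

/-- The relative entropy of a state with respect to a state given by its spectral decomposition is
nonnegative. -/
theorem sum_negMulLog_le {X W : Matrix d d ℂ} (hX : X ∈ Matrix.unitaryGroup d ℂ)
    (hW : W ∈ Matrix.unitaryGroup d ℂ) {lam q : d → ℝ} (hlam : ∀ a, 0 ≤ lam a)
    (hlam1 : ∑ a, lam a = 1) (hq : ∀ b, 0 ≤ q b) (hq1 : ∑ b, q b ≤ 1)
    (hsupp : ∀ b, q b = 0 → pop W (conjDiag X lam) b = 0) :
    ∑ a, Real.negMulLog (lam a) ≤ ∑ b, pop W (conjDiag X lam) b * -Real.log (q b) := by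
  have hY : W.conjTranspose * X ∈ Matrix.unitaryGroup d ℂ :=
    mul_mem (conjTranspose_mem hW) hX
  -- The overlaps of the two eigenbases form a doubly stochastic matrix. Weighted with it, the
  -- scalar inequality `x - y ≤ x log x - x log y` sums to the claim, the left side giving `1 - ∑ q
  -- ≥ 0`.
  set M : d → d → ℝ := fun b a => Complex.normSq ((W.conjTranspose * X) b a) with hM
  have hM0 : ∀ b a, 0 ≤ M b a := fun b a => Complex.normSq_nonneg _
  have hcol : ∀ a, ∑ b, M b a = 1 := sum_normSq_col hY
  have hrow : ∀ b, ∑ a, M b a = 1 := sum_normSq_row hY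
  have hpop : ∀ b, pop W (conjDiag X lam) b = ∑ a, lam a * M b a := pop_conjDiag W X lam
  have key : ∀ b a, M b a * (lam a - q b) ≤
      M b a * lam a * Real.log (lam a) + lam a * M b a * -Real.log (q b) := by
    intro b a
    rcases (hq b).eq_or_lt with h0 | h0
    -- Where `q b = 0` the support condition annihilates every term `lam a * M b a`, so the value
    -- `Real.log 0 = 0` does no harm.
    · have h1 : ∑ a, lam a * M b a = 0 := by rw [← hpop]; exact hsupp b h0.symm
      have h2 := (Finset.sum_eq_zero_iff_of_nonneg
        (fun a _ => mul_nonneg (hlam a) (hM0 b a))).1 h1 a (Finset.mem_univ _)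
      rw [← h0, mul_comm (M b a) (lam a), h2, sub_zero, mul_comm, h2]
      simp
    · rcases (hlam a).eq_or_lt with h1 | h1
      · rw [← h1]
        have := mul_nonneg (hM0 b a) h0.le
        simp only [zero_sub, mul_neg, mul_zero, Real.log_zero, zero_mul, neg_zero, add_zero]
        linarith
      · have h2 := Real.log_le_sub_one_of_pos (div_pos h0 h1)
        rw [Real.log_div h0.ne' h1.ne'] at h2
        have h3 : lam a * (Real.log (q b) - Real.log (lam a)) ≤ q b - lam a := by
          calc _ ≤ lam a * (q b / lam a - 1) := mul_le_mul_of_nonneg_left h2 h1.le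
            _ = _ := by field_simp
        nlinarith [mul_le_mul_of_nonneg_left h3 (hM0 b a)]
  have hsum := Finset.sum_le_sum fun b (_ : b ∈ Finset.univ) =>
    Finset.sum_le_sum fun a (_ : a ∈ Finset.univ) => key b a
  simp only [Finset.sum_add_distrib, mul_sub, Finset.sum_sub_distrib] at hsum
  have e1 : ∑ b, ∑ a, M b a * lam a = 1 := by
    rw [Finset.sum_comm, ← hlam1]
    exact Finset.sum_congr rfl fun a _ => by rw [← Finset.sum_mul, hcol, one_mul]
  have e2 : ∑ b, ∑ a, M b a * q b = ∑ b, q b :=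
    Finset.sum_congr rfl fun b _ => by rw [← Finset.sum_mul, hrow, one_mul]
  have e3 : ∑ b, ∑ a, M b a * lam a * Real.log (lam a) = -∑ a, Real.negMulLog (lam a) := by
    rw [Finset.sum_comm, ← Finset.sum_neg_distrib]
    refine Finset.sum_congr rfl fun a _ => ?_
    rw [← Finset.sum_mul, ← Finset.sum_mul, hcol, one_mul, Real.negMulLog]
    ring
  have e4 : ∑ b, ∑ a, lam a * M b a * -Real.log (q b) =
      ∑ b, pop W (conjDiag X lam) b * -Real.log (q b) :=
    Finset.sum_congr rfl fun b _ => by rw [hpop, Finset.sum_mul]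
  rw [e1, e2, e3, e4] at hsum
  linarith

theorem IsDensity.exists_conjDiag {ρ : Matrix d d ℂ} (hρ : IsDensity ρ) :
    ∃ W ∈ Matrix.unitaryGroup d ℂ, ∃ p : d → ℝ, (∀ i, 0 ≤ p i) ∧ ∑ i, p i = 1 ∧
      ρ = conjDiag W p ∧ vonNeumannEntropy ρ = ∑ i, Real.negMulLog (p i) := by
  obtain ⟨W, hW, h⟩ := exists_conjDiag_of_isHermitian hρ.1.isHermitian
  refine ⟨W, hW, _, hρ.1.eigenvalues_nonneg, ?_, h, ?_⟩
  · have h1 := hρ.2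
    rw [h, trace_conjDiag hW] at h1
    exact_mod_cast h1
  · rw [vonNeumannEntropy, hρ.1.isHermitian.cfc_eq, Matrix.IsHermitian.cfc]
    have : ∀ f : d → ℝ, (Unitary.conjStarAlgAut ℂ _ hρ.1.isHermitian.eigenvectorUnitary
        (Matrix.diagonal (RCLike.ofReal ∘ f))) =
        conjDiag (hρ.1.isHermitian.eigenvectorUnitary : Matrix d d ℂ) f := fun f => rfl
    erw [this]
    rw [trace_conjDiag hρ.1.isHermitian.eigenvectorUnitary.2, Complex.ofReal_re]
    rfl

/-- The functional calculus chooses its own eigenbasis. Klein's inequality, applied in both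
directions between that diagonalisation and the given one, shows that the choice does not matter. -/
theorem entropy_conjDiag {W : Matrix d d ℂ} (hW : W ∈ Matrix.unitaryGroup d ℂ) {p : d → ℝ}
    (hp : ∀ i, 0 ≤ p i) (hp1 : ∑ i, p i = 1) :
    vonNeumannEntropy (conjDiag W p) = ∑ i, Real.negMulLog (p i) := by
  obtain ⟨X, hX, r, hr, hr1, h, hS⟩ := (isDensity_conjDiag hW hp hp1).exists_conjDiag
  rw [hS]
  have h1 : ∀ b, pop W (conjDiag X r) b = p b := fun b => by rw [← h, pop_conjDiag_self hW]
  have h2 : ∀ b, pop X (conjDiag W p) b = r b := fun b => by rw [h, pop_conjDiag_self hX]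
  apply le_antisymm
  · refine (sum_negMulLog_le hX hW hr hr1 hp hp1.le fun b hb => by rw [h1, hb]).trans_eq ?_
    refine Finset.sum_congr rfl fun b _ => ?_
    rw [h1, Real.negMulLog]; ring
  · refine (sum_negMulLog_le hW hX hp hp1 hr hr1.le fun b hb => by rw [h2, hb]).trans_eq ?_
    refine Finset.sum_congr rfl fun b _ => ?_
    rw [h2, Real.negMulLog]; ring

/-- An upper bound for the entropy that is linear in the state. -/
theorem entropy_le {W : Matrix d d ℂ} (hW : W ∈ Matrix.unitaryGroup d ℂ) {ρ : Matrix d d ℂ}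
    (hρ : IsDensity ρ) {q : d → ℝ} (hq : ∀ b, 0 ≤ q b) (hq1 : ∑ b, q b ≤ 1)
    (hsupp : ∀ b, q b = 0 → pop W ρ b = 0) :
    vonNeumannEntropy ρ ≤ ∑ b, pop W ρ b * -Real.log (q b) := by
  obtain ⟨X, hX, r, hr, hr1, h, hS⟩ := hρ.exists_conjDiag
  rw [hS, h]
  rw [h] at hsupp
  exact sum_negMulLog_le hX hW hr hr1 hq hq1 hsupp

/-! ### The trace norm -/

theorem trace_conjTranspose_mul_self (A : Matrix d d ℂ) :
    (A.conjTranspose * A).trace = ((∑ i, ∑ j, Complex.normSq (A i j) : ℝ) : ℂ) := by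
  rw [Matrix.trace, Finset.sum_comm, Complex.ofReal_sum]
  refine Finset.sum_congr rfl fun j _ => ?_
  rw [Matrix.diag_apply, Matrix.mul_apply, Complex.ofReal_sum]
  refine Finset.sum_congr rfl fun i _ => ?_
  rw [Matrix.conjTranspose_apply, Complex.star_def, Complex.normSq_eq_conj_mul_self]

theorem sum_eigenvalues_conjTranspose_mul_self (A : Matrix d d ℂ) :
    ∑ i, (Matrix.isHermitian_conjTranspose_mul_self A).eigenvalues i =
      ∑ i, ∑ j, Complex.normSq (A i j) := by
  have h := (Matrix.isHermitian_conjTranspose_mul_self A).trace_eq_sum_eigenvalues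
  rw [trace_conjTranspose_mul_self] at h
  exact Complex.ofReal_injective (h.trans (Complex.ofReal_sum _ _).symm).symm

/-- The sum of the squared moduli of the entries is the sum of the squared singular values, which is
at most the square of their sum. -/
theorem norm_apply_le_traceNorm (A : Matrix d d ℂ) (i j : d) : ‖A i j‖ ≤ traceNorm A := by
  have h0 := (Matrix.posSemidef_conjTranspose_mul_self A).eigenvalues_nonneg
  have h1 : ‖A i j‖ ^ 2 ≤ traceNorm A ^ 2 := by
    calc ‖A i j‖ ^ 2 = Complex.normSq (A i j) := (Complex.normSq_eq_norm_sq _).symm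
      _ ≤ ∑ j, Complex.normSq (A i j) :=
        Finset.single_le_sum (f := fun j => Complex.normSq (A i j))
          (fun j _ => Complex.normSq_nonneg _) (Finset.mem_univ j)
      _ ≤ ∑ i, ∑ j, Complex.normSq (A i j) :=
        Finset.single_le_sum (f := fun i => ∑ j, Complex.normSq (A i j))
          (fun i _ => Finset.sum_nonneg fun j _ => Complex.normSq_nonneg _) (Finset.mem_univ i)
      _ = ∑ i, √((Matrix.isHermitian_conjTranspose_mul_self A).eigenvalues i) ^ 2 := by
        rw [← sum_eigenvalues_conjTranspose_mul_self]
        exact Finset.sum_congr rfl fun i _ => (Real.sq_sqrt (h0 i)).symm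
      _ ≤ traceNorm A ^ 2 :=
        Finset.sum_sq_le_sq_sum_of_nonneg fun i _ => Real.sqrt_nonneg _
  exact le_of_sq_le_sq h1 (Finset.sum_nonneg fun i _ => Real.sqrt_nonneg _)

theorem traceNorm_le {A : Matrix d d ℂ} {δ : ℝ} (hA : ∀ i j, ‖A i j‖ ≤ δ) (hδ : 0 ≤ δ) :
    traceNorm A ≤ (Fintype.card d : ℝ) ^ 2 * δ := by
  have h0 := (Matrix.posSemidef_conjTranspose_mul_self A).eigenvalues_nonneg
  set D : ℝ := (Fintype.card d : ℝ) with hD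
  have hD0 : 0 ≤ D := Nat.cast_nonneg _
  have h1 : traceNorm A ^ 2 ≤ D * (D * (D * δ ^ 2)) := by
    calc traceNorm A ^ 2 ≤ D * ∑ i, √((Matrix.isHermitian_conjTranspose_mul_self A).eigenvalues i) ^ 2 := by
          simpa [hD, traceNorm] using sq_sum_le_card_mul_sum_sq (s := Finset.univ)
            (f := fun i => √((Matrix.isHermitian_conjTranspose_mul_self A).eigenvalues i))
      _ = D * ∑ i, ∑ j, Complex.normSq (A i j) := by
        rw [← sum_eigenvalues_conjTranspose_mul_self]
        congr 1
        exact Finset.sum_congr rfl fun i _ => Real.sq_sqrt (h0 i)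
      _ ≤ D * ∑ _i : d, ∑ _j : d, δ ^ 2 := by
        gcongr with i _ j _
        rw [Complex.normSq_eq_norm_sq]
        exact pow_le_pow_left₀ (norm_nonneg _) (hA i j) 2
      _ = _ := by simp [hD]
  -- Cauchy–Schwarz gives `D ^ 3 * δ ^ 2`; the weaker `D ^ 4 * δ ^ 2` is a perfect square but needs
  -- `1 ≤ D`, whence the separate empty case.
  refine le_of_sq_le_sq (h1.trans ?_) (by positivity)
  rcases Nat.eq_zero_or_pos (Fintype.card d) with h | h
  · simp [hD, h]
  · have : (1 : ℝ) ≤ D := Nat.one_le_cast.2 h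
    nlinarith [mul_nonneg (pow_nonneg hD0 3) (sq_nonneg δ)]

end Basics

end MacroThermo

end

noncomputable section

namespace MacroThermo

set_option linter.unusedSectionVars false

/-! ### Expectation values, their continuity, and affine bounds for the entropy -/

section Expect

variable {d : Type*} [Fintype d] [DecidableEq d]

theorem expect_add_right (ρ A B : Matrix d d ℂ) : expect ρ (A + B) = expect ρ A + expect ρ B := by
  simp [expect, Matrix.mul_add]

theorem expect_sub_left (ρ σ A : Matrix d d ℂ) : expect (ρ - σ) A = expect ρ A - expect σ A := by
  simp [expect, Matrix.sub_mul]

theorem expect_smul_right (ρ A : Matrix d d ℂ) (c : ℝ) :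
    expect ρ ((c : ℂ) • A) = c * expect ρ A := by
  simp [expect]

theorem expect_sum_right {κ : Type*} (s : Finset κ) (ρ : Matrix d d ℂ) (A : κ → Matrix d d ℂ) :
    expect ρ (∑ j ∈ s, A j) = ∑ j ∈ s, expect ρ (A j) := by
  simp [expect, Finset.mul_sum, Matrix.trace_sum]

theorem expect_one (ρ : Matrix d d ℂ) : expect ρ 1 = ρ.trace.re := by
  simp [expect]

/-- The constant in the continuity estimate `abs_expect_le`. -/
def entrySum (A : Matrix d d ℂ) : ℝ := ∑ i, ∑ j, ‖A j i‖

theorem entrySum_nonneg (A : Matrix d d ℂ) : 0 ≤ entrySum A :=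
  Finset.sum_nonneg fun _ _ => Finset.sum_nonneg fun _ _ => norm_nonneg _

theorem abs_expect_le_of_norm_le {ρ : Matrix d d ℂ} {δ : ℝ} (h : ∀ i j, ‖ρ i j‖ ≤ δ)
    (A : Matrix d d ℂ) : |expect ρ A| ≤ δ * entrySum A := by
  calc |expect ρ A| ≤ ‖(ρ * A).trace‖ := Complex.abs_re_le_norm _
    _ ≤ ∑ i, ∑ j, ‖ρ i j * A j i‖ := by
      rw [Matrix.trace]
      refine (norm_sum_le _ _).trans (Finset.sum_le_sum fun i _ => ?_)
      rw [Matrix.diag_apply, Matrix.mul_apply]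
      exact norm_sum_le _ _
    _ ≤ ∑ i, ∑ j, δ * ‖A j i‖ := by
      gcongr with i _ j _
      rw [norm_mul]
      exact mul_le_mul_of_nonneg_right (h i j) (norm_nonneg _)
    _ = _ := by simp [entrySum, Finset.mul_sum]

theorem abs_expect_le (ρ A : Matrix d d ℂ) : |expect ρ A| ≤ traceNorm ρ * entrySum A :=
  abs_expect_le_of_norm_le (norm_apply_le_traceNorm ρ) A

theorem sum_pop_of_isDensity {W ρ : Matrix d d ℂ} (hW : W ∈ Matrix.unitaryGroup d ℂ)
    (hρ : IsDensity ρ) : ∑ b, pop W ρ b = 1 := by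
  rw [sum_pop hW, hρ.2, Complex.one_re]

/-- The entropy is bounded by affine functions that are almost tight at a given state. -/
theorem exists_entropy_le_expect {ρf : Matrix d d ℂ} (hf : IsDensity ρf) {η : ℝ} (hη : 0 < η) :
    ∃ K : Matrix d d ℂ, (∀ ρ, IsDensity ρ → vonNeumannEntropy ρ ≤ expect ρ K) ∧
      expect ρf K ≤ vonNeumannEntropy ρf + η := by
  obtain ⟨W, hW, p, hp, hp1, rfl, hS⟩ := hf.exists_conjDiag
  have hne : (0 : ℝ) < Fintype.card d := by
    have : Nonempty d := by
      by_contra h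
      rw [not_nonempty_iff] at h
      simp at hp1
    exact_mod_cast Fintype.card_pos
  set t : ℝ := Real.exp (-η) with ht
  have ht0 : 0 < t := Real.exp_pos _
  have ht1 : t < 1 := by simpa [ht] using hη
  set q : d → ℝ := fun b => t * p b + (1 - t) / Fintype.card d with hq
  have hc : 0 < (1 - t) / Fintype.card d := div_pos (by linarith) hne
  have hq0 : ∀ b, 0 < q b := fun b => by
    have := mul_nonneg ht0.le (hp b)
    simp only [hq]; linarith
  have hq1 : ∑ b, q b = 1 := by
    simp only [hq, Finset.sum_add_distrib, ← Finset.mul_sum, hp1]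
    simp only [Finset.sum_const, Finset.card_univ, nsmul_eq_mul]
    field_simp; ring
  refine ⟨conjDiag W fun b => -Real.log (q b), fun ρ hρ => ?_, ?_⟩
  · rw [expect_conjDiag]
    exact entropy_le hW hρ (fun b => (hq0 b).le) hq1.le fun b hb => absurd hb (hq0 b).ne'
  · rw [expect_conjDiag, hS]
    have : ∀ b, pop W (conjDiag W p) b * -Real.log (q b) ≤ Real.negMulLog (p b) + η * p b := by
      intro b
      rw [pop_conjDiag_self hW, Real.negMulLog]
      rcases (hp b).eq_or_lt with h | h
      · simp [← h]
      · have h1 : Real.log (t * p b) ≤ Real.log (q b) :=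
          Real.log_le_log (mul_pos ht0 h) (by simp only [hq]; linarith)
        rw [Real.log_mul ht0.ne' h.ne', ht, Real.log_exp] at h1
        nlinarith
    refine (Finset.sum_le_sum fun b _ => this b).trans_eq ?_
    rw [Finset.sum_add_distrib, ← Finset.mul_sum, hp1, mul_one]

end Expect

/-! ### Tensor products of finitely many matrices -/

section Tensor

variable {N : ℕ} {D : Fin N → ℕ}

theorem piTensor_mul (A B : (l : Fin N) → Matrix (Fin (D l)) (Fin (D l)) ℂ) :
    piTensor A * piTensor B = piTensor fun l => A l * B l := by
  ext a b
  simp only [piTensor, Matrix.mul_apply, Matrix.of_apply]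
  rw [Finset.prod_univ_sum, Fintype.piFinset_univ]
  exact Finset.sum_congr rfl fun c _ => Finset.prod_mul_distrib.symm

theorem piTensor_diagonal (g : (l : Fin N) → Fin (D l) → ℂ) :
    piTensor (fun l => Matrix.diagonal (g l)) = Matrix.diagonal fun x => ∏ l, g l (x l) := by
  ext a b
  simp only [piTensor, Matrix.of_apply, Matrix.diagonal_apply]
  split_ifs with h
  · subst h; simp
  · obtain ⟨l, hl⟩ := Function.ne_iff.1 h
    exact Finset.prod_eq_zero (Finset.mem_univ l) (if_neg hl)

theorem piTensor_one : piTensor (fun l => (1 : Matrix (Fin (D l)) (Fin (D l)) ℂ)) = 1 := by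
  have := piTensor_diagonal (D := D) fun _ _ => 1
  simpa using this

theorem conjTranspose_piTensor (A : (l : Fin N) → Matrix (Fin (D l)) (Fin (D l)) ℂ) :
    (piTensor A).conjTranspose = piTensor fun l => (A l).conjTranspose := by
  ext a b
  simp [piTensor, Matrix.conjTranspose_apply]

theorem piTensor_mem_unitaryGroup {W : (l : Fin N) → Matrix (Fin (D l)) (Fin (D l)) ℂ}
    (hW : ∀ l, W l ∈ Matrix.unitaryGroup (Fin (D l)) ℂ) :
    piTensor W ∈ Matrix.unitaryGroup ((l : Fin N) → Fin (D l)) ℂ := by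
  rw [Matrix.mem_unitaryGroup_iff, Matrix.star_eq_conjTranspose, conjTranspose_piTensor,
    piTensor_mul, ← piTensor_one]
  congr 1
  funext l
  exact mul_conjTranspose_self_of_mem (hW l)

theorem trace_piTensor (A : (l : Fin N) → Matrix (Fin (D l)) (Fin (D l)) ℂ) :
    (piTensor A).trace = ∏ l, (A l).trace := by
  simp only [Matrix.trace, Matrix.diag_apply, piTensor, Matrix.of_apply]
  rw [Finset.prod_univ_sum, Fintype.piFinset_univ]

theorem piTensor_conjDiag (W : (l : Fin N) → Matrix (Fin (D l)) (Fin (D l)) ℂ)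
    (g : (l : Fin N) → Fin (D l) → ℝ) :
    piTensor (fun l => conjDiag (W l) (g l)) =
      conjDiag (piTensor W) fun x => ∏ l, g l (x l) := by
  simp only [conjDiag, ← piTensor_mul, conjTranspose_piTensor, piTensor_diagonal,
    Complex.ofReal_prod]

theorem posSemidef_piTensor {A : (l : Fin N) → Matrix (Fin (D l)) (Fin (D l)) ℂ}
    (hA : ∀ l, (A l).PosSemidef) : (piTensor A).PosSemidef := by
  choose W hW h using fun l => exists_conjDiag_of_isHermitian (hA l).isHermitian
  have : A = fun l => conjDiag (W l) (hA l).isHermitian.eigenvalues := funext h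
  rw [this, piTensor_conjDiag]
  refine Matrix.PosSemidef.mul_mul_conjTranspose_same ?_ _
  rw [Matrix.posSemidef_diagonal_iff]
  intro x
  exact_mod_cast Finset.prod_nonneg fun l _ => (hA l).eigenvalues_nonneg (x l)

theorem piTensor_update_apply (l : Fin N) (M : Matrix (Fin (D l)) (Fin (D l)) ℂ)
    (a b : (l : Fin N) → Fin (D l)) :
    piTensor (Function.update (fun _ => 1) l M) a b =
      M (a l) (b l) * ∏ k ∈ Finset.univ.erase l,
        (1 : Matrix (Fin (D k)) (Fin (D k)) ℂ) (a k) (b k) := by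
  rw [piTensor, Matrix.of_apply, ← Finset.mul_prod_erase _ _ (Finset.mem_univ l),
    Function.update_self]
  congr 1
  refine Finset.prod_congr rfl fun k hk => ?_
  rw [Function.update_of_ne (Finset.ne_of_mem_erase hk)]

theorem piTensor_update_sum_smul {ι : Type*} [Fintype ι] (l : Fin N) (β : ι → ℂ)
    (M : ι → Matrix (Fin (D l)) (Fin (D l)) ℂ) :
    piTensor (Function.update (fun _ => 1) l (∑ j, β j • M j)) =
      ∑ j, β j • piTensor (Function.update (fun _ => 1) l (M j)) := by
  ext a b
  simp only [piTensor_update_apply, Matrix.sum_apply, Matrix.smul_apply, smul_eq_mul,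
    Finset.sum_mul, mul_assoc]

theorem piTensor_update_conjDiag {W : (l : Fin N) → Matrix (Fin (D l)) (Fin (D l)) ℂ}
    (hW : ∀ l, W l ∈ Matrix.unitaryGroup (Fin (D l)) ℂ) (l : Fin N) (m : Fin (D l) → ℝ) :
    piTensor (Function.update (fun _ => 1) l (conjDiag (W l) m)) =
      conjDiag (piTensor W) fun x => m (x l) := by
  -- The identity in each other slot is written as a matrix with spectrum `1` in the basis `W k`, so
  -- that all factors are diagonal in the product basis.
  have h : (Function.update (fun _ => 1) l (conjDiag (W l) m) :
      (l : Fin N) → Matrix (Fin (D l)) (Fin (D l)) ℂ) =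
      fun k => conjDiag (W k) (Function.update (β := fun k => Fin (D k) → ℝ)
        (fun _ _ => 1) l m k) := by
    funext k
    rcases eq_or_ne k l with rfl | hk
    · simp
    · rw [Function.update_of_ne hk, Function.update_of_ne hk, conjDiag]
      simp [mul_conjTranspose_self_of_mem (hW k)]
  rw [h, piTensor_conjDiag]
  congr 1
  funext x
  rw [← Finset.mul_prod_erase _ _ (Finset.mem_univ l), Function.update_self,
    Finset.prod_eq_one, mul_one]
  intro k hk
  rw [Function.update_of_ne (Finset.ne_of_mem_erase hk)]

end Tensor

/-! ### Bipartite systems and the partial trace -/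

section Composite

variable {d e : Type*} [Fintype d] [DecidableEq d] [Fintype e] [DecidableEq e]

theorem conjDiag_kronecker (W : Matrix d d ℂ) (V : Matrix e e ℂ) (p : d → ℝ) (q : e → ℝ) :
    conjDiag W p ⊗ₖ conjDiag V q = conjDiag (W ⊗ₖ V) fun x => p x.1 * q x.2 := by
  simp only [conjDiag, Matrix.mul_kronecker_mul, Matrix.conjTranspose_kronecker,
    Matrix.diagonal_kronecker_diagonal, Complex.ofReal_mul]

theorem conjDiag_one {W : Matrix d d ℂ} (hW : W ∈ Matrix.unitaryGroup d ℂ) :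
    conjDiag W (fun _ => 1) = 1 := by
  simp [conjDiag, mul_conjTranspose_self_of_mem hW]

theorem conjDiag_const {W : Matrix d d ℂ} (hW : W ∈ Matrix.unitaryGroup d ℂ) (c : ℝ) :
    conjDiag W (fun _ => c) = (c : ℂ) • 1 := by
  rw [conjDiag, ← Matrix.smul_one_eq_diagonal, Matrix.mul_smul, Matrix.mul_one, Matrix.smul_mul,
    mul_conjTranspose_self_of_mem hW]

theorem trace_partialTrace (A : Matrix (d × e) (d × e) ℂ) : (partialTrace A).trace = A.trace := by
  simp only [Matrix.trace, Matrix.diag_apply, partialTrace, Matrix.of_apply, Fintype.sum_prod_type]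

theorem partialTrace_kronecker (A : Matrix d d ℂ) (B : Matrix e e ℂ) :
    partialTrace (A ⊗ₖ B) = B.trace • A := by
  ext i j
  simp [partialTrace, Matrix.trace, Finset.mul_sum, mul_comm]

theorem expect_kronecker_one (F : Matrix (d × e) (d × e) ℂ) (A : Matrix d d ℂ) :
    expect F (A ⊗ₖ (1 : Matrix e e ℂ)) = expect (partialTrace F) A := by
  rw [expect, expect]
  congr 1
  simp only [Matrix.trace, Matrix.diag_apply, Matrix.mul_apply, partialTrace, Matrix.of_apply,
    Fintype.sum_prod_type, Matrix.kroneckerMap_apply, Finset.sum_mul]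
  refine Finset.sum_congr rfl fun i _ => ?_
  rw [Finset.sum_comm]
  refine Finset.sum_congr rfl fun j _ => ?_
  refine Finset.sum_congr rfl fun k _ => ?_
  rw [Finset.sum_eq_single k]
  · simp
  · intro b _ hb; simp [hb]
  · simp

/-- The partial trace is a sum of principal submatrices, one for each basis vector of the second
factor. -/
theorem posSemidef_partialTrace {A : Matrix (d × e) (d × e) ℂ} (hA : A.PosSemidef) :
    (partialTrace A).PosSemidef := by
  have : partialTrace A = ∑ k : e, A.submatrix (fun i => (i, k)) (fun i => (i, k)) := by
    ext i j
    simp [partialTrace, Matrix.sum_apply]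
  rw [this]
  exact Matrix.posSemidef_sum _ fun k _ => hA.submatrix _

theorem IsDensity.partialTrace {A : Matrix (d × e) (d × e) ℂ} (hA : IsDensity A) :
    IsDensity (partialTrace A) :=
  ⟨posSemidef_partialTrace hA.1, by rw [trace_partialTrace, hA.2]⟩

theorem IsDensity.kronecker {A : Matrix d d ℂ} {B : Matrix e e ℂ} (hA : IsDensity A)
    (hB : IsDensity B) : IsDensity (A ⊗ₖ B) :=
  ⟨hA.1.kronecker hB.1, by rw [Matrix.trace_kronecker, hA.2, hB.2, mul_one]⟩

theorem IsDensity.conj {A : Matrix d d ℂ} (hA : IsDensity A) {U : Matrix d d ℂ}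
    (hU : U ∈ Matrix.unitaryGroup d ℂ) : IsDensity (U * A * U.conjTranspose) :=
  ⟨hA.1.mul_mul_conjTranspose_same U, by
    rw [Matrix.trace_mul_comm, ← Matrix.mul_assoc, conjTranspose_mul_self_of_mem hU,
      Matrix.one_mul, hA.2]⟩

theorem isDensity_piTensor {N : ℕ} {D : Fin N → ℕ}
    {A : (l : Fin N) → Matrix (Fin (D l)) (Fin (D l)) ℂ}
    (hA : ∀ l, IsDensity (A l)) : IsDensity (piTensor A) :=
  ⟨posSemidef_piTensor fun l => (hA l).1, by
    rw [trace_piTensor]; exact Finset.prod_eq_one fun l _ => (hA l).2⟩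

end Composite

/-! ### Gibbs states through their spectra -/

section Gibbs

variable {ι d : Type*} [Fintype ι] [Fintype d] [DecidableEq d]

/-- The partition function of a spectrum. -/
def partition (m : d → ℝ) : ℝ := ∑ i, Real.exp (-m i)

/-- The Gibbs distribution of a spectrum. -/
def boltzmann (m : d → ℝ) (i : d) : ℝ := Real.exp (-m i) / partition m

theorem partition_pos [Nonempty d] (m : d → ℝ) : 0 < partition m :=
  Finset.sum_pos (fun _ _ => Real.exp_pos _) Finset.univ_nonempty

theorem boltzmann_pos [Nonempty d] (m : d → ℝ) (i : d) : 0 < boltzmann m i :=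
  div_pos (Real.exp_pos _) (partition_pos m)

theorem sum_boltzmann [Nonempty d] (m : d → ℝ) : ∑ i, boltzmann m i = 1 := by
  simp only [boltzmann, ← Finset.sum_div]
  exact div_self (partition_pos m).ne'

theorem neg_log_boltzmann [Nonempty d] (m : d → ℝ) (i : d) :
    -Real.log (boltzmann m i) = m i + Real.log (partition m) := by
  rw [boltzmann, Real.log_div (Real.exp_pos _).ne' (partition_pos m).ne', Real.log_exp]
  ring

theorem gibbs_eq_conjDiag {b : ι → ℝ} {Q : ι → Matrix d d ℂ} {W : Matrix d d ℂ}
    (hW : W ∈ Matrix.unitaryGroup d ℂ) {m : d → ℝ}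
    (h : ∑ j, (b j : ℂ) • Q j = conjDiag W m) : gibbs b Q = conjDiag W (boltzmann m) := by
  have h1 : NormedSpace.exp (-∑ j, (b j : ℂ) • Q j) = conjDiag W fun i => Real.exp (-m i) := by
    have hinv : W⁻¹ = W.conjTranspose :=
      Matrix.inv_eq_right_inv (mul_conjTranspose_self_of_mem hW)
    have hu : IsUnit W := (Matrix.isUnit_iff_isUnit_det W).2
      (Matrix.isUnit_det_of_right_inverse (mul_conjTranspose_self_of_mem hW))
    have hneg : -conjDiag W m = W * Matrix.diagonal (fun i => ((-m i : ℝ) : ℂ)) * W⁻¹ := by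
      have : Matrix.diagonal (fun i => ((-m i : ℝ) : ℂ)) =
          -Matrix.diagonal (fun i => ((m i : ℝ) : ℂ)) := by
        rw [Matrix.diagonal_neg]; congr 1; funext i; simp
      rw [hinv, conjDiag, this, Matrix.mul_neg, Matrix.neg_mul]
    rw [h, hneg, Matrix.exp_conj _ _ hu, Matrix.exp_diagonal, hinv, conjDiag]
    congr 3
    funext i
    rw [Pi.coe_exp, ← Complex.exp_eq_exp_ℂ, ← Complex.ofReal_exp]
  rw [gibbs, h1, trace_conjDiag hW, conjDiag, conjDiag, ← Matrix.smul_mul, ← Matrix.mul_smul,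
    ← Matrix.diagonal_smul]
  congr 3
  funext i
  simp only [Pi.smul_apply, boltzmann, partition, smul_eq_mul, Complex.ofReal_div]
  rw [div_eq_mul_inv, mul_comm]

theorem isHermitian_sum_smul {Q : ι → Matrix d d ℂ} (hQ : ∀ j, (Q j).IsHermitian) (b : ι → ℝ) :
    (∑ j, (b j : ℂ) • Q j).IsHermitian := by
  rw [Matrix.IsHermitian, Matrix.conjTranspose_sum]
  refine Finset.sum_congr rfl fun j _ => ?_
  rw [Matrix.conjTranspose_smul, hQ j, Complex.star_def, Complex.conj_ofReal]

theorem isDensity_gibbs [Nonempty d] {Q : ι → Matrix d d ℂ} (hQ : ∀ j, (Q j).IsHermitian)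
    (b : ι → ℝ) : IsDensity (gibbs b Q) := by
  obtain ⟨W, hW, h⟩ := exists_conjDiag_of_isHermitian (isHermitian_sum_smul hQ b)
  rw [gibbs_eq_conjDiag hW h]
  exact isDensity_conjDiag hW (fun i => (boltzmann_pos _ i).le) (sum_boltzmann _)

end Gibbs

/-! ### The free-entropy inequality for Gibbs environments -/

namespace Environment

variable {ι : Type*} (E : Environment ι)

/-- The increase of the expectation value of the `j`-th observable of the environment. -/
def envIncrease {d : Type*} [Fintype d] [DecidableEq d]
    (U : Matrix.unitaryGroup (d × E.Idx) ℂ) (ρ : Matrix d d ℂ) (σ : E.Family) (j : ι) : ℝ :=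
  expect (E.final U ρ σ) ((1 : Matrix d d ℂ) ⊗ₖ E.charge j) -
    expect (E.initial ρ σ) ((1 : Matrix d d ℂ) ⊗ₖ E.charge j)

variable {d : Type*} [Fintype d] [DecidableEq d]

theorem isDensity_of_mem_thermalMicrostates [Fintype ι] {β : ι → ℝ} {σ : E.Family}
    (hσ : σ ∈ E.thermalMicrostates β) (l : Fin E.N) : IsDensity (σ l) := (hσ l).1

theorem isDensity_final (U : Matrix.unitaryGroup (d × E.Idx) ℂ) {ρ : Matrix d d ℂ}
    (hρ : IsDensity ρ) {σ : E.Family} (hσ : ∀ l, IsDensity (σ l)) :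
    IsDensity (E.final U ρ σ) :=
  (hρ.kronecker (isDensity_piTensor hσ)).conj U.2

/-- This splits the balance between system and environment: once the final state of the system is
known, only the increase in the environment has to be tracked. -/
theorem decrease_eq (Q : ι → Matrix d d ℂ) (U : Matrix.unitaryGroup (d × E.Idx) ℂ)
    (ρ : Matrix d d ℂ) {σ : E.Family} (hσ : ∀ l, IsDensity (σ l)) (j : ι) :
    E.decrease Q U ρ σ j = expect ρ (Q j) - expect (partialTrace (E.final U ρ σ)) (Q j) -
      E.envIncrease U ρ σ j := by
  have h : partialTrace (E.initial ρ σ) = ρ := by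
    rw [initial, partialTrace_kronecker, (isDensity_piTensor hσ).2, one_smul]
  rw [decrease, totalCharge, expect_add_right, expect_add_right, expect_kronecker_one,
    expect_kronecker_one, h, envIncrease]
  ring

/-- A protocol that works for all microstates works in particular for the Gibbs product state, where
the entropic bounds apply. -/
theorem gibbsFamily_mem_thermalMicrostates [Fintype ι] (β : ι → ℝ) :
    E.gibbsFamily β ∈ E.thermalMicrostates β := fun l =>
  have : Nonempty (Fin (E.dim l)) := ⟨⟨0, E.dim_pos l⟩⟩
  ⟨isDensity_gibbs (E.hermitian l) β, fun _ => rfl⟩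

/-- The free entropy bounds what can be extracted with an environment in its Gibbs state. -/
theorem sum_mul_decrease_le [Fintype ι] (β : ι → ℝ) (Q : ι → Matrix d d ℂ)
    (U : Matrix.unitaryGroup (d × E.Idx) ℂ) {ρ : Matrix d d ℂ} (hρ : IsDensity ρ) :
    ∑ j, β j * E.decrease Q U ρ (E.gibbsFamily β) j ≤
      freeEntropy β Q ρ - freeEntropy β Q (partialTrace (E.final U ρ (E.gibbsFamily β))) := by
  have hσ := E.isDensity_of_mem_thermalMicrostates (E.gibbsFamily_mem_thermalMicrostates β)
  have hne : ∀ l, Nonempty (Fin (E.dim l)) := fun l => ⟨⟨0, E.dim_pos l⟩⟩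
  choose V hV h using fun l =>
    exists_conjDiag_of_isHermitian (isHermitian_sum_smul (E.hermitian l) β)
  set m : (l : Fin E.N) → Fin (E.dim l) → ℝ := fun l =>
    (isHermitian_sum_smul (E.hermitian l) β).eigenvalues with hm
  have hg : E.gibbsFamily β = fun l => conjDiag (V l) (boltzmann (m l)) :=
    funext fun l => gibbs_eq_conjDiag (hV l) (h l)
  set g : E.Idx → ℝ := fun x => ∏ l, boltzmann (m l) (x l) with hgdef
  have hg0 : ∀ x, 0 < g x := fun x => Finset.prod_pos fun l _ => boltzmann_pos _ _
  set VE := piTensor V with hVE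
  have hVE' : VE ∈ Matrix.unitaryGroup E.Idx ℂ := piTensor_mem_unitaryGroup hV
  have hpi : piTensor (E.gibbsFamily β) = conjDiag VE g := by rw [hg, piTensor_conjDiag]
  have hg1 : ∑ x, g x = 1 := by
    have := (isDensity_piTensor hσ).2
    rw [hpi, trace_conjDiag hVE'] at this
    exact_mod_cast this
  obtain ⟨X, hX, r, hr, hr1, hρX, hSr⟩ := hρ.exists_conjDiag
  set F := E.final U ρ (E.gibbsFamily β) with hF
  have hFd : IsDensity F := E.isDensity_final U hρ hσ
  obtain ⟨Y, hY, s, hs, hs1, hρY, hSs⟩ := hFd.partialTrace.exists_conjDiag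
  have hinit : E.initial ρ (E.gibbsFamily β) = conjDiag (X ⊗ₖ VE) fun x => r x.1 * g x.2 := by
    rw [initial, hpi, hρX, conjDiag_kronecker]
  have hFc : F = conjDiag ((U : Matrix (d × E.Idx) (d × E.Idx) ℂ) * (X ⊗ₖ VE))
      fun x => r x.1 * g x.2 := by
    rw [hF, final, hinit, conj_conjDiag]
  have hXV : X ⊗ₖ VE ∈ Matrix.unitaryGroup (d × E.Idx) ℂ := Matrix.kronecker_mem_unitary hX hVE'
  have hYV : Y ⊗ₖ VE ∈ Matrix.unitaryGroup (d × E.Idx) ℂ := Matrix.kronecker_mem_unitary hY hVE'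
  -- the logarithm of the Gibbs distribution
  set k : E.Idx → ℝ := fun x => -Real.log (g x) with hk
  set L : ℝ := ∑ l, Real.log (partition (m l)) with hL
  have hkx : ∀ x, k x = ∑ l, m l (x l) + L := by
    intro x
    simp only [hk, hgdef, hL]
    rw [Real.log_prod (fun l _ => (boltzmann_pos _ _).ne'), ← Finset.sum_neg_distrib,
      ← Finset.sum_add_distrib]
    exact Finset.sum_congr rfl fun l _ => neg_log_boltzmann _ _
  -- Minus the logarithm of the Gibbs state is the weighted sum of the charges plus `L`, the
  -- logarithm of the total partition function. This turns entropic terms into expectation values of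
  -- the conserved observables.
  have hcharge : conjDiag VE k = ∑ j, (β j : ℂ) • E.charge j + ((L : ℝ) : ℂ) • 1 := by
    have h1 : ∑ j, (β j : ℂ) • E.charge j = ∑ l, conjDiag VE fun x => m l (x l) := by
      simp only [charge, Finset.smul_sum]
      rw [Finset.sum_comm]
      refine Finset.sum_congr rfl fun l _ => ?_
      rw [← piTensor_update_sum_smul, h l, piTensor_update_conjDiag hV]
    have h2 := conjDiag_const hVE' L
    rw [h1, ← h2]
    simp only [conjDiag, ← Matrix.mul_sum, ← Matrix.sum_mul, ← Matrix.add_mul, ← Matrix.mul_add]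
    congr 2
    ext x y
    rcases eq_or_ne x y with rfl | hxy
    · simp [hkx, Matrix.sum_apply]
    · simp [hxy, Matrix.sum_apply]
  have hexp : ∀ G : Matrix (d × E.Idx) (d × E.Idx) ℂ, G.trace = 1 →
      expect G ((1 : Matrix d d ℂ) ⊗ₖ conjDiag VE k) =
        ∑ j, β j * expect G ((1 : Matrix d d ℂ) ⊗ₖ E.charge j) + L := by
    intro G hG
    have : (1 : Matrix d d ℂ) ⊗ₖ (∑ j, (β j : ℂ) • E.charge j + ((L : ℝ) : ℂ) • 1) =
        ∑ j, (β j : ℂ) • ((1 : Matrix d d ℂ) ⊗ₖ E.charge j) + ((L : ℝ) : ℂ) • 1 := by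
      rw [Matrix.kronecker_add, Matrix.kronecker_smul, Matrix.one_kronecker_one]
      congr 1
      ext a b
      simp only [Matrix.kroneckerMap_apply, Matrix.sum_apply, Matrix.smul_apply, smul_eq_mul,
        Finset.mul_sum]
      exact Finset.sum_congr rfl fun j _ => by ring
    rw [hcharge, this, expect_add_right, expect_smul_right, expect_sum_right, expect_one, hG,
      Complex.one_re, mul_one]
    simp only [expect_smul_right]
  have hone : ∀ (Y : Matrix d d ℂ), Y ∈ Matrix.unitaryGroup d ℂ →
      (1 : Matrix d d ℂ) ⊗ₖ conjDiag VE k = conjDiag (Y ⊗ₖ VE) fun x => k x.2 := by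
    intro Y hY
    rw [← conjDiag_one hY, conjDiag_kronecker]
    simp
  -- entropy of the initial state
  have hSinit : ∑ x : d × E.Idx, Real.negMulLog (r x.1 * g x.2) = vonNeumannEntropy ρ +
      (∑ j, β j * expect (E.initial ρ (E.gibbsFamily β)) ((1 : Matrix d d ℂ) ⊗ₖ E.charge j) + L) := by
    rw [← hexp (E.initial ρ (E.gibbsFamily β)) (hρ.kronecker (isDensity_piTensor hσ)).2, hone X hX, expect_conjDiag, hSr]
    have : ∀ x : d × E.Idx, Real.negMulLog (r x.1 * g x.2) =
        g x.2 * Real.negMulLog (r x.1) + pop (X ⊗ₖ VE) (E.initial ρ (E.gibbsFamily β)) x * k x.2 := by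
      intro x
      rw [hinit, pop_conjDiag_self hXV, Real.negMulLog_mul]
      simp only [hk, Real.negMulLog]
      ring
    rw [Finset.sum_congr rfl fun x _ => this x, Finset.sum_add_distrib, Fintype.sum_prod_type]
    simp only [← Finset.sum_mul, hg1, one_mul]
  -- the bound for the entropy of the final state
  have hmarg : ∀ i, ∑ x, pop (Y ⊗ₖ VE) F (i, x) = s i := by
    intro i
    have h1 := expect_kronecker_one F (conjDiag Y (Pi.single i 1))
    rw [expect_conjDiag, hρY, ← conjDiag_one hVE', conjDiag_kronecker, expect_conjDiag,
      Fintype.sum_prod_type] at h1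
    simp only [pop_conjDiag_self hY, mul_one, Pi.single_apply, mul_ite, mul_zero,
      Finset.sum_ite_eq', Finset.mem_univ, if_true] at h1
    rw [← h1, Finset.sum_eq_single i]
    · simp
    · intro b _ hb; simp [hb]
    · simp
  -- The support condition for Klein's inequality: a vanishing eigenvalue of the marginal forces the
  -- whole corresponding row of joint populations to vanish.
  have hzero : ∀ i, s i = 0 → ∀ x, pop (Y ⊗ₖ VE) F (i, x) = 0 := fun i hi x =>
    (Finset.sum_eq_zero_iff_of_nonneg (fun x _ => pop_nonneg _ hFd.1 (i, x))).1
      ((hmarg i).trans hi) x (Finset.mem_univ x)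
  -- The reference is the product of the final marginal of the system with the Gibbs state. The
  -- discarded nonnegative relative entropy contains both the correlations created by `U` and the
  -- departure of the environment from equilibrium.
  have hklein := sum_negMulLog_le (lam := fun x : d × E.Idx => r x.1 * g x.2)
    (q := fun x => s x.1 * g x.2) (mul_mem U.2 hXV) hYV
    (fun x => mul_nonneg (hr _) (hg0 _).le)
    (by rw [Fintype.sum_prod_type]; simp only [← Finset.mul_sum, hg1, hr1, mul_one])
    (fun x => mul_nonneg (hs _) (hg0 _).le)
    (by rw [Fintype.sum_prod_type]; simp only [← Finset.mul_sum, hg1, hs1, mul_one]; rfl)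
    (fun x hx => by
      rw [← hFc]
      exact hzero x.1 ((mul_eq_zero.1 hx).resolve_right (hg0 _).ne') x.2)
  rw [← hFc, hSinit] at hklein
  have hrhs : ∑ x : d × E.Idx, pop (Y ⊗ₖ VE) F x * -Real.log (s x.1 * g x.2) =
      vonNeumannEntropy (partialTrace F) +
        (∑ j, β j * expect F ((1 : Matrix d d ℂ) ⊗ₖ E.charge j) + L) := by
    rw [← hexp F hFd.2, hone Y hY, expect_conjDiag, hSs]
    have : ∀ x : d × E.Idx, pop (Y ⊗ₖ VE) F x * -Real.log (s x.1 * g x.2) =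
        pop (Y ⊗ₖ VE) F x * -Real.log (s x.1) + pop (Y ⊗ₖ VE) F x * k x.2 := by
      rintro ⟨i, x⟩
      by_cases hi : s i = 0
      · rw [hzero i hi x]; ring
      · simp only
        rw [Real.log_mul hi (hg0 x).ne']
        simp only [hk]; ring
    rw [Finset.sum_congr rfl fun x _ => this x, Finset.sum_add_distrib, Fintype.sum_prod_type]
    congr 1
    refine Finset.sum_congr rfl fun i _ => ?_
    simp only
    rw [← Finset.sum_mul, hmarg, Real.negMulLog]
    ring
  rw [hrhs] at hklein
  have hfin : ∑ j, β j * E.decrease Q U ρ (E.gibbsFamily β) j =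
      ∑ j, β j * expect ρ (Q j) - ∑ j, β j * expect (partialTrace F) (Q j) -
        (∑ j, β j * expect F ((1 : Matrix d d ℂ) ⊗ₖ E.charge j) -
          ∑ j, β j * expect (E.initial ρ (E.gibbsFamily β)) ((1 : Matrix d d ℂ) ⊗ₖ E.charge j)) := by
    simp only [← Finset.sum_sub_distrib]
    refine Finset.sum_congr rfl fun j _ => ?_
    rw [E.decrease_eq Q U ρ hσ, envIncrease]
    ring
  rw [hfin, freeEntropy, freeEntropy]
  linarith

end Environment

end MacroThermo

end

noncomputable section

namespace MacroThermo

set_option linter.unusedSectionVars false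

/-! ### Adding a qubit to the environment -/

section Submatrix

variable {d e f : Type*} [Fintype d] [DecidableEq d] [Fintype e] [DecidableEq e] [Fintype f]
  [DecidableEq f]

theorem submatrix_mem_unitaryGroup (g : d ≃ e) {W : Matrix e e ℂ}
    (hW : W ∈ Matrix.unitaryGroup e ℂ) : W.submatrix g g ∈ Matrix.unitaryGroup d ℂ := by
  rw [Matrix.mem_unitaryGroup_iff, Matrix.star_eq_conjTranspose, Matrix.conjTranspose_submatrix,
    Matrix.submatrix_mul_equiv, mul_conjTranspose_self_of_mem hW, Matrix.submatrix_one_equiv]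

theorem expect_submatrix (g : d ≃ e) (M A : Matrix e e ℂ) :
    expect (M.submatrix g g) (A.submatrix g g) = expect M A := by
  rw [expect, expect, Matrix.submatrix_mul_equiv]
  congr 1
  simp only [Matrix.trace, Matrix.diag_apply, Matrix.submatrix_apply]
  exact Equiv.sum_comp g fun i => (M * A) i i

theorem partialTrace_conj_kronecker_one (V : Matrix d d ℂ) (M : Matrix (d × e) (d × e) ℂ) :
    partialTrace ((V ⊗ₖ (1 : Matrix e e ℂ)) * M * (V ⊗ₖ (1 : Matrix e e ℂ)).conjTranspose) =
      V * partialTrace M * V.conjTranspose := by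
  ext a b
  have h : ∀ k, ((V ⊗ₖ (1 : Matrix e e ℂ)) * M *
      (V ⊗ₖ (1 : Matrix e e ℂ)).conjTranspose) (a, k) (b, k) =
      ∑ y, ∑ x, V a x * M (x, k) (y, k) * star (V b y) := by
    intro k
    rw [Matrix.mul_apply, Fintype.sum_prod_type]
    refine Finset.sum_congr rfl fun y _ => ?_
    rw [Finset.sum_eq_single k]
    · rw [Matrix.mul_apply, Fintype.sum_prod_type, Finset.sum_mul]
      refine Finset.sum_congr rfl fun x _ => ?_
      rw [Finset.sum_eq_single k]
      · simp [Matrix.conjTranspose_apply]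
      · intro c _ hc; simp [hc.symm]
      · simp
    · intro c _ hc; simp [Matrix.conjTranspose_apply, hc.symm]
    · simp
  rw [partialTrace, Matrix.of_apply, Finset.sum_congr rfl fun k _ => h k, Finset.sum_comm,
    Matrix.mul_apply]
  refine Finset.sum_congr rfl fun y _ => ?_
  rw [Finset.sum_comm, Matrix.mul_apply, Finset.sum_mul]
  refine Finset.sum_congr rfl fun x _ => ?_
  rw [partialTrace, Matrix.of_apply, Finset.mul_sum, Finset.sum_mul]
  rfl

theorem expect_conj {W : Matrix d d ℂ} (hW : W ∈ Matrix.unitaryGroup d ℂ) (M : Matrix d d ℂ)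
    {A : Matrix d d ℂ} (h : Commute W A) :
    expect (W * M * W.conjTranspose) A = expect M A := by
  rw [expect, expect]
  congr 1
  have h2 : W.conjTranspose * A * W = A := by
    rw [Matrix.mul_assoc, ← h.eq, ← Matrix.mul_assoc, conjTranspose_mul_self_of_mem hW,
      Matrix.one_mul]
  calc (W * M * W.conjTranspose * A).trace = (M * (W.conjTranspose * A * W)).trace := by
        rw [Matrix.mul_assoc, Matrix.mul_assoc, Matrix.trace_mul_comm]
        simp [Matrix.mul_assoc]
    _ = _ := by rw [h2]

theorem expect_kronecker (A C : Matrix d d ℂ) (B D : Matrix e e ℂ) :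
    (A ⊗ₖ B * (C ⊗ₖ D)).trace = (A * C).trace * (B * D).trace := by
  rw [← Matrix.mul_kronecker_mul, Matrix.trace_kronecker]

/-- The equivalence that exchanges the second and the third factor. -/
def exchange (d e f : Type*) : (d × f) × e ≃ (d × e) × f where
  toFun x := ((x.1.1, x.2), x.1.2)
  invFun x := ((x.1.1, x.2), x.1.2)

/-- A system that has not yet interacted stays a tensor factor when the old environment is traced
out. -/
theorem partialTrace_exchange (X : Matrix (d × e) (d × e) ℂ) (s : Matrix f f ℂ) :
    partialTrace ((X ⊗ₖ s).submatrix (exchange d e f) (exchange d e f)) = partialTrace X ⊗ₖ s := by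
  ext ⟨a, x⟩ ⟨b, y⟩
  simp [partialTrace, exchange, Finset.sum_mul]

end Submatrix

section Tensor

variable {N : ℕ} {D : Fin (N + 1) → ℕ}

theorem piTensor_succ (A : (l : Fin (N + 1)) → Matrix (Fin (D l)) (Fin (D l)) ℂ)
    (a b : (l : Fin (N + 1)) → Fin (D l)) :
    piTensor A a b = A 0 (a 0) (b 0) *
      piTensor (fun l : Fin N => A l.succ) (fun l => a l.succ) (fun l => b l.succ) := by
  rw [piTensor, Matrix.of_apply, Fin.prod_univ_succ, piTensor, Matrix.of_apply]

/-- Slot `0` is split off, which is where `cons` places the new qubit: a sum of local observables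
becomes the one of the qubit plus the one of the old environment. -/
theorem sum_piTensor_update_succ (M : (l : Fin (N + 1)) → Matrix (Fin (D l)) (Fin (D l)) ℂ)
    (a b : (l : Fin (N + 1)) → Fin (D l)) :
    (∑ l, piTensor (Function.update (fun _ => 1) l (M l))) a b =
      M 0 (a 0) (b 0) * (1 : Matrix ((l : Fin N) → Fin (D l.succ)) _ ℂ)
        (fun l : Fin N => a l.succ) (fun l : Fin N => b l.succ) +
      (1 : Matrix (Fin (D 0)) (Fin (D 0)) ℂ) (a 0) (b 0) *
        (∑ l : Fin N, piTensor (D := fun l : Fin N => D l.succ)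
          (Function.update (fun _ => 1) l (M l.succ))) (fun l => a l.succ) (fun l => b l.succ) := by
  rw [Fin.sum_univ_succ, Matrix.add_apply, Matrix.sum_apply, Matrix.sum_apply, Finset.mul_sum]
  congr 1
  · rw [piTensor_succ, Function.update_self, ← piTensor_one]
    congr 2
  · refine Finset.sum_congr rfl fun l _ => ?_
    rw [piTensor_succ, Function.update_of_ne (Fin.succ_ne_zero l).symm]
    congr 2
    funext k
    rcases eq_or_ne k l with rfl | hk
    · rw [Function.update_self, Function.update_self]
    · rw [Function.update_of_ne hk,
        Function.update_of_ne fun h => hk (Fin.succ_injective _ h)]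

end Tensor

/-! ### Gates between the system and a fresh qubit -/

namespace Environment

variable {ι : Type*} (E : Environment ι)

/-- The environment with an additional qubit. -/
def cons (q : ι → Matrix (Fin 2) (Fin 2) ℂ) (hq : ∀ j, (q j).IsHermitian)
    (hc : ∀ i j, Commute (q i) (q j)) : Environment ι where
  N := E.N + 1
  dim := Fin.cons 2 E.dim
  dim_pos := Fin.cases (by simp) fun l => by simpa using E.dim_pos l
  Q := Fin.cases (motive := fun l => ι → Matrix (Fin ((Fin.cons 2 E.dim : Fin (E.N + 1) → ℕ) l))
    (Fin ((Fin.cons 2 E.dim : Fin (E.N + 1) → ℕ) l)) ℂ) q E.Q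
  hermitian := Fin.cases hq E.hermitian
  commute := Fin.cases hc E.commute

variable {E} {q : ι → Matrix (Fin 2) (Fin 2) ℂ} {hq : ∀ j, (q j).IsHermitian}
  {hc : ∀ i j, Commute (q i) (q j)}

/-- The index of the additional qubit. -/
def fresh : Fin (E.cons q hq hc).N := (0 : Fin (E.N + 1))

/-- The index of an old system in the enlarged environment. -/
def old (l : Fin E.N) : Fin (E.cons q hq hc).N := Fin.succ l

/-- The states of the old systems. -/
def tail (σ : (E.cons q hq hc).Family) : E.Family := fun l => σ (old l)

/-- The state of the additional qubit. -/
def head (σ : (E.cons q hq hc).Family) : Matrix (Fin 2) (Fin 2) ℂ := σ fresh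

/-- A basis of the enlarged environment. -/
def consIdx : Fin 2 × E.Idx ≃ (E.cons q hq hc).Idx :=
  Fin.consEquiv fun l => Fin ((E.cons q hq hc).dim l)

/-- The dimensions and observables given by `Fin.cons` and `Fin.cases` reduce definitionally at `0`
and at successors, so the recursion for slot `0` applies verbatim. -/
theorem piTensor_consIdx (A : (E.cons q hq hc).Family) (a b : Fin 2) (x y : E.Idx) :
    piTensor A (consIdx (a, x)) (consIdx (b, y)) = head A a b * piTensor (tail A) x y :=
  piTensor_succ (D := (E.cons q hq hc).dim) A (consIdx (a, x)) (consIdx (b, y))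

theorem charge_consIdx (j : ι) (a b : Fin 2) (x y : E.Idx) :
    (E.cons q hq hc).charge j (consIdx (a, x)) (consIdx (b, y)) =
      q j a b * (1 : Matrix E.Idx E.Idx ℂ) x y +
        (1 : Matrix (Fin 2) (Fin 2) ℂ) a b * E.charge j x y :=
  sum_piTensor_update_succ (D := (E.cons q hq hc).dim) (fun l => (E.cons q hq hc).Q l j)
    (consIdx (a, x)) (consIdx (b, y))

theorem mem_thermalMicrostates_cons [Fintype ι] {β : ι → ℝ} {σ : (E.cons q hq hc).Family}
    (hσ : σ ∈ (E.cons q hq hc).thermalMicrostates β) :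
    tail σ ∈ E.thermalMicrostates β ∧
      head σ ∈ microstates q fun j => expect (gibbs β q) (q j) :=
  ⟨fun l => hσ (old l), hσ fresh⟩

variable {d : Type*} [Fintype d] [DecidableEq d]

/-- A basis of the system with the enlarged environment. -/
def compIdx : d × (E.cons q hq hc).Idx ≃ (d × Fin 2) × E.Idx :=
  ((Equiv.prodAssoc d (Fin 2) E.Idx).trans (Equiv.prodCongr (Equiv.refl d) consIdx)).symm

theorem compIdx_consIdx (a : d) (x : Fin 2) (k : E.Idx) :
    compIdx (a, consIdx (q := q) (hq := hq) (hc := hc) (x, k)) = ((a, x), k) := by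
  simp [compIdx]

theorem exists_eq_consIdx (k : (E.cons q hq hc).Idx) : ∃ x i, k = consIdx (x, i) :=
  ⟨(consIdx.symm k).1, (consIdx.symm k).2, by simp⟩

theorem initial_cons (ρ : Matrix d d ℂ) (σ : (E.cons q hq hc).Family) :
    (E.cons q hq hc).initial ρ σ =
      ((E.initial ρ (tail σ) ⊗ₖ head σ).submatrix (exchange d E.Idx (Fin 2))
        (exchange d E.Idx (Fin 2))).submatrix compIdx compIdx := by
  ext ⟨a, k⟩ ⟨b, k'⟩
  obtain ⟨x, i, rfl⟩ := exists_eq_consIdx k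
  obtain ⟨y, i', rfl⟩ := exists_eq_consIdx k'
  simp only [initial, Matrix.kroneckerMap_apply, piTensor_consIdx, Matrix.submatrix_apply,
    compIdx_consIdx, exchange, Equiv.coe_fn_mk]
  ring

theorem charge_cons (j : ι) :
    (1 : Matrix d d ℂ) ⊗ₖ (E.cons q hq hc).charge j =
      (((1 : Matrix d d ℂ) ⊗ₖ q j) ⊗ₖ (1 : Matrix E.Idx E.Idx ℂ) +
        (1 : Matrix (d × Fin 2) (d × Fin 2) ℂ) ⊗ₖ E.charge j).submatrix compIdx compIdx := by
  ext ⟨a, k⟩ ⟨b, k'⟩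
  obtain ⟨x, i, rfl⟩ := exists_eq_consIdx k
  obtain ⟨y, i', rfl⟩ := exists_eq_consIdx k'
  rw [← Matrix.one_kronecker_one]
  simp only [Matrix.kroneckerMap_apply, charge_consIdx, Matrix.submatrix_apply,
    compIdx_consIdx, Matrix.add_apply]
  ring

theorem partialTrace_submatrix_compIdx (M : Matrix ((d × Fin 2) × E.Idx) ((d × Fin 2) × E.Idx) ℂ) :
    partialTrace (M.submatrix (compIdx (q := q) (hq := hq) (hc := hc)) compIdx) =
      partialTrace (partialTrace M) := by
  ext a b
  simp only [partialTrace, Matrix.of_apply, Matrix.submatrix_apply]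
  rw [← Equiv.sum_comp (consIdx (q := q) (hq := hq) (hc := hc)), Fintype.sum_prod_type]
  simp only [compIdx_consIdx]

variable (E q hq hc) in
/-- A gate on the system and an additional qubit, after a unitary with the old environment. -/
def consGate (U : Matrix.unitaryGroup (d × E.Idx) ℂ) (V : Matrix.unitaryGroup (d × Fin 2) ℂ) :
    Matrix.unitaryGroup (d × (E.cons q hq hc).Idx) ℂ :=
  ⟨((((V : Matrix (d × Fin 2) (d × Fin 2) ℂ) ⊗ₖ (1 : Matrix E.Idx E.Idx ℂ)) *
      ((U : Matrix (d × E.Idx) (d × E.Idx) ℂ) ⊗ₖ (1 : Matrix (Fin 2) (Fin 2) ℂ)).submatrix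
        (exchange d E.Idx (Fin 2)) (exchange d E.Idx (Fin 2)))).submatrix compIdx compIdx,
    submatrix_mem_unitaryGroup _ (mul_mem (Matrix.kronecker_mem_unitary V.2 (one_mem _))
      (submatrix_mem_unitaryGroup _ (Matrix.kronecker_mem_unitary U.2 (one_mem _))))⟩

theorem final_cons (U : Matrix.unitaryGroup (d × E.Idx) ℂ)
    (V : Matrix.unitaryGroup (d × Fin 2) ℂ) (ρ : Matrix d d ℂ) (σ : (E.cons q hq hc).Family) :
    (E.cons q hq hc).final (consGate E q hq hc U V) ρ σ =
      (((V : Matrix (d × Fin 2) (d × Fin 2) ℂ) ⊗ₖ (1 : Matrix E.Idx E.Idx ℂ)) *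
        (E.final U ρ (tail σ) ⊗ₖ head σ).submatrix (exchange d E.Idx (Fin 2))
          (exchange d E.Idx (Fin 2)) *
        ((V : Matrix (d × Fin 2) (d × Fin 2) ℂ) ⊗ₖ
          (1 : Matrix E.Idx E.Idx ℂ)).conjTranspose).submatrix compIdx compIdx := by
  have h : E.final U ρ (tail σ) ⊗ₖ head σ =
      ((U : Matrix (d × E.Idx) (d × E.Idx) ℂ) ⊗ₖ (1 : Matrix (Fin 2) (Fin 2) ℂ)) *
        (E.initial ρ (tail σ) ⊗ₖ head σ) *
        ((U : Matrix (d × E.Idx) (d × E.Idx) ℂ) ⊗ₖ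
          (1 : Matrix (Fin 2) (Fin 2) ℂ)).conjTranspose := by
    rw [final, Matrix.conjTranspose_kronecker, ← Matrix.mul_kronecker_mul,
      ← Matrix.mul_kronecker_mul, Matrix.conjTranspose_one, Matrix.one_mul, Matrix.mul_one]
  rw [final, initial_cons, consGate, h]
  simp only [Matrix.conjTranspose_submatrix, Matrix.submatrix_mul_equiv, Matrix.conjTranspose_mul]
  congr 1
  rw [← Matrix.submatrix_mul_equiv _ _ _ (exchange d E.Idx (Fin 2)),
    ← Matrix.submatrix_mul_equiv _ _ _ (exchange d E.Idx (Fin 2))]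
  simp only [Matrix.mul_assoc]

/-- The fresh qubit is uncorrelated with everything before it, so the next gate sees only the
reduced state of the system; the correlations with the old environment left by `U` do not matter. -/
theorem partialTrace_final_cons (U : Matrix.unitaryGroup (d × E.Idx) ℂ)
    (V : Matrix.unitaryGroup (d × Fin 2) ℂ) (ρ : Matrix d d ℂ) (σ : (E.cons q hq hc).Family) :
    partialTrace ((E.cons q hq hc).final (consGate E q hq hc U V) ρ σ) =
      partialTrace ((V : Matrix (d × Fin 2) (d × Fin 2) ℂ) *
        (partialTrace (E.final U ρ (tail σ)) ⊗ₖ head σ) *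
        (V : Matrix (d × Fin 2) (d × Fin 2) ℂ).conjTranspose) := by
  rw [final_cons, partialTrace_submatrix_compIdx, partialTrace_conj_kronecker_one,
    partialTrace_exchange]

theorem commute_kronecker_one (V : Matrix (d × Fin 2) (d × Fin 2) ℂ) (A : Matrix E.Idx E.Idx ℂ) :
    Commute (V ⊗ₖ (1 : Matrix E.Idx E.Idx ℂ)) ((1 : Matrix (d × Fin 2) (d × Fin 2) ℂ) ⊗ₖ A) := by
  rw [Commute, SemiconjBy, ← Matrix.mul_kronecker_mul, ← Matrix.mul_kronecker_mul]
  simp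

theorem expect_exchange (X : Matrix (d × E.Idx) (d × E.Idx) ℂ) {s : Matrix (Fin 2) (Fin 2) ℂ}
    (hs : s.trace = 1) (A : Matrix E.Idx E.Idx ℂ) :
    expect ((X ⊗ₖ s).submatrix (exchange d E.Idx (Fin 2)) (exchange d E.Idx (Fin 2)))
      ((1 : Matrix (d × Fin 2) (d × Fin 2) ℂ) ⊗ₖ A) = expect X ((1 : Matrix d d ℂ) ⊗ₖ A) := by
  have h : (1 : Matrix (d × Fin 2) (d × Fin 2) ℂ) ⊗ₖ A =
      (((1 : Matrix d d ℂ) ⊗ₖ A) ⊗ₖ (1 : Matrix (Fin 2) (Fin 2) ℂ)).submatrix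
        (exchange d E.Idx (Fin 2)) (exchange d E.Idx (Fin 2)) := by
    rw [← Matrix.one_kronecker_one]
    ext ⟨⟨a, x⟩, k⟩ ⟨⟨b, y⟩, k'⟩
    simp only [Matrix.kroneckerMap_apply, Matrix.submatrix_apply, exchange, Equiv.coe_fn_mk]
    ring
  rw [h, expect_submatrix, expect_kronecker_one, partialTrace_kronecker, hs, one_smul]

/-- The gate acts trivially on the old environment and commutes with its charges. The increments are
thus additive, and the new one involves only the reduced state of the system and the qubit. -/
theorem envIncrease_cons (U : Matrix.unitaryGroup (d × E.Idx) ℂ)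
    (V : Matrix.unitaryGroup (d × Fin 2) ℂ) {ρ : Matrix d d ℂ} (hρ : IsDensity ρ)
    {σ : (E.cons q hq hc).Family} (hσ : ∀ l, IsDensity (tail σ l)) (hs : IsDensity (head σ))
    (j : ι) :
    (E.cons q hq hc).envIncrease (consGate E q hq hc U V) ρ σ j =
      E.envIncrease U ρ (tail σ) j +
        (expect ((V : Matrix (d × Fin 2) (d × Fin 2) ℂ) *
          (partialTrace (E.final U ρ (tail σ)) ⊗ₖ head σ) *
          (V : Matrix (d × Fin 2) (d × Fin 2) ℂ).conjTranspose) ((1 : Matrix d d ℂ) ⊗ₖ q j) -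
          expect (head σ) (q j)) := by
  have hinit : partialTrace (E.initial ρ (tail σ)) = ρ := by
    rw [initial, partialTrace_kronecker, (isDensity_piTensor hσ).2, one_smul]
  have hq' : expect (ρ ⊗ₖ head σ) ((1 : Matrix d d ℂ) ⊗ₖ q j) = expect (head σ) (q j) := by
    rw [expect, expect_kronecker, Matrix.mul_one, hρ.2, one_mul, expect]
  rw [envIncrease, envIncrease, final_cons, initial_cons, charge_cons, expect_submatrix,
    expect_submatrix, expect_add_right, expect_add_right, expect_kronecker_one,
    expect_kronecker_one, partialTrace_conj_kronecker_one, partialTrace_exchange,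
    partialTrace_exchange, hinit, hq',
    expect_conj (Matrix.kronecker_mem_unitary V.2 (one_mem _)) _ (commute_kronecker_one _ _),
    expect_exchange _ hs.2, expect_exchange _ hs.2]
  ring

end Environment

/-! ### Realizable processes -/

section Realizable

variable {ι d : Type*} [Fintype ι] [Fintype d] [DecidableEq d]

/-- Some unitary with some environment relates all initial states `ρ` of the system, for all
microstates of the environment, to a final state `ρ'` of the system and to increases `c` of the
observables of the environment such that `C ρ ρ' c`. -/
def Realizable (β : ι → ℝ) (C : Matrix d d ℂ → Matrix d d ℂ → (ι → ℝ) → Prop) : Prop :=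
  ∃ (E : Environment ι) (U : Matrix.unitaryGroup (d × E.Idx) ℂ),
    ∀ ρ, IsDensity ρ → ∀ σ ∈ E.thermalMicrostates β,
      C ρ (partialTrace (E.final U ρ σ)) (E.envIncrease U ρ σ)

theorem Realizable.mono {β : ι → ℝ} {C C' : Matrix d d ℂ → Matrix d d ℂ → (ι → ℝ) → Prop}
    (h : Realizable β C)
    (hC : ∀ ρ ρ' c, IsDensity ρ → IsDensity ρ' → C ρ ρ' c → C' ρ ρ' c) : Realizable β C' := by
  obtain ⟨E, U, h⟩ := h
  exact ⟨E, U, fun ρ hρ σ hσ => hC _ _ _ hρ (E.isDensity_final U hρ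
    (E.isDensity_of_mem_thermalMicrostates hσ)).partialTrace (h ρ hρ σ hσ)⟩

theorem realizable_trivial (β : ι → ℝ) :
    Realizable (d := d) β fun ρ ρ' c => ρ' = ρ ∧ c = 0 := by
  refine ⟨⟨0, Fin.elim0, fun l => l.elim0, fun l => l.elim0, fun l => l.elim0, fun l => l.elim0⟩,
    1, fun ρ hρ σ hσ => ⟨?_, ?_⟩⟩
  · have hσ' := Environment.isDensity_of_mem_thermalMicrostates _ hσ
    rw [Environment.final]
    simp only [OneMemClass.coe_one, Matrix.one_mul, Matrix.conjTranspose_one, Matrix.mul_one]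
    rw [Environment.initial, partialTrace_kronecker, (isDensity_piTensor hσ').2, one_smul]
  · funext j
    simp [Environment.envIncrease, Environment.final]

/-- This is the composition step from which every process below is built. Each gate consumes a fresh
qubit, so the history is summarised by the reduced state `ρ₁` and the accumulated increases `c₁`. -/
theorem Realizable.gate {β : ι → ℝ} {C : Matrix d d ℂ → Matrix d d ℂ → (ι → ℝ) → Prop}
    (h : Realizable β C) {q : ι → Matrix (Fin 2) (Fin 2) ℂ} (hq : ∀ j, (q j).IsHermitian)
    (hc : ∀ i j, Commute (q i) (q j)) {V : Matrix (d × Fin 2) (d × Fin 2) ℂ}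
    (hV : V ∈ Matrix.unitaryGroup (d × Fin 2) ℂ) :
    Realizable β fun ρ ρ' c => ∃ ρ₁ c₁, ∃ s ∈ microstates q fun j => expect (gibbs β q) (q j),
      IsDensity ρ₁ ∧ C ρ ρ₁ c₁ ∧ ρ' = partialTrace (V * (ρ₁ ⊗ₖ s) * V.conjTranspose) ∧
      ∀ j, c j = c₁ j + (expect (V * (ρ₁ ⊗ₖ s) * V.conjTranspose) ((1 : Matrix d d ℂ) ⊗ₖ q j) -
        expect s (q j)) := by
  obtain ⟨E, U, h⟩ := h
  refine ⟨E.cons q hq hc, Environment.consGate E q hq hc U ⟨V, hV⟩, fun ρ hρ σ hσ => ?_⟩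
  obtain ⟨hσ', hs⟩ := Environment.mem_thermalMicrostates_cons hσ
  have hd := E.isDensity_of_mem_thermalMicrostates hσ'
  exact ⟨_, _, _, hs, (E.isDensity_final U hρ hd).partialTrace, h ρ hρ _ hσ',
    Environment.partialTrace_final_cons U ⟨V, hV⟩ ρ σ,
    Environment.envIncrease_cons U ⟨V, hV⟩ hρ hd hs.1⟩

end Realizable

end MacroThermo

end

noncomputable section

namespace MacroThermo

set_option linter.unusedSectionVars false

/-! ### Qubits as sources of known randomness -/

section Qubit

variable {ι : Type*} [Fintype ι]

/-- The observables of a qubit with charges `0` and `h`. -/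
def qubit (h : ι → ℝ) (j : ι) : Matrix (Fin 2) (Fin 2) ℂ := conjDiag 1 ![0, h j]

/-- The thermal population of the upper level of a qubit with gap `x` in units of the
temperature. -/
def excited (x : ℝ) : ℝ := (1 + Real.exp x)⁻¹

theorem isHermitian_qubit (h : ι → ℝ) (j : ι) : (qubit h j).IsHermitian :=
  isHermitian_conjDiag _ _

theorem commute_qubit (h : ι → ℝ) (i j : ι) : Commute (qubit h i) (qubit h j) := by
  simp only [qubit, conjDiag, Matrix.one_mul, Matrix.conjTranspose_one, Matrix.mul_one]
  exact Matrix.commute_diagonal _ _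

theorem expect_qubit (h : ι → ℝ) (s : Matrix (Fin 2) (Fin 2) ℂ) (j : ι) :
    expect s (qubit h j) = h j * (s 1 1).re := by
  rw [qubit, expect_conjDiag]
  simp [pop, mul_comm]

theorem expect_one_kronecker_qubit {d : Type*} [Fintype d] [DecidableEq d] (h : ι → ℝ)
    (M : Matrix (d × Fin 2) (d × Fin 2) ℂ) (j : ι) :
    expect M ((1 : Matrix d d ℂ) ⊗ₖ qubit h j) = h j * ∑ a, (M (a, 1) (a, 1)).re := by
  rw [qubit, ← conjDiag_one (one_mem _), conjDiag_kronecker, Matrix.one_kronecker_one,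
    expect_conjDiag, Fintype.sum_prod_type, Finset.mul_sum]
  refine Finset.sum_congr rfl fun a _ => ?_
  simp [pop, mul_comm]

theorem gibbs_qubit_apply (β h : ι → ℝ) :
    (gibbs β (qubit h) 1 1).re = excited (∑ j, β j * h j) := by
  have h1 : ∑ j, (β j : ℂ) • qubit h j = conjDiag 1 ![0, ∑ j, β j * h j] := by
    ext a b
    fin_cases a <;> fin_cases b <;> simp [qubit, conjDiag, Matrix.sum_apply]
  rw [gibbs_eq_conjDiag (one_mem _) h1]
  have : ((conjDiag (1 : Matrix (Fin 2) (Fin 2) ℂ) (boltzmann ![0, ∑ j, β j * h j])) 1 1).re =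
      boltzmann ![0, ∑ j, β j * h j] 1 := by
    simp [conjDiag]
  rw [this, boltzmann, partition, excited]
  simp only [Fin.sum_univ_two, Matrix.cons_val_zero, Matrix.cons_val_one, neg_zero, Real.exp_zero]
  rw [Real.exp_neg]
  have := Real.exp_pos (∑ j, β j * h j)
  field_simp
  ring

theorem ofReal_re_diag {d : Type*} [Fintype d] {A : Matrix d d ℂ} (hA : A.PosSemidef) (i : d) :
    A i i = ((A i i).re : ℂ) := (hA.isHermitian.coe_re_apply_self i).symm

/-- The populations of a qubit are fixed by its mean charges. -/
theorem diag_of_mem_microstates_qubit {β h : ι → ℝ} (hh : ∃ j, h j ≠ 0)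
    {s : Matrix (Fin 2) (Fin 2) ℂ}
    (hs : s ∈ microstates (qubit h) fun j => expect (gibbs β (qubit h)) (qubit h j)) :
    s 0 0 = ((1 - excited (∑ j, β j * h j) : ℝ) : ℂ) ∧
      s 1 1 = (excited (∑ j, β j * h j) : ℂ) := by
  obtain ⟨j, hj⟩ := hh
  have h1 := hs.2 j
  simp only [expect_qubit, gibbs_qubit_apply] at h1
  have h11 : s 1 1 = (excited (∑ j, β j * h j) : ℂ) := by
    rw [ofReal_re_diag hs.1.1, mul_left_cancel₀ hj h1]
  refine ⟨?_, h11⟩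
  have h2 := hs.1.2
  rw [Matrix.trace_fin_two, h11] at h2
  push_cast
  exact eq_sub_of_add_eq h2

variable {d : Type*} [Fintype d] [DecidableEq d]

/-- For a qubit with some nonzero charge the mean charges determine both populations. The coherences
of `s` remain arbitrary, so usable gates are those whose effect depends on `s 0 0` and `s 1 1`
alone. -/
theorem Realizable.qubitGate {β : ι → ℝ} {C : Matrix d d ℂ → Matrix d d ℂ → (ι → ℝ) → Prop}
    (hC : Realizable β C) {h : ι → ℝ} (hh : ∃ j, h j ≠ 0) {u : ℝ}
    (hu : excited (∑ j, β j * h j) = u) {V : Matrix (d × Fin 2) (d × Fin 2) ℂ}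
    (hV : V ∈ Matrix.unitaryGroup (d × Fin 2) ℂ) :
    Realizable β fun ρ ρ' c => ∃ (ρ₁ : Matrix d d ℂ) (c₁ : ι → ℝ) (s : Matrix (Fin 2) (Fin 2) ℂ),
      IsDensity ρ₁ ∧ C ρ ρ₁ c₁ ∧ s 0 0 = ((1 - u : ℝ) : ℂ) ∧ s 1 1 = (u : ℂ) ∧
      ρ' = partialTrace (V * (ρ₁ ⊗ₖ s) * V.conjTranspose) ∧
      ∀ j, c j = c₁ j +
        h j * (∑ a, ((V * (ρ₁ ⊗ₖ s) * V.conjTranspose) (a, 1) (a, 1)).re - u) := by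
  refine (hC.gate (isHermitian_qubit h) (commute_qubit h) hV).mono ?_
  rintro ρ ρ' c - - ⟨ρ₁, c₁, s, hs, hρ₁, h1, h2, h3⟩
  obtain ⟨h00, h11⟩ := diag_of_mem_microstates_qubit hh hs
  rw [hu] at h00 h11
  refine ⟨ρ₁, c₁, s, hρ₁, h1, h00, h11, h2, fun j => ?_⟩
  rw [h3 j, expect_one_kronecker_qubit, expect_qubit, h11, Complex.ofReal_re]
  ring

/-- The unitary that permutes the basis. -/
def permGate {e : Type*} [DecidableEq e] (g : e ≃ e) : Matrix e e ℂ :=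
  (1 : Matrix e e ℂ).submatrix g (Equiv.refl e)

theorem permGate_conj {e : Type*} [Fintype e] [DecidableEq e] (g : e ≃ e) (X : Matrix e e ℂ) :
    permGate g * X * (permGate g).conjTranspose = X.submatrix g g := by
  rw [permGate, Matrix.conjTranspose_submatrix, Matrix.conjTranspose_one,
    Matrix.one_submatrix_mul, Matrix.mul_submatrix_one]
  rfl

theorem permGate_mem {e : Type*} [Fintype e] [DecidableEq e] (g : e ≃ e) :
    permGate g ∈ Matrix.unitaryGroup e ℂ := by
  have := permGate_conj g 1
  rw [Matrix.mul_one, Matrix.submatrix_one_equiv] at this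
  exact Matrix.mem_unitaryGroup_iff.2 this

theorem trace_re_eq {ρ : Matrix d d ℂ} (hρ : IsDensity ρ) : ∑ a, (ρ a a).re = 1 := by
  have := congrArg Complex.re hρ.2
  rwa [Matrix.trace, Complex.re_sum, Complex.one_re] at this

/-- A unitary on the system alone. -/
theorem Realizable.unitary [Nonempty ι] {β : ι → ℝ}
    {C : Matrix d d ℂ → Matrix d d ℂ → (ι → ℝ) → Prop}
    (hC : Realizable β C) {V : Matrix d d ℂ} (hV : V ∈ Matrix.unitaryGroup d ℂ) :
    Realizable β fun ρ ρ' c => ∃ ρ₁, IsDensity ρ₁ ∧ C ρ ρ₁ c ∧ ρ' = V * ρ₁ * V.conjTranspose := by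
  -- An idle qubit serves as the second factor that a gate requires. It is left untouched, and any
  -- nonzero charges would do.
  refine (hC.qubitGate (h := fun _ => 1) ⟨Classical.arbitrary ι, one_ne_zero⟩ rfl
    (Matrix.kronecker_mem_unitary hV (one_mem (Matrix.unitaryGroup (Fin 2) ℂ)))).mono ?_
  rintro ρ ρ' c - - ⟨ρ₁, c₁, s, hρ₁, h1, h00, h11, h2, h3⟩
  have hconj : (V ⊗ₖ (1 : Matrix (Fin 2) (Fin 2) ℂ)) * (ρ₁ ⊗ₖ s) *
      (V ⊗ₖ (1 : Matrix (Fin 2) (Fin 2) ℂ)).conjTranspose = (V * ρ₁ * V.conjTranspose) ⊗ₖ s := by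
    rw [Matrix.conjTranspose_kronecker, ← Matrix.mul_kronecker_mul, ← Matrix.mul_kronecker_mul,
      Matrix.conjTranspose_one, Matrix.one_mul, Matrix.mul_one]
  have hs : s.trace = 1 := by rw [Matrix.trace_fin_two, h00, h11]; push_cast; ring
  rw [hconj] at h2 h3
  have hc : c = c₁ := by
    funext j
    rw [h3 j]
    simp only [Matrix.kroneckerMap_apply, h11, Complex.re_mul_ofReal, ← Finset.sum_mul]
    rw [trace_re_eq (hρ₁.conj hV)]
    ring
  rw [partialTrace_kronecker, hs, one_smul] at h2
  exact ⟨ρ₁, hρ₁, hc ▸ h1, h2⟩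

/-- The inversion of a qubit, which changes the observables of the environment. -/
theorem Realizable.invert {β : ι → ℝ} {C : Matrix d d ℂ → Matrix d d ℂ → (ι → ℝ) → Prop}
    (hC : Realizable β C) {h : ι → ℝ} (hh : ∃ j, h j ≠ 0) :
    Realizable β fun ρ ρ' c => ∃ c₁, C ρ ρ' c₁ ∧
      ∀ j, c j = c₁ j + h j * (1 - 2 * excited (∑ j, β j * h j)) := by
  refine (hC.qubitGate hh rfl (permGate_mem
    (Equiv.prodCongr (Equiv.refl d) (Equiv.swap (0 : Fin 2) 1)))).mono ?_
  rintro ρ ρ' c - - ⟨ρ₁, c₁, s, hρ₁, h1, h00, h11, h2, h3⟩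
  rw [permGate_conj] at h2 h3
  have : ρ' = ρ₁ := by
    rw [h2]
    ext a b
    simp only [partialTrace, Matrix.of_apply, Fin.sum_univ_two, Matrix.submatrix_apply,
      Equiv.prodCongr_apply, Prod.map, Equiv.refl_apply, Equiv.swap_apply_left,
      Equiv.swap_apply_right, Matrix.kroneckerMap_apply, h00, h11]
    push_cast
    ring
  refine ⟨c₁, this ▸ h1, fun j => ?_⟩
  rw [h3 j]
  simp only [Matrix.submatrix_apply,
      Equiv.prodCongr_apply, Prod.map, Equiv.refl_apply,
      Equiv.swap_apply_right, Matrix.kroneckerMap_apply, h00, Complex.re_mul_ofReal,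
      ← Finset.sum_mul, trace_re_eq hρ₁]
  ring

/-- Random sign flips of one level. -/
theorem Realizable.flip {β : ι → ℝ} {C : Matrix d d ℂ → Matrix d d ℂ → (ι → ℝ) → Prop}
    (hC : Realizable β C) {h : ι → ℝ} (hh : ∃ j, h j ≠ 0) (k : d) :
    Realizable β fun ρ ρ' c => ∃ ρ₁, IsDensity ρ₁ ∧ C ρ ρ₁ c ∧
      ∀ a b, ρ' a b = if (a = k ↔ b = k) then ρ₁ a b else
        ((1 - 2 * excited (∑ j, β j * h j) : ℝ) : ℂ) * ρ₁ a b := by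
  set u := excited (∑ j, β j * h j) with hu
  -- The sign of level `k` is controlled by the qubit. The gate is diagonal and so preserves the
  -- populations and the charge of the qubit, while a coherence between `k` and another level is
  -- multiplied by `(1 - u) - u`.
  set v : d × Fin 2 → ℂ := fun x => if x.1 = k ∧ x.2 = 1 then -1 else 1 with hv
  have hvv : ∀ x, v x * star (v x) = 1 := fun x => by
    simp only [hv]; split_ifs <;> simp
  have hV : Matrix.diagonal v ∈ Matrix.unitaryGroup (d × Fin 2) ℂ := by
    rw [Matrix.mem_unitaryGroup_iff, Matrix.star_eq_conjTranspose, Matrix.diagonal_conjTranspose,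
      Matrix.diagonal_mul_diagonal, ← Matrix.diagonal_one]
    congr 1
    funext x
    exact hvv x
  have hconj : ∀ X : Matrix (d × Fin 2) (d × Fin 2) ℂ, ∀ x y,
      (Matrix.diagonal v * X * (Matrix.diagonal v).conjTranspose) x y =
        v x * X x y * star (v y) := by
    intro X x y
    rw [Matrix.diagonal_conjTranspose, Matrix.mul_diagonal, Matrix.diagonal_mul]
    rfl
  refine (hC.qubitGate hh hu.symm hV).mono ?_
  rintro ρ ρ' c - - ⟨ρ₁, c₁, s, hρ₁, h1, h00, h11, h2, h3⟩
  have hc : c = c₁ := by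
    funext j
    rw [h3 j]
    have : ∀ a, ((Matrix.diagonal v * (ρ₁ ⊗ₖ s) * (Matrix.diagonal v).conjTranspose)
        (a, 1) (a, 1)).re = (ρ₁ a a).re * u := by
      intro a
      rw [hconj, mul_right_comm, hvv, one_mul, Matrix.kroneckerMap_apply, h11,
        Complex.re_mul_ofReal]
    simp only [this, ← Finset.sum_mul, trace_re_eq hρ₁]
    ring
  refine ⟨ρ₁, hρ₁, hc ▸ h1, fun a b => ?_⟩
  rw [h2]
  simp only [partialTrace, Matrix.of_apply, Fin.sum_univ_two, hv]
  by_cases ha : a = k <;> by_cases hb : b = k <;>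
    simp [ha, hb, h00, h11] <;> ring

/-- Dephasing in the standard basis. -/
theorem Realizable.dephase {β : ι → ℝ} {C : Matrix d d ℂ → Matrix d d ℂ → (ι → ℝ) → Prop}
    (hC : Realizable β C) {h : ι → ℝ} (hh : ∃ j, h j ≠ 0) {δ : ℝ}
    (hδ : |1 - 2 * excited (∑ j, β j * h j)| ≤ δ) (hδ1 : δ ≤ 1) (S : Finset d) :
    Realizable β fun ρ ρ' c => ∃ ρ₁, IsDensity ρ₁ ∧ C ρ ρ₁ c ∧ (∀ a, ρ' a a = ρ₁ a a) ∧
      (∀ a b, ‖ρ' a b‖ ≤ ‖ρ₁ a b‖) ∧ ∀ a ∈ S, ∀ b, a ≠ b → ‖ρ' a b‖ ≤ δ * ‖ρ₁ a b‖ := by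
  induction S using Finset.induction with
  | empty =>
    exact hC.mono fun ρ ρ' c _ hρ' h => ⟨ρ', hρ', h, fun _ => rfl, fun _ _ => le_rfl, by simp⟩
  | insert k S hk ih =>
    refine (ih.flip hh k).mono ?_
    rintro ρ ρ' c - - ⟨ρ₂, hρ₂, ⟨ρ₁, hρ₁, h1, h2, h3, h4⟩, h5⟩
    -- A later flip never enlarges an entry, because `δ ≤ 1`; rows already damped stay damped.
    have h6 : ∀ a b, ‖ρ' a b‖ ≤ ‖ρ₂ a b‖ := by
      intro a b
      rw [h5]
      split_ifs
      · exact le_rfl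
      · rw [norm_mul, Complex.norm_real, Real.norm_eq_abs]
        exact mul_le_of_le_one_left (norm_nonneg _) (hδ.trans hδ1)
    refine ⟨ρ₁, hρ₁, h1, fun a => ?_, fun a b => (h6 a b).trans (h3 a b), fun a ha b hab => ?_⟩
    · rw [h5, if_pos Iff.rfl, h2]
    · rcases Finset.mem_insert.1 ha with rfl | ha
      · rw [h5, if_neg (by simpa using hab.symm), norm_mul, Complex.norm_real, Real.norm_eq_abs]
        exact mul_le_mul hδ (h3 _ _) (norm_nonneg _) ((abs_nonneg _).trans hδ)
      · exact (h6 a b).trans (h4 a ha b hab)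

/-- The populations after the exchange of the transition between the levels `i` and `j` with
a two-level system with the populations `1 - u` and `u`. -/
def mix (i j : d) (u : ℝ) (p : d → ℝ) (a : d) : ℝ :=
  if a = i then (p i + p j) * (1 - u) else if a = j then (p i + p j) * u else p a

/-- The exchange of a transition of the system with a qubit. -/
theorem Realizable.exchange {β : ι → ℝ} {C : Matrix d d ℂ → Matrix d d ℂ → (ι → ℝ) → Prop}
    (hC : Realizable β C) {h : ι → ℝ} (hh : ∃ j, h j ≠ 0) {u : ℝ}
    (hu : excited (∑ j, β j * h j) = u) {i k : d} (hik : i ≠ k) :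
    Realizable β fun ρ ρ' c => ∃ ρ₁ c₁, C ρ ρ₁ c₁ ∧
      (∀ a, (ρ' a a).re = mix i k u (fun a => (ρ₁ a a).re) a) ∧
      ∀ j, c j = c₁ j + h j * ((ρ₁ k k).re * (1 - u) - (ρ₁ i i).re * u) := by
  -- Only `(i, 1)` and `(k, 0)` trade places: the transition from `k` to `i` in the system excites
  -- the qubit. Afterwards the pair has the qubit's ratio `1 - u` to `u`.
  refine (hC.qubitGate hh hu (permGate_mem (Equiv.swap (i, (1 : Fin 2)) (k, 0)))).mono ?_
  rintro ρ ρ' c - - ⟨ρ₁, c₁, s, hρ₁, h1, h00, h11, h2, h3⟩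
  rw [permGate_conj] at h2 h3
  have e0 : ∀ a, a ≠ k → Equiv.swap (i, (1 : Fin 2)) (k, 0) (a, 0) = (a, 0) := fun a ha =>
    Equiv.swap_apply_of_ne_of_ne (by simp) (by simp [ha])
  have e1 : ∀ a, a ≠ i → Equiv.swap (i, (1 : Fin 2)) (k, 0) (a, 1) = (a, 1) := fun a ha =>
    Equiv.swap_apply_of_ne_of_ne (by simp [ha]) (by simp)
  refine ⟨ρ₁, c₁, h1, fun a => ?_, fun j => ?_⟩
  · rw [h2]
    simp only [partialTrace, Matrix.of_apply, Fin.sum_univ_two, Matrix.submatrix_apply, mix]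
    by_cases ha : a = i
    · subst ha
      rw [e0 a hik, Equiv.swap_apply_left, if_pos rfl]
      simp only [Matrix.kroneckerMap_apply, h00, Complex.add_re, Complex.re_mul_ofReal]
      ring
    · rw [e1 a ha, if_neg ha]
      by_cases hk : a = k
      · subst hk
        rw [Equiv.swap_apply_right, if_pos rfl]
        simp only [Matrix.kroneckerMap_apply, h11, Complex.add_re, Complex.re_mul_ofReal]
        ring
      · rw [e0 a hk, if_neg hk]
        simp only [Matrix.kroneckerMap_apply, h00, h11, Complex.add_re, Complex.re_mul_ofReal]
        ring
  · rw [h3 j]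
    have hsum : ∑ a, (((ρ₁ ⊗ₖ s).submatrix (Equiv.swap (i, (1 : Fin 2)) (k, 0))
        (Equiv.swap (i, (1 : Fin 2)) (k, 0))) (a, 1) (a, 1)).re =
        (ρ₁ k k).re * (1 - u) + (1 - (ρ₁ i i).re) * u := by
      rw [← Finset.add_sum_erase _ _ (Finset.mem_univ i)]
      congr 1
      · rw [Matrix.submatrix_apply, Equiv.swap_apply_left, Matrix.kroneckerMap_apply, h00,
          Complex.re_mul_ofReal]
      · rw [← trace_re_eq hρ₁, ← Finset.sum_erase_eq_sub (Finset.mem_univ i), Finset.sum_mul]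
        refine Finset.sum_congr rfl fun a ha => ?_
        rw [Matrix.submatrix_apply, e1 a (Finset.ne_of_mem_erase ha), Matrix.kroneckerMap_apply,
          h11, Complex.re_mul_ofReal]
    rw [hsum]
    ring

end Qubit

end MacroThermo

end

noncomputable section

namespace MacroThermo

set_option linter.unusedSectionVars false

/-! ### Quasi-static processes -/

section BinEntropy

/-- The derivative of the binary entropy. -/
def logOdds (u : ℝ) : ℝ := Real.log (1 - u) - Real.log u

/-- The gap with thermal population `u`, in units of the temperature, is also the slope of the
binary entropy at `u`. This coincidence makes slow exchanges reversible. -/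
theorem excited_logOdds {u : ℝ} (h0 : 0 < u) (h1 : u < 1) : excited (logOdds u) = u := by
  rw [excited, logOdds, Real.exp_sub, Real.exp_log (by linarith), Real.exp_log h0]
  field_simp
  ring

theorem binEntropy_eq_log (u : ℝ) :
    Real.binEntropy u = -(u * Real.log u) - (1 - u) * Real.log (1 - u) := by
  rw [Real.binEntropy, Real.log_inv, Real.log_inv]; ring

/-- The binary entropy lies below its tangents. -/
theorem binEntropy_sub_le {x y : ℝ} (hx0 : 0 < x) (hx1 : x < 1) (hy0 : 0 < y) (hy1 : y < 1) :
    Real.binEntropy x - Real.binEntropy y ≤ logOdds y * (x - y) := by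
  have h1 := Real.log_le_sub_one_of_pos (div_pos hy0 hx0)
  have h2 := Real.log_le_sub_one_of_pos (div_pos (sub_pos.2 hy1) (sub_pos.2 hx1))
  rw [Real.log_div hy0.ne' hx0.ne'] at h1
  rw [Real.log_div (sub_pos.2 hy1).ne' (sub_pos.2 hx1).ne'] at h2
  have h3 : x * (Real.log y - Real.log x) ≤ y - x := by
    calc _ ≤ x * (y / x - 1) := mul_le_mul_of_nonneg_left h1 hx0.le
      _ = _ := by field_simp
  have h4 : (1 - x) * (Real.log (1 - y) - Real.log (1 - x)) ≤ (1 - y) - (1 - x) := by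
    have := (sub_pos.2 hx1).ne'
    calc _ ≤ (1 - x) * ((1 - y) / (1 - x) - 1) :=
          mul_le_mul_of_nonneg_left h2 (sub_pos.2 hx1).le
      _ = _ := by field_simp
  rw [binEntropy_eq_log, binEntropy_eq_log, logOdds]
  nlinarith

end BinEntropy

/-! ### Processes on populations and their costs -/

section Drives

variable {ι d : Type*} [Fintype ι] [Fintype d] [DecidableEq d]

theorem mix_mem_stdSimplex {i j : d} (hij : i ≠ j) {u : ℝ} (h0 : 0 ≤ u) (h1 : u ≤ 1) {p : d → ℝ}
    (hp : p ∈ stdSimplex ℝ d) : mix i j u p ∈ stdSimplex ℝ d := by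
  have hij0 : 0 ≤ p i + p j := add_nonneg (hp.1 i) (hp.1 j)
  refine ⟨fun a => ?_, ?_⟩
  · rw [mix]
    split_ifs
    · exact mul_nonneg hij0 (sub_nonneg.2 h1)
    · exact mul_nonneg hij0 h0
    · exact hp.1 a
  · have hj : j ∈ Finset.univ.erase i := Finset.mem_erase.2 ⟨hij.symm, Finset.mem_univ j⟩
    rw [← hp.2, ← Finset.add_sum_erase _ _ (Finset.mem_univ i), ← Finset.add_sum_erase _ _ hj,
      ← Finset.add_sum_erase _ p (Finset.mem_univ i), ← Finset.add_sum_erase _ p hj,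
      Finset.sum_congr (g := p) rfl]
    · simp only [mix, if_true, if_neg hij.symm]
      ring
    · intro a ha
      have ha1 := Finset.ne_of_mem_erase ha
      have ha2 := Finset.ne_of_mem_erase (Finset.mem_of_mem_erase ha)
      rw [mix, if_neg ha2, if_neg ha1]

/-- An exchange keeps the joint population of the two levels and forgets how it was divided, so in a
chain only the last ratio counts. -/
theorem mix_mix {i j : d} (hij : i ≠ j) (u v : ℝ) (p : d → ℝ) :
    mix i j v (mix i j u p) = mix i j v p := by
  funext a
  simp only [mix, if_neg hij.symm, if_true]
  split_ifs <;> ring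

theorem abs_mix_sub_le {i j : d} {u ε : ℝ} (h0 : 0 ≤ u) (h1 : u ≤ 1) {p p' : d → ℝ}
    (h : ∀ a, |p a - p' a| ≤ ε) (a : d) : |mix i j u p a - mix i j u p' a| ≤ 2 * ε := by
  have hε : 0 ≤ ε := (abs_nonneg _).trans (h a)
  have hs : |p i + p j - (p' i + p' j)| ≤ 2 * ε := by
    calc _ = |(p i - p' i) + (p j - p' j)| := by ring_nf
      _ ≤ |p i - p' i| + |p j - p' j| := abs_add_le _ _
      _ ≤ 2 * ε := by linarith [h i, h j]
  simp only [mix]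
  split_ifs
  · rw [← sub_mul, abs_mul, abs_of_nonneg (sub_nonneg.2 h1)]
    exact (mul_le_of_le_one_right (abs_nonneg _) (by linarith)).trans hs
  · rw [← sub_mul, abs_mul, abs_of_nonneg h0]
    exact (mul_le_of_le_one_right (abs_nonneg _) h1).trans hs
  · exact (h a).trans (by linarith)

theorem abs_mix_sub_mix_le (i j : d) (u v : ℝ) {p : d → ℝ} (hp : p ∈ stdSimplex ℝ d) (a : d) :
    |mix i j u p a - mix i j v p a| ≤ 2 * |u - v| := by
  have h1 : ∀ i, p i ≤ 1 := fun i => by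
    rw [← hp.2]
    exact Finset.single_le_sum (fun a _ => hp.1 a) (Finset.mem_univ i)
  have hs : |p i + p j| ≤ 2 := by
    rw [abs_of_nonneg (add_nonneg (hp.1 i) (hp.1 j))]; linarith [h1 i, h1 j]
  simp only [mix]
  split_ifs
  · rw [← mul_sub, abs_mul]
    refine mul_le_mul hs ?_ (abs_nonneg _) zero_le_two
    rw [abs_sub_comm u v]; ring_nf; exact le_rfl
  · rw [← mul_sub, abs_mul]
    exact mul_le_mul_of_nonneg_right hs (abs_nonneg _)
  · simp

theorem pop_mem_stdSimplex {W ρ : Matrix d d ℂ} (hW : W ∈ Matrix.unitaryGroup d ℂ)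
    (hρ : IsDensity ρ) : pop W ρ ∈ stdSimplex ℝ d :=
  ⟨pop_nonneg W hρ.1, sum_pop_of_isDensity hW hρ⟩

/-- Up to arbitrarily small errors, some unitary with some environment turns the populations `p` in
the basis `W` into the populations `f p` in the standard basis, while it increases the observables
of the environment by `c p` along `t`. -/
structure Drives (β t : ι → ℝ) (W : Matrix d d ℂ) (f : (d → ℝ) → d → ℝ)
    (c : (d → ℝ) → ℝ) : Prop where
  mapsTo : ∀ p ∈ stdSimplex ℝ d, f p ∈ stdSimplex ℝ d
  realizable : ∀ ε > 0, Realizable β fun ρ ρ' e => ∃ C : ℝ, (∀ j, e j = t j * C) ∧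
    |C - c (pop W ρ)| ≤ ε ∧ ∀ i, |(ρ' i i).re - f (pop W ρ) i| ≤ ε

variable {β t : ι → ℝ} {W : Matrix d d ℂ}

theorem drives_id [Nonempty ι] (hW : W ∈ Matrix.unitaryGroup d ℂ) :
    Drives β t W (fun p => p) fun _ => 0 where
  mapsTo _ hp := hp
  realizable ε hε := by
    -- Rotating by the adjoint of `W` turns the populations in the basis `W` into diagonal entries.
    refine ((realizable_trivial β).unitary (conjTranspose_mem hW)).mono ?_
    rintro ρ ρ' e - - ⟨ρ₁, -, ⟨rfl, rfl⟩, rfl⟩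
    refine ⟨0, by simp, by simpa using hε.le, fun i => ?_⟩
    rw [Matrix.conjTranspose_conjTranspose]
    simpa [pop] using hε.le

/-- The definition only demands approximations, so it is stable under limits uniform on the simplex.
This gives access to gap zero, to extreme ratios and to infinitely slow processes. -/
theorem Drives.limit (hW : W ∈ Matrix.unitaryGroup d ℂ) {f : (d → ℝ) → d → ℝ}
    {c : (d → ℝ) → ℝ} (hf : ∀ p ∈ stdSimplex ℝ d, f p ∈ stdSimplex ℝ d)
    (h : ∀ η > 0, ∃ f' c', Drives β t W f' c' ∧ ∀ p ∈ stdSimplex ℝ d,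
      |c' p - c p| ≤ η ∧ ∀ i, |f' p i - f p i| ≤ η) : Drives β t W f c where
  mapsTo := hf
  realizable ε hε := by
    obtain ⟨f', c', hD, hfc⟩ := h (ε / 2) (half_pos hε)
    refine (hD.realizable (ε / 2) (half_pos hε)).mono ?_
    rintro ρ ρ' e hρ - ⟨C, h1, h2, h3⟩
    obtain ⟨h4, h5⟩ := hfc _ (pop_mem_stdSimplex hW hρ)
    exact ⟨C, h1, (abs_sub_le _ _ _).trans (by linarith),
      fun i => (abs_sub_le _ _ _).trans (by linarith [h3 i, h5 i])⟩

theorem Drives.congr (hW : W ∈ Matrix.unitaryGroup d ℂ) {f f' : (d → ℝ) → d → ℝ}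
    {c c' : (d → ℝ) → ℝ} (h : Drives β t W f c) (hf : ∀ p ∈ stdSimplex ℝ d, f p = f' p)
    (hc : ∀ p ∈ stdSimplex ℝ d, c p = c' p) : Drives β t W f' c' := by
  refine Drives.limit hW (fun p hp => hf p hp ▸ h.mapsTo p hp) fun η hη =>
    ⟨f, c, h, fun p hp => ?_⟩
  simp [hf p hp, hc p hp, hη.le]

variable (ht : ∑ j, β j * t j = 1) (hW : W ∈ Matrix.unitaryGroup d ℂ)

include ht hW

/-- The gap must not vanish, since the mean charges of a qubit with charges `0` say nothing about
its populations. -/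
theorem Drives.exchange_of_ne {f : (d → ℝ) → d → ℝ} {c : (d → ℝ) → ℝ} (h : Drives β t W f c)
    {i k : d} (hik : i ≠ k) {u : ℝ} (h0 : 0 < u) (h1 : u < 1) (hu : logOdds u ≠ 0) :
    Drives β t W (fun p => mix i k u (f p))
      fun p => c p + logOdds u * (f p k * (1 - u) - f p i * u) where
  mapsTo p hp := mix_mem_stdSimplex hik h0.le h1.le (h.mapsTo p hp)
  realizable ε hε := by
    -- An incoming error `δ` becomes at most `2 * δ` in the populations and `(1 + |logOdds u|) * δ`
    -- in the cost.
    have hL : 0 < 2 + |logOdds u| := by positivity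
    have hgap : ∑ j, β j * (logOdds u * t j) = logOdds u := by
      calc _ = logOdds u * ∑ j, β j * t j := by
            rw [Finset.mul_sum]; exact Finset.sum_congr rfl fun j _ => by ring
        _ = _ := by rw [ht, mul_one]
    have hne : ∃ j, logOdds u * t j ≠ 0 := by
      by_contra! hcon
      simp only [hcon, mul_zero, Finset.sum_const_zero] at hgap
      exact hu hgap.symm
    refine ((h.realizable (ε / (2 + |logOdds u|)) (div_pos hε hL)).exchange hne
      (hgap.symm ▸ excited_logOdds h0 h1) hik).mono ?_
    rintro ρ ρ' e - - ⟨ρ₁, c₁, ⟨C, h2, h3, h4⟩, h5, h6⟩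
    have hδ : ε / (2 + |logOdds u|) * (2 + |logOdds u|) = ε := div_mul_cancel₀ _ hL.ne'
    have hδ0 : 0 < ε / (2 + |logOdds u|) := div_pos hε hL
    set δ := ε / (2 + |logOdds u|)
    refine ⟨C + logOdds u * ((ρ₁ k k).re * (1 - u) - (ρ₁ i i).re * u), fun j => ?_, ?_,
      fun a => ?_⟩
    · rw [h6 j, h2 j]; ring
    · set p := f (pop W ρ)
      have h7 : |((ρ₁ k k).re - p k) * (1 - u) - ((ρ₁ i i).re - p i) * u| ≤ δ := by
        refine (abs_sub _ _).trans ?_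
        rw [abs_mul, abs_mul, abs_of_pos h0, abs_of_pos (sub_pos.2 h1)]
        nlinarith [h4 k, h4 i]
      calc _ = |(C - c (pop W ρ)) +
            logOdds u * (((ρ₁ k k).re - p k) * (1 - u) - ((ρ₁ i i).re - p i) * u)| := by ring_nf
        _ ≤ δ + |logOdds u| * δ := by
          refine (abs_add_le _ _).trans (add_le_add h3 ?_)
          rw [abs_mul]
          exact mul_le_mul_of_nonneg_left h7 (abs_nonneg _)
        _ ≤ ε := by nlinarith
    · rw [h5 a]
      exact (abs_mix_sub_le h0.le h1.le h4 a).trans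
        (by nlinarith [abs_nonneg (logOdds u)])

theorem Drives.exchange {f : (d → ℝ) → d → ℝ} {c : (d → ℝ) → ℝ} (h : Drives β t W f c)
    {i k : d} (hik : i ≠ k) {u : ℝ} (h0 : 0 < u) (h1 : u < 1) :
    Drives β t W (fun p => mix i k u (f p))
      fun p => c p + logOdds u * (f p k * (1 - u) - f p i * u) := by
  by_cases hu : logOdds u = 0
  -- The unbiased qubit has gap zero and is replaced by one with a slightly larger `v`, whose gap is
  -- small but nonzero by strict monotonicity.
  · refine Drives.limit hW (fun p hp => mix_mem_stdSimplex hik h0.le h1.le (h.mapsTo p hp))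
      fun η hη => ?_
    have hcont : ContinuousAt logOdds u :=
      (Real.continuousAt_log (sub_pos.2 h1).ne' |>.comp (by fun_prop)).sub
        (Real.continuousAt_log h0.ne')
    have hev := (Metric.continuousAt_iff.1 hcont) (η / 2) (by positivity)
    obtain ⟨δ, hδ, hev⟩ := hev
    obtain ⟨v, hv1, hv2⟩ := exists_between (lt_min (lt_min h1 (lt_add_of_pos_right u hδ))
      (lt_add_of_pos_right u (half_pos hη)))
    rw [lt_min_iff, lt_min_iff] at hv2
    have hlog : logOdds v < logOdds u :=
      sub_lt_sub (Real.log_lt_log (by linarith) (by linarith)) (Real.log_lt_log h0 hv1)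
    have habs : |v - u| ≤ η / 2 := by rw [abs_of_pos (by linarith)]; linarith
    have hlv : |logOdds v| ≤ η / 2 := by
      have := hev (x := v) (by rw [Real.dist_eq, abs_of_pos (by linarith)]; linarith)
      rw [Real.dist_eq, hu, sub_zero] at this
      exact this.le
    refine ⟨_, _, h.exchange_of_ne ht hW hik (h0.trans hv1) hv2.1.1 (by rw [hu] at hlog; exact hlog.ne),
      fun p hp => ⟨?_, fun a => ?_⟩⟩
    · have hfp := h.mapsTo p hp
      have hle : ∀ a, f p a ≤ 1 := fun a => by
        rw [← hfp.2]
        exact Finset.single_le_sum (fun a _ => hfp.1 a) (Finset.mem_univ a)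
      have hv : 0 < v := h0.trans hv1
      have hbd : |f p k * (1 - v) - f p i * v| ≤ 1 := by
        rw [abs_le]
        constructor <;> nlinarith [hle i, hle k, hfp.1 i, hfp.1 k]
      rw [hu, zero_mul, add_zero, add_sub_cancel_left, abs_mul]
      nlinarith [abs_nonneg (logOdds v)]
    · exact (abs_mix_sub_mix_le i k v u (h.mapsTo p hp) a).trans (by linarith)
  · exact h.exchange_of_ne ht hW hik h0 h1 hu

/-- A chain of exchanges with small steps. -/
theorem Drives.chain {f : (d → ℝ) → d → ℝ} {c : (d → ℝ) → ℝ} (h : Drives β t W f c)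
    {i k : d} (hik : i ≠ k) {u Δ : ℝ} (h0 : 0 < u) (h1 : u < 1) (n : ℕ)
    (hn0 : 0 < u - n * Δ) (hn1 : u - n * Δ < 1) :
    ∃ s, Drives β t W (fun p => mix i k (u - n * Δ) (f p))
      (fun p => c p + logOdds u * (f p k * (1 - u) - f p i * u) + (f p i + f p k) * s) ∧
      0 ≤ s - (Real.binEntropy u - Real.binEntropy (u - n * Δ)) ∧
      s - (Real.binEntropy u - Real.binEntropy (u - n * Δ)) ≤
        (logOdds (u - n * Δ) - logOdds u) * Δ := by
  induction n with
  | zero =>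
    refine ⟨0, ?_, by simp, by simp⟩
    simpa using h.exchange ht hW hik h0 h1
  | succ n ih =>
    -- The intermediate ratios lie between `u` and the last one, whichever sign `Δ` has.
    have hx : 0 < u - n * Δ ∧ u - n * Δ < 1 := by
      push_cast at hn0 hn1
      have hn : (0 : ℝ) ≤ n := Nat.cast_nonneg n
      rcases le_total 0 Δ with hΔ | hΔ
      · exact ⟨by nlinarith, by nlinarith⟩
      · exact ⟨by nlinarith, by nlinarith⟩
    obtain ⟨s, hD, hs0, hs1⟩ := ih hx.1 hx.2
    set x := u - n * Δ with hxdef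
    set y := u - ((n + 1 : ℕ) : ℝ) * Δ with hydef
    have hxy : x - y = Δ := by rw [hxdef, hydef]; push_cast; ring
    -- The tangents at both ends of the step confine the excess of its cost `logOdds y * Δ` over the
    -- entropy difference to the interval from `0` to `(logOdds y - logOdds x) * Δ`; these bounds
    -- telescope.
    have hb1 := binEntropy_sub_le hx.1 hx.2 hn0 hn1
    have hb2 := binEntropy_sub_le hn0 hn1 hx.1 hx.2
    rw [hxy] at hb1
    rw [← neg_sub x y, hxy] at hb2
    refine ⟨s + logOdds y * Δ, ?_, by linarith, by nlinarith⟩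
    refine (hD.exchange ht hW hik hn0 hn1).congr hW (fun p _ => mix_mix hik _ _ _) fun p _ => ?_
    simp only [mix, if_neg hik.symm, if_true]
    rw [← hxy]
    ring

/-- The quasi-static change of the populations of two levels. -/
theorem Drives.quasistatic {f : (d → ℝ) → d → ℝ} {c : (d → ℝ) → ℝ} (h : Drives β t W f c)
    {i k : d} (hik : i ≠ k) {u y : ℝ} (h0 : 0 < u) (h1 : u < 1) (hy0 : 0 ≤ y) (hy1 : y ≤ 1) :
    Drives β t W (fun p => mix i k y (f p))
      fun p => c p - f p i * Real.log (1 - u) - f p k * Real.log u -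
        (f p i + f p k) * Real.binEntropy y := by
  have hsum : ∀ p ∈ stdSimplex ℝ d, 0 ≤ f p i + f p k ∧ f p i + f p k ≤ 2 := fun p hp => by
    have hfp := h.mapsTo p hp
    have hle : ∀ a, f p a ≤ 1 := fun a => by
      rw [← hfp.2]
      exact Finset.single_le_sum (fun a _ => hfp.1 a) (Finset.mem_univ a)
    exact ⟨add_nonneg (hfp.1 i) (hfp.1 k), by linarith [hle i, hle k]⟩
  have hopen : ∀ y, 0 < y → y < 1 → Drives β t W (fun p => mix i k y (f p))
      fun p => c p - f p i * Real.log (1 - u) - f p k * Real.log u -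
        (f p i + f p k) * Real.binEntropy y := by
    intro y hy0 hy1
    refine Drives.limit hW (fun p hp => mix_mem_stdSimplex hik hy0.le hy1.le (h.mapsTo p hp))
      fun η hη => ?_
    set B := |logOdds y - logOdds u| * |u - y| with hB
    -- With `n` steps the total dissipation is at most `B / n` per unit of joint population, and the
    -- joint population is at most `2` by the crude bound `hsum`.
    obtain ⟨n, hn⟩ := exists_nat_gt (2 * B / η)
    have hB0 : 0 ≤ B := by positivity
    have hn0 : (0 : ℝ) < n := lt_of_le_of_lt (by positivity) hn
    have hend : u - n * ((u - y) / n) = y := by field_simp; ring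
    obtain ⟨s, hD, hs0, hs1⟩ := h.chain ht hW hik (Δ := (u - y) / n) h0 h1 n
      (by rw [hend]; exact hy0) (by rw [hend]; exact hy1)
    rw [hend] at hD hs0 hs1
    refine ⟨_, _, hD, fun p hp => ⟨?_, fun a => by simpa using hη.le⟩⟩
    set s' := s - (Real.binEntropy u - Real.binEntropy y)
    have hs' : s' ≤ η / 2 := by
      calc s' ≤ (logOdds y - logOdds u) * ((u - y) / n) := hs1
        _ ≤ |(logOdds y - logOdds u) * ((u - y) / n)| := le_abs_self _
        _ = B / n := by rw [abs_mul, abs_div, abs_of_pos hn0, hB]; ring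
        _ ≤ η / 2 := by
          rw [div_le_iff₀ hn0]
          rw [div_lt_iff₀ hη] at hn
          linarith
    -- The first, sudden exchange together with the entropy term `(f p i + f p k) * binEntropy u`
    -- collapses to `-f p i * log (1 - u) - f p k * log u`, a cross entropy that is linear in the
    -- unknown populations.
    have heq : c p + logOdds u * (f p k * (1 - u) - f p i * u) + (f p i + f p k) * s -
        (c p - f p i * Real.log (1 - u) - f p k * Real.log u -
        (f p i + f p k) * Real.binEntropy y) = (f p i + f p k) * s' := by
      simp only [s', binEntropy_eq_log u, logOdds]
      ring
    obtain ⟨hm0, hm2⟩ := hsum p hp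
    rw [heq, abs_of_nonneg (mul_nonneg hm0 hs0)]
    nlinarith
  refine Drives.limit hW (fun p hp => mix_mem_stdSimplex hik hy0 hy1 (h.mapsTo p hp))
    fun η hη => ?_
  have hcl : y ∈ closure (Set.Ioo (0 : ℝ) 1) := by
    rw [closure_Ioo zero_ne_one]; exact ⟨hy0, hy1⟩
  obtain ⟨δ, hδ, hbin⟩ := Metric.continuousAt_iff.1
    (Real.binEntropy_continuous.continuousAt (x := y)) (η / 2) (half_pos hη)
  obtain ⟨z, hz, hyz⟩ := Metric.mem_closure_iff.1 hcl (min δ (η / 2)) (lt_min hδ (half_pos hη))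
  rw [lt_min_iff, dist_comm] at hyz
  refine ⟨_, _, hopen z hz.1 hz.2, fun p hp => ⟨?_, fun a => ?_⟩⟩
  · obtain ⟨hm0, hm2⟩ := hsum p hp
    have hb := (hbin hyz.1).le
    rw [Real.dist_eq] at hb
    have : ∀ A h h' m : ℝ, A - m * h - (A - m * h') = -(m * (h - h')) := fun _ _ _ _ => by ring
    rw [this, abs_neg, abs_mul, abs_of_nonneg hm0]
    nlinarith [abs_nonneg (Real.binEntropy z - Real.binEntropy y)]
  · refine (abs_mix_sub_mix_le i k z y (h.mapsTo p hp) a).trans ?_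
    have := hyz.2
    rw [Real.dist_eq] at this
    linarith

/-- The quasi-static population of an empty level. -/
theorem Drives.populate {f : (d → ℝ) → d → ℝ} {c : (d → ℝ) → ℝ} (h : Drives β t W f c)
    {i k : d} (hik : i ≠ k) (hk : ∀ p ∈ stdSimplex ℝ d, f p k = 0) {y : ℝ} (hy0 : 0 ≤ y)
    (hy1 : y ≤ 1) :
    Drives β t W (fun p => mix i k y (f p)) fun p => c p - f p i * Real.binEntropy y := by
  refine Drives.limit hW (fun p hp => mix_mem_stdSimplex hik hy0 hy1 (h.mapsTo p hp))
    fun η hη => ?_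
  -- For an empty level the ideal initial ratio is `0`, which is not allowed. The choice `1 - exp
  -- (-η)` makes the extra cost exactly `f p i * η`.
  refine ⟨_, _, h.quasistatic ht hW hik (u := 1 - Real.exp (-η))
    (by simpa using hη) (by linarith [Real.exp_pos (-η)]) hy0 hy1,
    fun p hp => ⟨?_, fun a => by simpa using hη.le⟩⟩
  have hfp := h.mapsTo p hp
  have hle : f p i ≤ 1 := by
    rw [← hfp.2]
    exact Finset.single_le_sum (fun a _ => hfp.1 a) (Finset.mem_univ i)
  rw [hk p hp, sub_sub_cancel, Real.log_exp]
  have : c p - f p i * -η - 0 * Real.log (1 - Real.exp (-η)) - (f p i + 0) * Real.binEntropy y -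
      (c p - f p i * Real.binEntropy y) = f p i * η := by ring
  rw [this, abs_of_nonneg (mul_nonneg (hfp.1 i) hη.le)]
  exact mul_le_of_le_one_left hη.le hle

/-- All levels in a set are merged into the level `i`. -/
theorem drives_merge [Nonempty ι] {q : d → ℝ} (hq : ∀ a, 0 < q a) (i : d) (A : Finset d)
    (hA : i ∉ A) :
    Drives β t W (fun p a => if a = i then p i + ∑ b ∈ A, p b else if a ∈ A then 0 else p a)
      fun p => -(p i * Real.log (q i) + ∑ b ∈ A, p b * Real.log (q b)) +
        (p i + ∑ b ∈ A, p b) * Real.log (q i + ∑ b ∈ A, q b) := by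
  induction A using Finset.induction with
  | empty =>
    refine (drives_id hW).congr hW (fun p _ => ?_) fun p _ => by simp
    funext a
    by_cases h : a = i <;> simp [h]
  | insert k A hk ih =>
    rw [Finset.mem_insert, not_or] at hA
    have ih := ih hA.2
    have hQ : 0 < q i + ∑ b ∈ A, q b := add_pos_of_pos_of_nonneg (hq i)
      (Finset.sum_nonneg fun b _ => (hq b).le)
    set Q := q i + ∑ b ∈ A, q b with hQdef
    have hQk : 0 < Q + q k := add_pos hQ (hq k)
    have hQ' : q i + ∑ b ∈ insert k A, q b = Q + q k := by
      rw [Finset.sum_insert hk, hQdef]; ring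
    have hu : 1 - q k / (Q + q k) = Q / (Q + q k) := by field_simp; ring
    -- The sudden exchange uses the ratio that `q` predicts for level `k` against the levels already
    -- merged, and the final ratio `0` empties `k`. The logarithms of the conditional ratios
    -- telescope to `log q`.
    refine (ih.quasistatic ht hW hA.1 (u := q k / (Q + q k)) (div_pos (hq k) hQk)
      ((div_lt_one hQk).2 (by linarith)) le_rfl zero_le_one).congr hW (fun p _ => ?_) fun p _ => ?_
    · funext a
      simp only [mix, if_true, if_neg (Ne.symm hA.1), if_neg hk, sub_zero, mul_one, mul_zero,
        Finset.sum_insert hk, Finset.mem_insert]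
      by_cases hai : a = i
      · simp only [hai, if_true]; ring
      · by_cases hak : a = k <;> simp [hai, hak, Ne.symm hA.1]
    · simp only [if_true, if_neg (Ne.symm hA.1), if_neg hk]
      rw [hQ', hu, Real.log_div hQ.ne' hQk.ne', Real.log_div (hq k).ne' hQk.ne',
        Finset.sum_insert hk, Finset.sum_insert hk, Real.binEntropy_zero]
      ring

omit [DecidableEq d] [Fintype d] in
omit ht hW in
-- This is the grouping rule of the entropy for a weight `R` divided into `r` and `R - r`. For `R =
-- 0` the junk value `r / 0 = 0` is consistent because then `r = 0`.
theorem mul_binEntropy_div {R r : ℝ} (h : R = 0 → r = 0) :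
    R * Real.binEntropy (r / R) =
      Real.negMulLog r + Real.negMulLog (R - r) - Real.negMulLog R := by
  rcases eq_or_ne R 0 with hR | hR
  · simp [hR, h hR]
  · have h1 : r = R * (r / R) := by field_simp
    have h2 : R - r = R * (1 - r / R) := by field_simp
    rw [h2]
    conv_rhs => rw [h1]
    rw [mul_div_cancel_left₀ _ hR, Real.negMulLog_mul, Real.negMulLog_mul,
      Real.binEntropy_eq_negMulLog_add_negMulLog_one_sub]
    ring

/-- The levels in a set are populated from the level `i`. -/
theorem Drives.split {r : d → ℝ} (hr : r ∈ stdSimplex ℝ d) (i : d) {c : (d → ℝ) → ℝ}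
    (h : Drives β t W (fun _ => Pi.single i 1) c) (A : Finset d) (hA : i ∉ A) :
    Drives β t W (fun _ a => if a ∈ A then r a else if a = i then 1 - ∑ b ∈ A, r b else 0)
      fun p => c p - (∑ b ∈ A, Real.negMulLog (r b) + Real.negMulLog (1 - ∑ b ∈ A, r b)) := by
  induction A using Finset.induction with
  | empty =>
    refine h.congr hW (fun p _ => ?_) fun p _ => by simp
    funext a
    simp [Pi.single_apply]
  | insert k A hk ih =>
    rw [Finset.mem_insert, not_or] at hA
    have ih := ih hA.2
    have hRk : r k ≤ 1 - ∑ b ∈ A, r b := by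
      have : ∑ b ∈ insert k A, r b ≤ 1 := by
        rw [← hr.2]
        exact Finset.sum_le_sum_of_subset_of_nonneg (Finset.subset_univ _) fun a _ _ => hr.1 a
      rw [Finset.sum_insert hk] at this
      linarith
    have hins : 1 - ∑ b ∈ insert k A, r b = (1 - ∑ b ∈ A, r b) - r k := by
      rw [Finset.sum_insert hk]; ring
    set R := 1 - ∑ b ∈ A, r b with hR
    have hR0 : 0 ≤ R := (hr.1 k).trans hRk
    have hRz : R = 0 → r k = 0 := fun h0 => le_antisymm (h0 ▸ hRk) (hr.1 k)
    -- Level `i` still holds the weight `R`; its fraction `r k / R` is passed to the empty level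
    -- `k`.
    refine (ih.populate ht hW hA.1 (fun p _ => by simp [hk, Ne.symm hA.1]) (y := r k / R)
      (div_nonneg (hr.1 k) hR0) (div_le_one_of_le₀ hRk hR0)).congr hW (fun p _ => ?_) fun p _ => ?_
    · have hmul : R * (r k / R) = r k := by
        rcases eq_or_ne R 0 with h0 | h0
        · simp [h0, hRz h0]
        · field_simp
      funext a
      simp only [mix, if_neg hA.2, if_true, if_neg hk, if_neg (Ne.symm hA.1), add_zero, mul_sub,
        mul_one, hmul, Finset.mem_insert, hins]
      by_cases hai : a = i
      · simp [hai, hA.1, hA.2]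
      · by_cases hak : a = k <;> simp [hai, hak, Ne.symm hA.1]
    · simp only [if_neg hA.2, if_true]
      rw [mul_binEntropy_div hRz, hins, Finset.sum_insert hk]
      ring

/-- Any distribution `q` can be exchanged reversibly for any other. -/
theorem drives_const [Nonempty ι] {q : d → ℝ} (hq : ∀ a, 0 < q a) (hq1 : ∑ a, q a = 1)
    {r : d → ℝ} (hr : r ∈ stdSimplex ℝ d) :
    Drives β t W (fun _ => r)
      fun p => ∑ a, p a * -Real.log (q a) - ∑ a, Real.negMulLog (r a) := by
  have hne : Nonempty d := by
    by_contra hcon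
    rw [not_nonempty_iff] at hcon
    simp at hq1
  obtain ⟨i⟩ := hne
  have hi : i ∉ Finset.univ.erase i := by simp
  have hsum : ∀ g : d → ℝ, g i + ∑ b ∈ Finset.univ.erase i, g b = ∑ b, g b := fun g =>
    Finset.add_sum_erase _ _ (Finset.mem_univ i)
  -- When all levels have been merged into `i`, the populations no longer depend on `p`; the
  -- ignorance about `p` survives only in the cost.
  have h1 : Drives β t W (fun _ => Pi.single i 1) fun p => ∑ a, p a * -Real.log (q a) := by
    refine (drives_merge ht hW hq i _ hi).congr hW (fun p hp => ?_) fun p hp => ?_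
    · funext a
      rw [hsum, hp.2]
      by_cases h : a = i <;> simp [h]
    · rw [hsum, hsum q, hq1, hsum fun a => p a * Real.log (q a), Real.log_one, mul_zero, add_zero,
        ← Finset.sum_neg_distrib]
      exact Finset.sum_congr rfl fun a _ => by ring
  have hri : 1 - ∑ b ∈ Finset.univ.erase i, r b = r i := by
    rw [← hr.2, ← hsum r]; ring
  refine (h1.split ht hW hr i _ hi).congr hW (fun p hp => ?_) fun p hp => ?_
  · funext a
    rw [hri]
    by_cases h : a = i <;> simp [h]
  · rw [hri, add_comm, hsum fun a => Real.negMulLog (r a)]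

end Drives

end MacroThermo

end

noncomputable section

namespace MacroThermo

set_option linter.unusedSectionVars false

/-! ### Ensembles of commuting observables -/

section JointDiagonalisation

variable {ι d : Type*} [Fintype d] [DecidableEq d]

open Module.End in
/-- Commuting Hermitian matrices have a common orthonormal eigenbasis. -/
theorem exists_joint_conjDiag {Q : ι → Matrix d d ℂ} (hQ : ∀ j, (Q j).IsHermitian)
    (hc : ∀ i j, Commute (Q i) (Q j)) :
    ∃ W ∈ Matrix.unitaryGroup d ℂ, ∃ lam : ι → d → ℝ, ∀ j, Q j = conjDiag W (lam j) := by
  classical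
  set T : ι → Module.End ℂ (EuclideanSpace ℂ d) := fun j => Matrix.toEuclideanLin (Q j) with hT
  have hsymm : ∀ j, (T j).IsSymmetric := fun j => Matrix.isSymmetric_toEuclideanLin_iff.2 (hQ j)
  have hcomm : Pairwise (Function.onFun Commute T) := by
    intro i j _
    have h := (hc i j).eq
    simp only [Function.onFun, Commute, SemiconjBy, hT]
    ext1 x
    simp only [Module.End.mul_apply, Matrix.toLpLin_apply, Matrix.mulVec_mulVec, h]
  -- The space is the orthogonal direct sum of the joint eigenspaces, so orthonormal bases of these
  -- combine into the required basis.
  have hint := LinearMap.IsSymmetric.directSum_isInternal_of_pairwise_commute hsymm hcomm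
  have horth := LinearMap.IsSymmetric.orthogonalFamily_iInf_eigenspaces hsymm
  set B := hint.collectedBasis fun χ =>
    (stdOrthonormalBasis ℂ (⨅ j, eigenspace (T j) (χ j) : Submodule ℂ _)).toBasis with hB
  have hBo : Orthonormal ℂ B := by
    rw [hB, hint.collectedBasis_coe]
    exact horth.orthonormal_sigma_orthonormal
      (v_family := fun χ => (stdOrthonormalBasis ℂ (⨅ j, eigenspace (T j) (χ j) : Submodule ℂ _)).toBasis)
      fun χ => by simp
  have : Finite (Σ χ : ι → ℂ, Fin (Module.finrank ℂ (⨅ j, eigenspace (T j) (χ j) :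
      Submodule ℂ (EuclideanSpace ℂ d)))) := Module.Finite.finite_basis B
  have := Fintype.ofFinite (Σ χ : ι → ℂ, Fin (Module.finrank ℂ (⨅ j, eigenspace (T j) (χ j) :
      Submodule ℂ (EuclideanSpace ℂ d))))
  have hcard := (Module.finrank_eq_card_basis B).symm.trans (finrank_euclideanSpace (𝕜 := ℂ) (ι := d))
  set e := Fintype.equivOfCardEq hcard with he
  set b := (B.toOrthonormalBasis hBo).reindex e with hb
  have heig : ∀ i j, T j (b i) = (e.symm i).1 j • b i := by
    intro i j
    have h1 : b i ∈ (⨅ j, eigenspace (T j) ((e.symm i).1 j) : Submodule ℂ _) := by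
      have : b i = B (e.symm i) := by simp [hb]
      rw [this, hB]
      exact hint.collectedBasis_mem _ _
    exact mem_eigenspace_iff.1 ((Submodule.mem_iInf _).1 h1 j)
  set W : Matrix d d ℂ := (EuclideanSpace.basisFun d ℂ).toBasis.toMatrix b.toBasis with hW
  have hWu : W ∈ Matrix.unitaryGroup d ℂ :=
    (EuclideanSpace.basisFun d ℂ).toMatrix_orthonormalBasis_mem_unitary b
  have hWa : ∀ a i, W a i = b i a := fun a i => by
    simp [hW, Module.Basis.toMatrix_apply]
  have hQW : ∀ j, Q j * W = W * Matrix.diagonal fun i => (e.symm i).1 j := by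
    intro j
    ext a i
    have h1 := congrArg (fun x : EuclideanSpace ℂ d => x a) (heig i j)
    simp only [hT, Matrix.toLpLin_apply, PiLp.smul_apply, smul_eq_mul] at h1
    rw [Matrix.mul_diagonal, hWa, mul_comm, ← h1]
    simp only [Matrix.mul_apply, hWa]
    rfl
  have hdiag : ∀ j, W.conjTranspose * Q j * W = Matrix.diagonal fun i => (e.symm i).1 j := by
    intro j
    rw [Matrix.mul_assoc, hQW, ← Matrix.mul_assoc, conjTranspose_mul_self_of_mem hWu,
      Matrix.one_mul]
  -- The joint eigenvalues arise as complex numbers; they are diagonal entries of a Hermitian matrix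
  -- and hence real.
  have hreal : ∀ j i, (e.symm i).1 j = (((e.symm i).1 j).re : ℂ) := by
    intro j i
    have h1 : (W.conjTranspose * Q j * W).IsHermitian :=
      Matrix.isHermitian_conjTranspose_mul_mul W (hQ j)
    rw [hdiag] at h1
    have h2 := h1.coe_re_apply_self i
    rw [Matrix.diagonal_apply_eq] at h2
    exact h2.symm
  refine ⟨W, hWu, fun j i => ((e.symm i).1 j).re, fun j => ?_⟩
  have h1 : Q j = Q j * W * W.conjTranspose := by
    rw [Matrix.mul_assoc, mul_conjTranspose_self_of_mem hWu, Matrix.mul_one]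
  rw [h1, hQW, conjDiag]
  congr 3
  funext i
  exact hreal j i

end JointDiagonalisation

/-! ### The Gibbs variational principle -/

section Variational

variable {ι d : Type*} [Fintype ι] [Fintype d] [DecidableEq d]

theorem sum_smul_conjDiag (W : Matrix d d ℂ) (lam : ι → d → ℝ) (b : ι → ℝ) :
    ∑ j, (b j : ℂ) • conjDiag W (lam j) = conjDiag W fun i => ∑ j, b j * lam j i := by
  simp only [conjDiag, ← Matrix.smul_mul, ← Matrix.sum_mul]
  congr 1
  ext x y
  simp only [Matrix.sum_apply, Matrix.smul_apply, Matrix.mul_diagonal, smul_eq_mul,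
    Complex.ofReal_sum, Complex.ofReal_mul, Finset.mul_sum]
  exact Finset.sum_congr rfl fun j _ => by ring

theorem expect_sum_smul (ρ : Matrix d d ℂ) (Q : ι → Matrix d d ℂ) (b : ι → ℝ) :
    expect ρ (∑ j, (b j : ℂ) • Q j) = ∑ j, b j * expect ρ (Q j) := by
  simp only [expect_sum_right, expect_smul_right]

theorem IsDensity.nonempty {ρ : Matrix d d ℂ} (hρ : IsDensity ρ) : Nonempty d := by
  by_contra h
  rw [not_nonempty_iff] at h
  have := hρ.2
  simp at this

/-- The Gibbs variational principle. -/
theorem entropy_le_sum_add_log_partition {ρ : Matrix d d ℂ} (hρ : IsDensity ρ)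
    {W : Matrix d d ℂ} (hW : W ∈ Matrix.unitaryGroup d ℂ) {Q : ι → Matrix d d ℂ} {b : ι → ℝ}
    {m : d → ℝ} (h : ∑ j, (b j : ℂ) • Q j = conjDiag W m) :
    vonNeumannEntropy ρ ≤ ∑ j, b j * expect ρ (Q j) + Real.log (partition m) := by
  have := hρ.nonempty
  refine (entropy_le hW hρ (fun i => (boltzmann_pos m i).le) (sum_boltzmann m).le
    fun i hi => absurd hi (boltzmann_pos m i).ne').trans_eq ?_
  simp only [neg_log_boltzmann, mul_add, Finset.sum_add_distrib, ← Finset.sum_mul]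
  rw [sum_pop_of_isDensity hW hρ, one_mul, ← expect_conjDiag, ← h, expect_sum_smul]

theorem entropy_gibbs [Nonempty d] {W : Matrix d d ℂ} (hW : W ∈ Matrix.unitaryGroup d ℂ)
    {Q : ι → Matrix d d ℂ} {b : ι → ℝ} {m : d → ℝ}
    (h : ∑ j, (b j : ℂ) • Q j = conjDiag W m) :
    vonNeumannEntropy (gibbs b Q) =
      ∑ j, b j * expect (gibbs b Q) (Q j) + Real.log (partition m) := by
  rw [← expect_sum_smul, h, gibbs_eq_conjDiag hW h,
    entropy_conjDiag hW (fun i => (boltzmann_pos m i).le) (sum_boltzmann m), expect_conjDiag]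
  simp only [pop_conjDiag_self hW]
  have : ∀ i, Real.negMulLog (boltzmann m i) =
      boltzmann m i * m i + boltzmann m i * Real.log (partition m) := fun i => by
    rw [← mul_add, ← neg_log_boltzmann, Real.negMulLog]; ring
  simp only [this, Finset.sum_add_distrib, ← Finset.sum_mul, sum_boltzmann, one_mul]

theorem freeEntropy_gibbs_le {Q : ι → Matrix d d ℂ} (hQ : ∀ j, (Q j).IsHermitian) (β : ι → ℝ)
    {ρ : Matrix d d ℂ} (hρ : IsDensity ρ) :
    freeEntropy β Q (gibbs β Q) ≤ freeEntropy β Q ρ := by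
  have := hρ.nonempty
  obtain ⟨W, hW, h⟩ := exists_conjDiag_of_isHermitian (isHermitian_sum_smul hQ β)
  rw [freeEntropy, freeEntropy, entropy_gibbs hW h]
  linarith [entropy_le_sum_add_log_partition hρ hW h]

end Variational

/-! ### Duality, existence and uniqueness of the ensemble -/

section Ensemble

variable {ι d : Type*} [Fintype ι] [Fintype d] [DecidableEq d]

theorem continuous_conjDiag (W : Matrix d d ℂ) : Continuous fun p : d → ℝ => conjDiag W p := by
  unfold conjDiag
  have : Continuous fun p : d → ℝ => Matrix.diagonal fun i => (p i : ℂ) :=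
    Continuous.matrix_diagonal (continuous_pi fun i =>
      Complex.continuous_ofReal.comp (continuous_apply i))
  exact (continuous_const.matrix_mul this).matrix_mul continuous_const

theorem continuous_pop (W : Matrix d d ℂ) (i : d) : Continuous fun A : Matrix d d ℂ => pop W A i := by
  unfold pop
  exact Complex.continuous_re.comp
    (((continuous_const.matrix_mul continuous_id).matrix_mul continuous_const).matrix_elem i i)

theorem continuous_expect (A : Matrix d d ℂ) : Continuous fun ρ : Matrix d d ℂ => expect ρ A := by
  unfold expect
  exact Complex.continuous_re.comp (continuous_id.matrix_mul continuous_const).matrix_trace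

/-- The exponents of the Gibbs states of jointly diagonal observables. -/
def combine (lam : ι → d → ℝ) (b : ι → ℝ) (i : d) : ℝ := ∑ j, b j * lam j i

/-- The dual function whose infimum is the entropy of the ensemble. -/
def dual (lam : ι → d → ℝ) (v b : ι → ℝ) : ℝ :=
  ∑ j, b j * v j + Real.log (partition (combine lam b))

variable {W : Matrix d d ℂ} {Q : ι → Matrix d d ℂ} {lam : ι → d → ℝ}

theorem gibbs_eq_conjDiag_combine (hW : W ∈ Matrix.unitaryGroup d ℂ)
    (hQ : ∀ j, Q j = conjDiag W (lam j)) (b : ι → ℝ) :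
    gibbs b Q = conjDiag W (boltzmann (combine lam b)) := by
  refine gibbs_eq_conjDiag hW ?_
  simp only [hQ, sum_smul_conjDiag]
  rfl

theorem entropy_le_dual (hW : W ∈ Matrix.unitaryGroup d ℂ) (hQ : ∀ j, Q j = conjDiag W (lam j))
    {v : ι → ℝ} {ρ : Matrix d d ℂ} (hρ : ρ ∈ microstates Q v) (b : ι → ℝ) :
    vonNeumannEntropy ρ ≤ dual lam v b := by
  refine (entropy_le_sum_add_log_partition hρ.1 hW (Q := Q) (b := b) (m := combine lam b)
    ?_).trans_eq ?_
  · simp only [hQ, sum_smul_conjDiag]; rfl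
  · rw [dual]
    congr 1
    exact Finset.sum_congr rfl fun j _ => by rw [hρ.2 j]

/-- The ensemble is diagonal, and it saturates the dual bound. -/
theorem IsEnsemble.exists_dual_le [Nonempty d] (hW : W ∈ Matrix.unitaryGroup d ℂ)
    (hQ : ∀ j, Q j = conjDiag W (lam j)) {v : ι → ℝ} {γ : Matrix d d ℂ} (h : IsEnsemble Q v γ) :
    (∃ p ∈ stdSimplex ℝ d, γ = conjDiag W p) ∧
      ∀ η > 0, ∃ b, dual lam v b ≤ vonNeumannEntropy γ + η := by
  have : FirstCountableTopology (Matrix d d ℂ) :=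
    inferInstanceAs (FirstCountableTopology (d → d → ℂ))
  obtain ⟨x, hx, hlim⟩ := mem_closure_iff_seq_limit.1 h.1
  choose b hb using hx
  have hx' : ∀ n, x n = conjDiag W (boltzmann (combine lam (b n))) := fun n => by
    rw [← hb n]; exact gibbs_eq_conjDiag_combine hW hQ (b n)
  set p : d → ℝ := pop W γ with hp
  have hlimp : ∀ i, Filter.Tendsto (fun n => boltzmann (combine lam (b n)) i) Filter.atTop
      (nhds (p i)) := fun i => by
    have h1 := ((continuous_pop W i).tendsto γ).comp hlim
    refine h1.congr fun n => ?_
    rw [Function.comp, hx', pop_conjDiag_self hW]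
  have hγ : γ = conjDiag W p := by
    refine tendsto_nhds_unique hlim ?_
    have h1 := ((continuous_conjDiag W).tendsto p).comp (tendsto_pi_nhds.2 hlimp)
    exact h1.congr fun n => (hx' n).symm
  have hps : p ∈ stdSimplex ℝ d := by
    refine ⟨fun i => ge_of_tendsto' (hlimp i) fun n => (boltzmann_pos _ i).le, ?_⟩
    refine tendsto_nhds_unique (tendsto_finsetSum _ fun i _ => hlimp i) ?_
    simp only [sum_boltzmann]
    exact tendsto_const_nhds
  refine ⟨⟨p, hps, hγ⟩, fun η hη => ?_⟩
  have hv : ∀ j, v j = ∑ i, p i * lam j i := fun j => by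
    rw [← h.2 j, hQ, expect_conjDiag]
  -- As `p` has the expectation values `v`, the dual function at `b n` is the cross entropy of `p`
  -- relative to the approximating Gibbs distribution.
  have hdual : ∀ n, dual lam v (b n) = ∑ i, p i * -Real.log (boltzmann (combine lam (b n)) i) := by
    intro n
    simp only [neg_log_boltzmann, mul_add, Finset.sum_add_distrib, ← Finset.sum_mul, hps.2, one_mul,
      dual, hv, combine, Finset.mul_sum]
    rw [Finset.sum_comm]
    congr 1
    exact Finset.sum_congr rfl fun i _ => Finset.sum_congr rfl fun j _ => by ring
  have htend : Filter.Tendsto (fun n => dual lam v (b n)) Filter.atTop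
      (nhds (vonNeumannEntropy γ)) := by
    rw [hγ, entropy_conjDiag hW hps.1 hps.2]
    simp only [hdual]
    refine tendsto_finsetSum _ fun i _ => ?_
    -- On the boundary the logarithm may diverge at levels where `p` vanishes, but there the summand
    -- is identically zero.
    rcases (hps.1 i).eq_or_lt with h0 | h0
    · simp only [← h0, zero_mul, Real.negMulLog_zero]
      exact tendsto_const_nhds
    · have := (((Real.continuousAt_log h0.ne').tendsto.comp (hlimp i)).neg).const_mul (p i)
      rw [Real.negMulLog, neg_mul, ← mul_neg]
      exact this
  obtain ⟨n, hn⟩ := (htend.eventually (gt_mem_nhds (lt_add_of_pos_right _ hη))).exists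
  exact ⟨b n, hn.le⟩

theorem IsEnsemble.mem_microstates [Nonempty d] (hW : W ∈ Matrix.unitaryGroup d ℂ)
    (hQ : ∀ j, Q j = conjDiag W (lam j)) {v : ι → ℝ} {γ : Matrix d d ℂ} (h : IsEnsemble Q v γ) :
    γ ∈ microstates Q v := by
  obtain ⟨⟨p, hp, hγ⟩, -⟩ := h.exists_dual_le hW hQ
  exact ⟨hγ ▸ isDensity_conjDiag hW hp.1 hp.2, h.2⟩

/-- The dual function dominates the entropy on the whole class, and the ensemble nearly attains its
infimum. -/
theorem IsEnsemble.entropy_le [Nonempty d] (hW : W ∈ Matrix.unitaryGroup d ℂ)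
    (hQ : ∀ j, Q j = conjDiag W (lam j)) {v : ι → ℝ} {γ : Matrix d d ℂ} (h : IsEnsemble Q v γ)
    {ρ : Matrix d d ℂ} (hρ : ρ ∈ microstates Q v) :
    vonNeumannEntropy ρ ≤ vonNeumannEntropy γ := by
  refine le_of_forall_pos_le_add fun η hη => ?_
  obtain ⟨b, hb⟩ := (h.exists_dual_le hW hQ).2 η hη
  exact (entropy_le_dual hW hQ hρ b).trans hb

/-- Two ensembles are diagonal in the same basis and both maximise the entropy. Their midpoint has
the same expectation values, and strict concavity would give it more entropy. -/
theorem IsEnsemble.unique [Nonempty d] (hW : W ∈ Matrix.unitaryGroup d ℂ)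
    (hQ : ∀ j, Q j = conjDiag W (lam j)) {v : ι → ℝ} {γ γ' : Matrix d d ℂ}
    (h : IsEnsemble Q v γ) (h' : IsEnsemble Q v γ') : γ = γ' := by
  obtain ⟨⟨p, hp, rfl⟩, -⟩ := h.exists_dual_le hW hQ
  obtain ⟨⟨p', hp', rfl⟩, -⟩ := h'.exists_dual_le hW hQ
  by_contra hne
  have hpne : p ≠ p' := fun hpp => hne (by rw [hpp])
  set r : d → ℝ := fun i => (1 / 2 : ℝ) • p i + (1 / 2 : ℝ) • p' i with hr
  have hrs : r ∈ stdSimplex ℝ d := convex_stdSimplex ℝ d hp hp' (by norm_num) (by norm_num) (by norm_num)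
  have hmem : conjDiag W r ∈ microstates Q v := by
    refine ⟨isDensity_conjDiag hW hrs.1 hrs.2, fun j => ?_⟩
    have h1 := h.2 j
    have h2 := h'.2 j
    rw [hQ, expect_conjDiag] at h1 h2 ⊢
    simp only [pop_conjDiag_self hW] at h1 h2 ⊢
    simp only [hr, smul_eq_mul, add_mul, Finset.sum_add_distrib, mul_assoc, ← Finset.mul_sum, h1, h2]
    ring
  have hmax := h.entropy_le hW hQ hmem
  have hmax' := h'.entropy_le hW hQ hmem
  rw [entropy_conjDiag hW hrs.1 hrs.2, entropy_conjDiag hW hp.1 hp.2] at hmax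
  rw [entropy_conjDiag hW hrs.1 hrs.2, entropy_conjDiag hW hp'.1 hp'.2] at hmax'
  obtain ⟨k, hk⟩ := Function.ne_iff.1 hpne
  have hlt : ∑ i, ((1 / 2 : ℝ) • Real.negMulLog (p i) + (1 / 2 : ℝ) • Real.negMulLog (p' i)) <
      ∑ i, Real.negMulLog (r i) :=
    Finset.sum_lt_sum
      (fun i _ => Real.concaveOn_negMulLog.2 (hp.1 i) (hp'.1 i) (by norm_num) (by norm_num)
        (by norm_num))
      ⟨k, Finset.mem_univ k, Real.strictConcaveOn_negMulLog.2 (hp.1 k) (hp'.1 k) hk (by norm_num)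
        (by norm_num) (by norm_num)⟩
  simp only [smul_eq_mul, Finset.sum_add_distrib, ← Finset.mul_sum] at hlt
  linarith

/-- Stationary points of the dual function are the parameters whose Gibbs state has the expectation
values `v`. For boundary values there may be none, so a regularised function is minimised below. -/
theorem hasDerivAt_dual [Nonempty d] [DecidableEq ι] (lam : ι → d → ℝ) (v b : ι → ℝ) (j : ι) :
    HasDerivAt (fun s : ℝ => dual lam v (b + s • Pi.single j 1))
      (v j - ∑ i, boltzmann (combine lam b) i * lam j i) 0 := by
  have hcomb : ∀ (s : ℝ) i, combine lam (b + s • Pi.single j 1) i = combine lam b i + s * lam j i := by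
    intro s i
    simp only [combine, Pi.add_apply, Pi.smul_apply, smul_eq_mul, add_mul, Finset.sum_add_distrib,
      Pi.single_apply, mul_ite, mul_one, mul_zero, ite_mul, zero_mul, Finset.sum_ite_eq',
      Finset.mem_univ, if_true]
  have hpart : HasDerivAt (fun s : ℝ => partition (combine lam (b + s • Pi.single j 1)))
      (∑ i, Real.exp (-combine lam b i) * -lam j i) 0 := by
    simp only [partition, hcomb]
    refine HasDerivAt.fun_sum fun i _ => ?_
    have h1 : HasDerivAt (fun s : ℝ => -(combine lam b i + s * lam j i)) (-lam j i) 0 := by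
      simpa using
        (((hasDerivAt_id' (0 : ℝ)).mul_const (lam j i)).const_add (combine lam b i)).fun_neg
    simpa using h1.exp
  have hlin : HasDerivAt (fun s : ℝ => ∑ k, (b + s • Pi.single j 1 : ι → ℝ) k * v k) (v j) 0 := by
    have : ∀ s : ℝ, ∑ k, (b + s • Pi.single j 1 : ι → ℝ) k * v k = ∑ k, b k * v k + s * v j := by
      intro s
      simp only [Pi.add_apply, Pi.smul_apply, smul_eq_mul, add_mul, Finset.sum_add_distrib,
        Pi.single_apply, mul_ite, mul_one, mul_zero, ite_mul, zero_mul, Finset.sum_ite_eq',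
        Finset.mem_univ, if_true]
    simp only [this]
    simpa using ((hasDerivAt_id (0 : ℝ)).mul_const (v j)).const_add (∑ k, b k * v k)
  have h := hlin.add (hpart.log (partition_pos _).ne')
  refine h.congr_deriv ?_
  simp only [zero_smul, add_zero, boltzmann, mul_neg, Finset.sum_neg_distrib, neg_div,
    Finset.sum_div, div_mul_eq_mul_div]
  ring

theorem continuous_dual [Nonempty d] (lam : ι → d → ℝ) (v : ι → ℝ) :
    Continuous fun b => dual lam v b := by
  have h1 : Continuous fun b : ι → ℝ => partition (combine lam b) := by
    unfold partition combine
    fun_prop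
  exact (by fun_prop : Continuous fun b : ι → ℝ => ∑ j, b j * v j).add
    (h1.log fun b => (partition_pos _).ne')

/-- Attainable expectation values are approximately those of Gibbs states. -/
theorem exists_expect_gibbs_near [Nonempty d] (hW : W ∈ Matrix.unitaryGroup d ℂ)
    (hQ : ∀ j, Q j = conjDiag W (lam j)) {v : ι → ℝ} (hv : (microstates Q v).Nonempty) {ε : ℝ}
    (hε : 0 < ε) : ∃ b, ∀ j, |expect (gibbs b Q) (Q j) - v j| ≤ ε := by
  classical
  obtain ⟨ρ, hρ⟩ := hv
  set S := vonNeumannEntropy ρ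
  have hS : ∀ b, S ≤ dual lam v b := entropy_le_dual hW hQ hρ
  set C := dual lam v 0 - S with hC
  have hC0 : 0 ≤ C := sub_nonneg.2 (hS 0)
  -- The error at the regularised minimum is `2 * η * b j`. Its square is `4 * η * (η * b j ^ 2) ≤ 4
  -- * η * C`, hence at most `ε ^ 2`.
  set η := ε ^ 2 / (4 * (C + 1)) with hη
  have hη0 : 0 < η := by positivity
  set Φ : (ι → ℝ) → ℝ := fun b => dual lam v b + η * ∑ j, b j ^ 2 with hΦ
  have hcont : Continuous Φ := (continuous_dual lam v).add (by fun_prop)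
  have hΦ0 : Φ 0 = dual lam v 0 := by simp [hΦ]
  have hnorm : ∀ b : ι → ℝ, ‖b‖ ^ 2 ≤ ∑ j, b j ^ 2 := by
    intro b
    have h0 : 0 ≤ ∑ j, b j ^ 2 := Finset.sum_nonneg fun j _ => sq_nonneg _
    have : ‖b‖ ≤ √(∑ j, b j ^ 2) := by
      refine (pi_norm_le_iff_of_nonneg (Real.sqrt_nonneg _)).2 fun j => ?_
      rw [Real.norm_eq_abs]
      exact Real.abs_le_sqrt (Finset.single_le_sum (f := fun j => b j ^ 2)
        (fun j _ => sq_nonneg _) (Finset.mem_univ j))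
    calc ‖b‖ ^ 2 ≤ √(∑ j, b j ^ 2) ^ 2 := pow_le_pow_left₀ (norm_nonneg _) this 2
      _ = _ := Real.sq_sqrt h0
  -- The dual function is bounded below by the entropy of `ρ`, so the quadratic penalty makes the
  -- sum coercive and a minimiser exists.
  have hcoer : ∀ᶠ b in Filter.cocompact (ι → ℝ), Φ 0 ≤ Φ b := by
    filter_upwards [tendsto_norm_cocompact_atTop.eventually_ge_atTop (C / η + 1)] with b hb
    have h1 : C / η ≤ ‖b‖ ^ 2 := by
      have : 0 ≤ C / η := by positivity
      nlinarith
    have h2 : C ≤ η * ∑ j, b j ^ 2 := by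
      rw [div_le_iff₀ hη0] at h1
      nlinarith [hnorm b]
    rw [hΦ0, hΦ]
    simp only
    linarith [hS b]
  obtain ⟨b, hb⟩ := hcont.exists_forall_le' 0 hcoer
  refine ⟨b, fun j => ?_⟩
  have hder : HasDerivAt (fun s : ℝ => Φ (b + s • Pi.single j 1))
      (v j - ∑ i, boltzmann (combine lam b) i * lam j i + 2 * η * b j) 0 := by
    have hsq : HasDerivAt (fun s : ℝ => η * ∑ k, (b + s • Pi.single j 1 : ι → ℝ) k ^ 2)
        (2 * η * b j) 0 := by
      have : ∀ s : ℝ, η * ∑ k, (b + s • Pi.single j 1 : ι → ℝ) k ^ 2 =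
          η * ∑ k, b k ^ 2 + s * (2 * η * b j) + η * s ^ 2 := by
        intro s
        have : ∀ k, (b + s • Pi.single j 1 : ι → ℝ) k ^ 2 =
            b k ^ 2 + (if k = j then 2 * s * b k + s ^ 2 else 0) := by
          intro k
          by_cases hk : k = j
          · subst hk; simp; ring
          · simp [hk]
        simp only [this, Finset.sum_add_distrib, Finset.sum_ite_eq', Finset.mem_univ, if_true]
        ring
      simp only [this]
      have h1 := ((hasDerivAt_id' (0 : ℝ)).mul_const (2 * η * b j)).const_add (η * ∑ k, b k ^ 2)
      have h2 := ((hasDerivAt_id' (0 : ℝ)).fun_pow 2).const_mul η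
      simpa using h1.fun_add h2
    exact (hasDerivAt_dual lam v b j).add hsq
  have hmin : IsLocalMin (fun s : ℝ => Φ (b + s • Pi.single j 1)) 0 :=
    Filter.Eventually.of_forall fun s => by simpa using hb _
  have hzero := hmin.hasDerivAt_eq_zero hder
  have hmean : expect (gibbs b Q) (Q j) = ∑ i, boltzmann (combine lam b) i * lam j i := by
    rw [gibbs_eq_conjDiag_combine hW hQ, hQ, expect_conjDiag]
    simp only [pop_conjDiag_self hW]
  have hdiff : expect (gibbs b Q) (Q j) - v j = 2 * η * b j := by rw [hmean]; linarith
  -- Comparison of the minimiser with `0` bounds the penalty by the total possible descent of the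
  -- dual function.
  have hbC : η * b j ^ 2 ≤ C := by
    have h1 : b j ^ 2 ≤ ∑ j, b j ^ 2 := Finset.single_le_sum (f := fun j => b j ^ 2)
      (fun j _ => sq_nonneg _) (Finset.mem_univ j)
    have h2 := hb 0
    rw [hΦ0, hΦ] at h2
    simp only at h2
    nlinarith [hS b]
  rw [hdiff]
  refine abs_le_of_sq_le_sq ?_ hε.le
  have h4 : η * (4 * (C + 1)) = ε ^ 2 := by rw [hη]; field_simp
  nlinarith

/-- The ensemble of commuting observables exists. -/
theorem exists_isEnsemble [Nonempty d] (hW : W ∈ Matrix.unitaryGroup d ℂ)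
    (hQ : ∀ j, Q j = conjDiag W (lam j)) {v : ι → ℝ} (hv : (microstates Q v).Nonempty) :
    ∃ γ, IsEnsemble Q v γ := by
  choose b hb using fun n : ℕ =>
    exists_expect_gibbs_near hW hQ hv (ε := 1 / ((n : ℝ) + 1)) Nat.one_div_pos_of_nat
  have hmem : ∀ n, boltzmann (combine lam (b n)) ∈ stdSimplex ℝ d := fun n =>
    ⟨fun i => (boltzmann_pos _ i).le, sum_boltzmann _⟩
  -- The parameters `b n` may diverge, so compactness is applied to the Gibbs distributions instead.
  obtain ⟨p, -, φ, hφ, hlim⟩ := (isCompact_stdSimplex ℝ d).tendsto_subseq hmem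
  have hlim' : Filter.Tendsto (fun n => gibbs (b (φ n)) Q) Filter.atTop (nhds (conjDiag W p)) := by
    refine (((continuous_conjDiag W).tendsto p).comp hlim).congr fun n => ?_
    exact (gibbs_eq_conjDiag_combine hW hQ _).symm
  refine ⟨conjDiag W p, mem_closure_of_tendsto hlim' (Filter.Eventually.of_forall fun n =>
    Set.mem_range_self _), fun j => ?_⟩
  refine tendsto_nhds_unique (((continuous_expect (Q j)).tendsto _).comp hlim') ?_
  rw [tendsto_iff_norm_sub_tendsto_zero]
  refine squeeze_zero (fun n => norm_nonneg _) (fun n => ?_)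
    (tendsto_one_div_add_atTop_nhds_zero_nat.comp hφ.tendsto_atTop)
  exact hb (φ n) j

end Ensemble

end MacroThermo

end

noncomputable section

namespace MacroThermo

set_option linter.unusedSectionVars false

/-! ### Attainable transitions -/

section Achievability

variable {ι d : Type*} [Fintype ι] [Fintype d] [DecidableEq d]

/-- The inversion of a qubit can exchange observables as long as it increases the free entropy. -/
theorem exists_inversion (β η : ι → ℝ) (hη : 0 < ∑ j, β j * η j) :
    ∃ h : ι → ℝ, (∃ j, h j ≠ 0) ∧ ∀ j, h j * (1 - 2 * excited (∑ j, β j * h j)) = η j := by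
  set s := ∑ j, β j * η j with hs
  have hcont : Continuous fun x : ℝ => x * (1 - 2 * excited x) := by
    unfold excited
    have : Continuous fun x : ℝ => (1 + Real.exp x)⁻¹ :=
      (by fun_prop : Continuous fun x : ℝ => 1 + Real.exp x).inv₀ fun x => by positivity
    fun_prop
  -- The function is `x * tanh (x / 2)`. At `2 * s + 2` the exponential is at least `3`, so the
  -- second factor is at least `1 / 2` and the product at least `s + 1`.
  have hend : s ≤ (2 * s + 2) * (1 - 2 * excited (2 * s + 2)) := by
    have h1 : 3 ≤ Real.exp (2 * s + 2) := by linarith [Real.add_one_le_exp (2 * s + 2)]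
    have h2 : excited (2 * s + 2) ≤ 1 / 4 := by
      rw [excited, ← one_div]
      exact one_div_le_one_div_of_le (by norm_num) (by linarith)
    nlinarith
  obtain ⟨x, hx, hxs⟩ := intermediate_value_Icc (by linarith : (0 : ℝ) ≤ 2 * s + 2)
    hcont.continuousOn (show s ∈ Set.Icc _ _ from ⟨by simpa using hη.le, hend⟩)
  simp only at hxs
  have hne : 1 - 2 * excited x ≠ 0 := fun h => by
    rw [h, mul_zero] at hxs; exact hη.ne hxs
  have hgap : ∑ j, β j * (η j / (1 - 2 * excited x)) = x := by
    simp only [← mul_div_assoc, ← Finset.sum_div]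
    rw [← hs, ← hxs, mul_div_cancel_right₀ _ hne]
  refine ⟨fun j => η j / (1 - 2 * excited x), ?_, fun j => ?_⟩
  · by_contra! hcon
    simp only [hcon, mul_zero, Finset.sum_const_zero] at hgap
    rw [← hgap, zero_mul] at hxs
    exact hη.ne hxs
  · rw [hgap, div_mul_cancel₀ _ hne]

/-- The population `1 / 2 - δ / 4` is nearly but not exactly unbiased: with zero charges the state
of the qubit would be undetermined. -/
theorem exists_small_polarisation {β t : ι → ℝ} (ht : ∑ j, β j * t j = 1) {δ : ℝ} (h0 : 0 < δ)
    (h1 : δ ≤ 1) :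
    ∃ h : ι → ℝ, (∃ j, h j ≠ 0) ∧ |1 - 2 * excited (∑ j, β j * h j)| ≤ δ := by
  set u : ℝ := 1 / 2 - δ / 4 with hu
  have hu0 : 0 < u := by linarith
  have hu1 : u < 1 := by linarith
  have hgap : ∑ j, β j * (logOdds u * t j) = logOdds u := by
    calc _ = logOdds u * ∑ j, β j * t j := by
          rw [Finset.mul_sum]; exact Finset.sum_congr rfl fun j _ => by ring
      _ = _ := by rw [ht, mul_one]
  refine ⟨fun j => logOdds u * t j, ?_, ?_⟩
  · by_contra! hcon
    simp only [hcon, mul_zero, Finset.sum_const_zero] at hgap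
    have := excited_logOdds hu0 hu1
    rw [← hgap, excited, Real.exp_zero] at this
    linarith
  · rw [hgap, excited_logOdds hu0 hu1, abs_le]
    constructor <;> linarith

theorem norm_apply_le_one {ρ : Matrix d d ℂ} (hρ : IsDensity ρ) (a b : d) : ‖ρ a b‖ ≤ 1 := by
  obtain ⟨W, hW, p, hp, hp1, rfl, -⟩ := hρ.exists_conjDiag
  rw [conjDiag, Matrix.mul_apply, ← hp1]
  refine (norm_sum_le _ _).trans (Finset.sum_le_sum fun k _ => ?_)
  rw [Matrix.mul_diagonal, Matrix.conjTranspose_apply, norm_mul, norm_mul, norm_star,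
    Complex.norm_real, Real.norm_of_nonneg (hp k)]
  have h1 := entry_norm_bound_of_unitary hW a k
  have h2 := entry_norm_bound_of_unitary hW b k
  have h3 := hp k
  calc ‖W a k‖ * p k * ‖W b k‖ ≤ 1 * p k * 1 := by gcongr
    _ = p k := by ring

theorem norm_conj_apply_le {W : Matrix d d ℂ} (hW : W ∈ Matrix.unitaryGroup d ℂ)
    {A : Matrix d d ℂ} {δ : ℝ} (hA : ∀ a b, ‖A a b‖ ≤ δ) (a b : d) :
    ‖(W * A * W.conjTranspose) a b‖ ≤ (Fintype.card d : ℝ) ^ 2 * δ := by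
  rw [Matrix.mul_apply]
  calc _ ≤ ∑ _y : d, ∑ _x : d, δ := by
        refine (norm_sum_le _ _).trans (Finset.sum_le_sum fun y _ => ?_)
        rw [norm_mul, Matrix.conjTranspose_apply, norm_star]
        refine (mul_le_of_le_one_right (norm_nonneg _) (entry_norm_bound_of_unitary hW b y)).trans ?_
        rw [Matrix.mul_apply]
        refine (norm_sum_le _ _).trans (Finset.sum_le_sum fun x _ => ?_)
        rw [norm_mul]
        exact (mul_le_of_le_one_left (norm_nonneg _) (entry_norm_bound_of_unitary hW a x)).trans
          (hA x y)
    _ = _ := by simp; ring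

variable {W : Matrix d d ℂ} {Q : ι → Matrix d d ℂ} {lam : ι → d → ℝ} {β : ι → ℝ}

/-- The reversible process changes the environment only along `t`. The strict inequality leaves a
positive surplus of free entropy, which the inversion of one qubit absorbs while it corrects every
single observable. -/
theorem exists_process_of_lt [Nonempty ι] (hβ : ∃ j, β j ≠ 0) (hW : W ∈ Matrix.unitaryGroup d ℂ)
    (hQ : ∀ j, Q j = conjDiag W (lam j)) {v b w : ι → ℝ} {ρf : Matrix d d ℂ} (hf : IsDensity ρf)
    (hlt : ∑ j, β j * w j + freeEntropy β Q ρf + dual lam v b < ∑ j, β j * v j) {ε : ℝ}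
    (hε : 0 < ε) :
    ∃ (E : Environment ι) (U : Matrix.unitaryGroup (d × E.Idx) ℂ),
      ∀ ρ ∈ microstates Q v, ∀ σ ∈ E.thermalMicrostates β,
        traceNorm (partialTrace (E.final U ρ σ) - ρf) ≤ ε ∧
        ∀ j, |E.decrease Q U ρ σ j - w j| ≤ ε := by
  classical
  have := hf.nonempty
  obtain ⟨j₀, hj₀⟩ := hβ
  set t : ι → ℝ := Pi.single j₀ (1 / β j₀) with htdef
  have ht : ∑ j, β j * t j = 1 := by
    rw [Finset.sum_eq_single j₀]
    · rw [htdef, Pi.single_eq_same]; field_simp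
    · intro j _ hj; rw [htdef, Pi.single_eq_of_ne hj, mul_zero]
    · simp
  obtain ⟨V, hV, r, hr, hr1, hρf, hS⟩ := hf.exists_conjDiag
  set q := boltzmann (combine lam b) with hq
  set c₀ := dual lam v b - vonNeumannEntropy ρf with hc₀
  -- The environment has to gain `v j - expect ρf (Q j) - w j`; the reversible part supplies `t j *
  -- c₀`, and `η` is what remains for the inversion.
  set η : ι → ℝ := fun j => v j - expect ρf (Q j) - t j * c₀ - w j with hη
  have hη0 : 0 < ∑ j, β j * η j := by
    have : ∑ j, β j * η j = ∑ j, β j * v j - ∑ j, β j * expect ρf (Q j) -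
        (∑ j, β j * t j) * c₀ - ∑ j, β j * w j := by
      rw [Finset.sum_mul, ← Finset.sum_sub_distrib, ← Finset.sum_sub_distrib,
        ← Finset.sum_sub_distrib]
      exact Finset.sum_congr rfl fun j _ => by simp only [hη]; ring
    rw [this, ht, hc₀]
    rw [freeEntropy] at hlt
    linarith
  obtain ⟨h₁, hh₁, hinv⟩ := exists_inversion β η hη0
  set D : ℝ := (Fintype.card d : ℝ) with hD
  -- The constants by which an error `δ` is amplified in the trace norm and in each observable,
  -- added up; the final `1` makes `M` positive.
  set M : ℝ := D ^ 2 * D ^ 2 + ∑ j, (D ^ 2 * entrySum (Q j) + |t j|) + 1 with hM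
  have hterm : ∀ j, 0 ≤ D ^ 2 * entrySum (Q j) + |t j| := fun j =>
    add_nonneg (mul_nonneg (sq_nonneg _) (entrySum_nonneg _)) (abs_nonneg _)
  have hsum0 : 0 ≤ ∑ j, (D ^ 2 * entrySum (Q j) + |t j|) := Finset.sum_nonneg fun j _ => hterm j
  have hM0 : 0 < M := by positivity
  set δ := min 1 (ε / M) with hδ
  have hδ0 : 0 < δ := lt_min one_pos (div_pos hε hM0)
  have hδ1 : δ ≤ 1 := min_le_left _ _
  have hδε : δ * M ≤ ε := by
    calc δ * M ≤ ε / M * M := mul_le_mul_of_nonneg_right (min_le_right _ _) hM0.le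
      _ = ε := div_mul_cancel₀ _ hM0.ne'
  obtain ⟨h₂, hh₂, hpol⟩ := exists_small_polarisation ht hδ0 hδ1
  have hdrive := (drives_const ht hW (q := q) (fun a => boltzmann_pos _ a) (sum_boltzmann _)
    (r := r) ⟨hr, hr1⟩).realizable δ hδ0
  obtain ⟨E, U, hEU⟩ := ((hdrive.invert hh₁).dephase hh₂ hpol hδ1 Finset.univ).unitary hV
  refine ⟨E, U, fun ρ hρ σ hσ => ?_⟩
  have hσd := E.isDensity_of_mem_thermalMicrostates hσ
  obtain ⟨ρ₂, hρ₂, ⟨ρ₁, hρ₁, ⟨c₁, ⟨C, hc₁, hC, hpops⟩, henv⟩, hdiag, -, hoff⟩, hfin⟩ :=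
    hEU ρ hρ.1 σ hσ
  -- The Gibbs choice of `q` is decisive here: the cost sees the microstate only through its
  -- expectation values, so one unitary serves the whole class.
  have hcost : ∑ a, pop W ρ a * -Real.log (q a) - ∑ a, Real.negMulLog (r a) = c₀ := by
    rw [hc₀, hS, dual]
    simp only [hq, neg_log_boltzmann, mul_add, Finset.sum_add_distrib, ← Finset.sum_mul]
    rw [sum_pop_of_isDensity hW hρ.1, one_mul, ← expect_conjDiag]
    have : conjDiag W (combine lam b) = ∑ j, (b j : ℂ) • Q j := by
      simp only [hQ, sum_smul_conjDiag]; rfl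
    rw [this, expect_sum_smul, Finset.sum_congr rfl fun j _ => by rw [hρ.2 j]]
  rw [hcost] at hC
  have hentry : ∀ a b, ‖(ρ₂ - Matrix.diagonal fun i => (r i : ℂ)) a b‖ ≤ δ := by
    intro a b
    rw [Matrix.sub_apply]
    rcases eq_or_ne a b with rfl | hab
    · rw [Matrix.diagonal_apply_eq, hdiag, ofReal_re_diag hρ₁.1, ← Complex.ofReal_sub,
        Complex.norm_real]
      exact hpops a
    · rw [Matrix.diagonal_apply_ne _ hab, sub_zero]
      exact (hoff a (Finset.mem_univ a) b hab).trans
        (mul_le_of_le_one_right hδ0.le (norm_apply_le_one hρ₁ a b))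
  have hclose : ∀ a b, ‖(partialTrace (E.final U ρ σ) - ρf) a b‖ ≤ D ^ 2 * δ := by
    have : partialTrace (E.final U ρ σ) - ρf =
        V * (ρ₂ - Matrix.diagonal fun i => (r i : ℂ)) * V.conjTranspose := by
      rw [hfin, hρf, conjDiag, Matrix.mul_sub, Matrix.sub_mul]
    rw [this]
    exact norm_conj_apply_le hV hentry
  refine ⟨(traceNorm_le hclose (by positivity)).trans ?_, fun j => ?_⟩
  · nlinarith
  · have h1 : E.decrease Q U ρ σ j - w j =
        -expect (partialTrace (E.final U ρ σ) - ρf) (Q j) - t j * (C - c₀) := by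
      rw [E.decrease_eq Q U ρ hσd, hρ.2 j, henv j, hc₁ j, hinv j, expect_sub_left]
      simp only [hη]
      ring
    have h2 := abs_expect_le_of_norm_le hclose (Q j)
    have h3 : |t j * (C - c₀)| ≤ |t j| * δ := by
      rw [abs_mul]; exact mul_le_mul_of_nonneg_left hC (abs_nonneg _)
    have h4 : D ^ 2 * entrySum (Q j) + |t j| ≤ M := by
      have := Finset.single_le_sum (f := fun j => D ^ 2 * entrySum (Q j) + |t j|)
        (fun j _ => hterm j) (Finset.mem_univ j)
      nlinarith [sq_nonneg (D ^ 2)]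
    rw [h1]
    calc _ ≤ |expect (partialTrace (E.final U ρ σ) - ρf) (Q j)| + |t j * (C - c₀)| := by
          refine (abs_sub _ _).trans_eq ?_
          rw [abs_neg]
      _ ≤ D ^ 2 * δ * entrySum (Q j) + |t j| * δ := add_le_add h2 h3
      _ = δ * (D ^ 2 * entrySum (Q j) + |t j|) := by ring
      _ ≤ δ * M := mul_le_mul_of_nonneg_left h4 hδ0.le
      _ ≤ ε := hδε

/-- Every transition allowed by the free entropy can be achieved. -/
theorem exists_process [Nonempty ι] (hβ : ∃ j, β j ≠ 0) (hW : W ∈ Matrix.unitaryGroup d ℂ)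
    (hQ : ∀ j, Q j = conjDiag W (lam j)) {v w : ι → ℝ} {γ ρf : Matrix d d ℂ}
    (hγ : IsEnsemble Q v γ) (hf : IsDensity ρf)
    (hle : ∑ j, β j * w j ≤ freeEntropy β Q γ - freeEntropy β Q ρf) {ε : ℝ} (hε : 0 < ε) :
    ∃ (E : Environment ι) (U : Matrix.unitaryGroup (d × E.Idx) ℂ),
      ∀ ρ ∈ microstates Q v, ∀ σ ∈ E.thermalMicrostates β,
        traceNorm (partialTrace (E.final U ρ σ) - ρf) ≤ ε ∧
        ∀ j, |E.decrease Q U ρ σ j - w j| ≤ ε := by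
  classical
  have := hf.nonempty
  obtain ⟨j₀, hj₀⟩ := id hβ
  set t : ι → ℝ := Pi.single j₀ (1 / β j₀) with htdef
  have ht : ∑ j, β j * t j = 1 := by
    rw [Finset.sum_eq_single j₀]
    · rw [htdef, Pi.single_eq_same]; field_simp
    · intro j _ hj; rw [htdef, Pi.single_eq_of_ne hj, mul_zero]
    · simp
  have hT0 : 0 ≤ ∑ j, |t j| := Finset.sum_nonneg fun j _ => abs_nonneg _
  -- Lowering the target `w` by `ν * t` reduces its weighted sum by `ν`. With `b` chosen so that
  -- `dual` exceeds the entropy of the ensemble by at most `ν / 2`, this yields the strict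
  -- inequality.
  set ν := ε / (2 * (∑ j, |t j| + 1)) with hν
  have hν0 : 0 < ν := by positivity
  have hνt : ∀ j, ν * |t j| ≤ ε / 2 := by
    intro j
    have h1 : |t j| ≤ ∑ j, |t j| + 1 := by
      have := Finset.single_le_sum (f := fun j => |t j|) (fun j _ => abs_nonneg _)
        (Finset.mem_univ j)
      linarith
    have h2 : ν * (∑ j, |t j| + 1) = ε / 2 := by rw [hν]; field_simp
    nlinarith
  obtain ⟨b, hb⟩ := (hγ.exists_dual_le hW hQ).2 (ν / 2) (half_pos hν0)
  have hlt : ∑ j, β j * (w j - ν * t j) + freeEntropy β Q ρf + dual lam v b <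
      ∑ j, β j * v j := by
    have h1 : ∑ j, β j * (w j - ν * t j) = ∑ j, β j * w j - ν := by
      calc _ = ∑ j, β j * w j - ν * ∑ j, β j * t j := by
            rw [Finset.mul_sum, ← Finset.sum_sub_distrib]
            exact Finset.sum_congr rfl fun j _ => by ring
        _ = _ := by rw [ht, mul_one]
    have h2 : freeEntropy β Q γ = ∑ j, β j * v j - vonNeumannEntropy γ := by
      rw [freeEntropy, Finset.sum_congr rfl fun j _ => by rw [hγ.2 j]]
    linarith
  obtain ⟨E, U, h⟩ := exists_process_of_lt hβ hW hQ hf hlt (half_pos hε)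
  refine ⟨E, U, fun ρ hρ σ hσ => ?_⟩
  obtain ⟨h1, h2⟩ := h ρ hρ σ hσ
  refine ⟨h1.trans (by linarith), fun j => ?_⟩
  calc _ = |(E.decrease Q U ρ σ j - (w j - ν * t j)) - ν * t j| := by ring_nf
    _ ≤ ε / 2 + ν * |t j| := by
      refine (abs_sub _ _).trans (add_le_add (h2 j) ?_)
      rw [abs_mul, abs_of_pos hν0]
    _ ≤ ε := by linarith [hνt j]

end Achievability

/-! ### Unattainable transitions -/

section Converse

variable {ι d : Type*} [Fintype ι] [Fintype d] [DecidableEq d] {β : ι → ℝ}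
  {Q : ι → Matrix d d ℂ}

/-- The entropy is not Lipschitz, so the free entropy of the actual final state is bounded below by
a linear functional, whose error is controlled by the trace norm. The set `T` allows targets that
vary with the protocol, provided that one functional works for all of them. -/
theorem le_freeEntropy_sub {w : ι → ℝ} {γ : Matrix d d ℂ} (hγ : IsDensity γ)
    {T : Set (Matrix d d ℂ)} {g : ℝ}
    (hT : ∀ κ > 0, ∃ K : Matrix d d ℂ, (∀ ρ, IsDensity ρ → vonNeumannEntropy ρ ≤ expect ρ K) ∧
      ∀ ρ ∈ T, g - κ ≤ ∑ j, β j * expect ρ (Q j) - expect ρ K)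
    (h : ∀ ε > 0, ∃ (E : Environment ι) (U : Matrix.unitaryGroup (d × E.Idx) ℂ), ∃ ρ ∈ T,
      traceNorm (partialTrace (E.final U γ (E.gibbsFamily β)) - ρ) ≤ ε ∧
      ∀ j, |E.decrease Q U γ (E.gibbsFamily β) j - w j| ≤ ε) :
    ∑ j, β j * w j ≤ freeEntropy β Q γ - g := by
  refine le_of_forall_pos_le_add fun κ hκ => ?_
  obtain ⟨K, hK, hKT⟩ := hT (κ / 2) (half_pos hκ)
  set M := ∑ j, (β j : ℂ) • Q j - K with hM
  have hexpM : ∀ ρ, expect ρ M = ∑ j, β j * expect ρ (Q j) - expect ρ K := fun ρ => by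
    rw [hM, ← expect_sum_smul]
    simp [expect, Matrix.mul_sub]
  -- An error `ε` shifts the linear bound by at most `ε * entrySum M` and the weighted decrease by
  -- at most `ε * ∑ j, |β j|`.
  set L := entrySum M + ∑ j, |β j| + 1 with hL
  have hB0 : 0 ≤ ∑ j, |β j| := Finset.sum_nonneg fun j _ => abs_nonneg _
  have hL0 : 0 < L := by linarith [entrySum_nonneg M]
  obtain ⟨E, U, ρ, hρ, htr, hdec⟩ := h (κ / (2 * L)) (by positivity)
  have hε : κ / (2 * L) * L = κ / 2 := by field_simp
  have hε0 : 0 < κ / (2 * L) := by positivity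
  set ε := κ / (2 * L)
  have h1 := E.sum_mul_decrease_le β Q U hγ
  have hσ := E.isDensity_of_mem_thermalMicrostates (E.gibbsFamily_mem_thermalMicrostates β)
  set ρ' := partialTrace (E.final U γ (E.gibbsFamily β)) with hρ'
  have hd : IsDensity ρ' := (E.isDensity_final U hγ hσ).partialTrace
  have h2 : g - κ / 2 - ε * entrySum M ≤ freeEntropy β Q ρ' := by
    have h3 := hK ρ' hd
    have h4 := hKT ρ hρ
    have h5 := abs_expect_le (ρ' - ρ) M
    rw [expect_sub_left, hexpM, hexpM] at h5
    have h6 : traceNorm (ρ' - ρ) * entrySum M ≤ ε * entrySum M :=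
      mul_le_mul_of_nonneg_right htr (entrySum_nonneg M)
    have h7 := (abs_le.1 h5).1
    rw [freeEntropy]
    linarith
  have h3 : ∑ j, β j * w j - ε * ∑ j, |β j| ≤
      ∑ j, β j * E.decrease Q U γ (E.gibbsFamily β) j := by
    rw [Finset.mul_sum, ← Finset.sum_sub_distrib]
    refine Finset.sum_le_sum fun j _ => ?_
    have h4 : |β j * (E.decrease Q U γ (E.gibbsFamily β) j - w j)| ≤ ε * |β j| := by
      rw [abs_mul, mul_comm]
      exact mul_le_mul_of_nonneg_right (hdec j) (abs_nonneg _)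
    have h5 := (abs_le.1 h4).1
    linarith
  nlinarith

theorem le_freeEntropy_sub_freeEntropy {w : ι → ℝ} {γ ρf : Matrix d d ℂ} (hγ : IsDensity γ)
    (hf : IsDensity ρf)
    (h : ∀ ε > 0, ∃ (E : Environment ι) (U : Matrix.unitaryGroup (d × E.Idx) ℂ),
      traceNorm (partialTrace (E.final U γ (E.gibbsFamily β)) - ρf) ≤ ε ∧
      ∀ j, |E.decrease Q U γ (E.gibbsFamily β) j - w j| ≤ ε) :
    ∑ j, β j * w j ≤ freeEntropy β Q γ - freeEntropy β Q ρf := by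
  refine le_freeEntropy_sub (T := {ρf}) hγ (fun κ hκ => ?_) fun ε hε => ?_
  · obtain ⟨K, hK, hKf⟩ := exists_entropy_le_expect hf hκ
    refine ⟨K, hK, ?_⟩
    rintro ρ rfl
    rw [freeEntropy]
    linarith
  · obtain ⟨E, U, h1, h2⟩ := h ε hε
    exact ⟨E, U, ρf, rfl, h1, h2⟩

variable {W : Matrix d d ℂ} {lam : ι → d → ℝ}

/-- The final microstate may change with the errors, so the bound must be uniform over its class.
Minus the logarithm of a Gibbs distribution provides this: its expectation is constant on the class,
equal to `dual`, and nearly the entropy of the ensemble. -/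
theorem freeEntropy_le_of_macToMac (hW : W ∈ Matrix.unitaryGroup d ℂ)
    (hQ : ∀ j, Q j = conjDiag W (lam j)) {v v' : ι → ℝ} {γ γ' : Matrix d d ℂ}
    (hγ : γ ∈ microstates Q v) (hγ' : IsEnsemble Q v' γ') (h : MacToMac β Q v v') :
    freeEntropy β Q γ' ≤ freeEntropy β Q γ := by
  have := hγ.1.nonempty
  have key := le_freeEntropy_sub (β := β) (Q := Q) (w := fun _ => 0) (T := microstates Q v')
    (g := freeEntropy β Q γ') hγ.1 (fun κ hκ => ?_) fun ε hε => ?_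
  · simp only [mul_zero, Finset.sum_const_zero] at key
    linarith
  · obtain ⟨b, hb⟩ := (hγ'.exists_dual_le hW hQ).2 κ hκ
    have hK : ∀ ρ, IsDensity ρ → expect ρ (conjDiag W fun i =>
        -Real.log (boltzmann (combine lam b) i)) =
        ∑ j, b j * expect ρ (Q j) + Real.log (partition (combine lam b)) := by
      intro ρ hρ
      rw [expect_conjDiag]
      simp only [neg_log_boltzmann, mul_add, Finset.sum_add_distrib, ← Finset.sum_mul]
      rw [sum_pop_of_isDensity hW hρ, one_mul, ← expect_conjDiag, ← expect_sum_smul]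
      simp only [hQ, sum_smul_conjDiag]
      rfl
    refine ⟨conjDiag W fun i => -Real.log (boltzmann (combine lam b) i), fun ρ hρ => ?_,
      fun ρ hρ => ?_⟩
    · rw [hK ρ hρ]
      refine entropy_le_sum_add_log_partition hρ hW ?_
      simp only [hQ, sum_smul_conjDiag]
      rfl
    · rw [hK ρ hρ.1, freeEntropy]
      simp only [hρ.2, hγ'.2]
      rw [dual] at hb
      linarith
  · obtain ⟨E, U, h1⟩ := h ε hε ε hε
    obtain ⟨⟨ρ', hρ', h2⟩, h3⟩ := h1 γ hγ _ (E.gibbsFamily_mem_thermalMicrostates β)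
    exact ⟨E, U, ρ', hρ', h2, fun j => by simpa using h3 j⟩

end Converse

/-! ### The second law for commuting observables -/

section SeveralObservables

variable {ι d : Type*} [Fintype ι] [Fintype d] [DecidableEq d] {β v : ι → ℝ}
  {Q : ι → Matrix d d ℂ}

theorem existsUnique_isEnsemble (hQ : ∀ j, (Q j).IsHermitian) (hc : ∀ i j, Commute (Q i) (Q j))
    (hv : (microstates Q v).Nonempty) : ∃! γ, IsEnsemble Q v γ := by
  obtain ⟨W, hW, lam, h⟩ := exists_joint_conjDiag hQ hc
  have := hv.some_mem.1.nonempty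
  obtain ⟨γ, hγ⟩ := exists_isEnsemble hW h hv
  exact ⟨γ, hγ, fun γ' hγ' => hγ'.unique hW h hγ⟩

theorem isEnsemble_ensemble (hQ : ∀ j, (Q j).IsHermitian) (hc : ∀ i j, Commute (Q i) (Q j))
    (hv : (microstates Q v).Nonempty) : IsEnsemble Q v (ensemble Q v) := by
  have h := (existsUnique_isEnsemble hQ hc hv).exists
  rw [ensemble, dif_pos h]
  exact h.choose_spec

theorem ensemble_mem_microstates (hQ : ∀ j, (Q j).IsHermitian) (hc : ∀ i j, Commute (Q i) (Q j))
    (hv : (microstates Q v).Nonempty) : ensemble Q v ∈ microstates Q v := by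
  obtain ⟨W, hW, lam, h⟩ := exists_joint_conjDiag hQ hc
  have := hv.some_mem.1.nonempty
  exact (isEnsemble_ensemble hQ hc hv).mem_microstates hW h

/-- The second law for several commuting observables. -/
theorem macReach_iff [Nonempty ι] (hQ : ∀ j, (Q j).IsHermitian)
    (hc : ∀ i j, Commute (Q i) (Q j)) (hβ : ∃ j, β j ≠ 0) (hv : (microstates Q v).Nonempty)
    {ρf : Matrix d d ℂ} (hf : IsDensity ρf) :
    MacReach β Q v ρf ↔ freeEntropy β Q (ensemble Q v) ≥ freeEntropy β Q ρf := by
  have hmem := ensemble_mem_microstates hQ hc hv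
  constructor
  · intro h
    have key := le_freeEntropy_sub_freeEntropy (β := β) (Q := Q) (w := fun _ => 0) hmem.1 hf
      fun ε hε => by
        obtain ⟨E, U, h1⟩ := h ε hε ε hε
        obtain ⟨h2, h3⟩ := h1 _ hmem _ (E.gibbsFamily_mem_thermalMicrostates β)
        exact ⟨E, U, h2, fun j => by simpa using h3 j⟩
    simp only [mul_zero, Finset.sum_const_zero] at key
    linarith
  · intro h ε hε ε' hε'
    obtain ⟨W, hW, lam, hlam⟩ := exists_joint_conjDiag hQ hc
    obtain ⟨E, U, h1⟩ := exists_process (w := fun _ => 0) hβ hW hlam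
      (isEnsemble_ensemble hQ hc hv) hf (by simpa using h) (lt_min hε hε')
    refine ⟨E, U, fun ρ hρ σ hσ => ?_⟩
    obtain ⟨h2, h3⟩ := h1 ρ hρ σ hσ
    exact ⟨h2.trans (min_le_left _ _), fun j => by
      simpa using (h3 j).trans (min_le_right _ _)⟩

end SeveralObservables

/-! ### The energy: Clausius inequality and work extraction -/

section Energy

variable {d : Type*} [Fintype d] [DecidableEq d] {β : ℝ} {H : Matrix d d ℂ} {e : ℝ}

theorem freeEntropy_eq_mul_freeEnergy (hβ : 0 < β) (ρ : Matrix d d ℂ) :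
    freeEntropy (fun _ : Unit => β) (fun _ => H) ρ = β * freeEnergy β H ρ := by
  rw [freeEntropy, freeEnergy]
  simp only [Finset.univ_unique, Finset.sum_singleton]
  field_simp

theorem canonical_mem_energyMicrostates (hH : H.IsHermitian) (he : (energyMicrostates H e).Nonempty) :
    canonical H e ∈ energyMicrostates H e :=
  ensemble_mem_microstates (fun _ => hH) (fun _ _ => Commute.refl H) he

theorem isDensity_thermal [Nonempty d] (hH : H.IsHermitian) (β : ℝ) : IsDensity (thermal β H) :=
  isDensity_gibbs (fun _ => hH) _

theorem energyMacReach_iff (hH : H.IsHermitian) (hβ : 0 < β)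
    (he : (energyMicrostates H e).Nonempty) {ρf : Matrix d d ℂ} (hf : IsDensity ρf) :
    EnergyMacReach β H e ρf ↔ freeEnergy β H (canonical H e) ≥ freeEnergy β H ρf := by
  have h := macReach_iff (β := fun _ : Unit => β) (Q := fun _ => H) (v := fun _ => e)
    (fun _ => hH) (fun _ _ => Commute.refl H) ⟨(), hβ.ne'⟩ he hf
  rw [freeEntropy_eq_mul_freeEnergy hβ, freeEntropy_eq_mul_freeEnergy hβ, ge_iff_le,
    mul_le_mul_iff_right₀ hβ] at h
  exact h

theorem macroEntropy_eq (hH : H.IsHermitian) (hβ : 0 < β) (he : (energyMicrostates H e).Nonempty) :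
    macroEntropy β H e = vonNeumannEntropy (canonical H e) := by
  have h : expect (canonical H e) H = e := (canonical_mem_energyMicrostates hH he).2 ()
  rw [macroEntropy, macroFreeEnergy, freeEnergy, h]
  field_simp
  ring

/-- The Clausius inequality. -/
theorem clausius_tfae (hH : H.IsHermitian) (hβ : 0 < β) (he : (energyMicrostates H e).Nonempty)
    {e' : ℝ} (he' : (energyMicrostates H e').Nonempty) :
    List.TFAE [EnergyMacReach β H e (canonical H e'),
      ∃ ρf ∈ energyMicrostates H e', EnergyMacReach β H e ρf,
      EnergyMacToMac β H e e',
      e - e' ≥ 1 / β * (macroEntropy β H e - macroEntropy β H e')] := by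
  have hmem := canonical_mem_energyMicrostates hH he'
  tfae_have 1 → 2 := fun h => ⟨_, hmem, h⟩
  tfae_have 2 → 3 := by
    rintro ⟨ρf, hρf, h⟩ ε hε ε' hε'
    obtain ⟨E, U, h1⟩ := h ε hε ε' hε'
    exact ⟨E, U, fun ρ hρ σ hσ => ⟨⟨ρf, hρf, (h1 ρ hρ σ hσ).1⟩, (h1 ρ hρ σ hσ).2⟩⟩
  -- The energies cancel by the definition of `macroEntropy`, and the Clausius inequality is the
  -- comparison of the two canonical free energies.
  have hiff : e - e' ≥ 1 / β * (macroEntropy β H e - macroEntropy β H e') ↔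
      freeEnergy β H (canonical H e) ≥ freeEnergy β H (canonical H e') := by
    have : 1 / β * (macroEntropy β H e - macroEntropy β H e') =
        e - macroFreeEnergy β H e - (e' - macroFreeEnergy β H e') := by
      rw [macroEntropy, macroEntropy]
      field_simp
    rw [this, macroFreeEnergy, macroFreeEnergy]
    constructor <;> intro h <;> linarith
  tfae_have 3 → 4 := by
    intro h
    rw [hiff]
    obtain ⟨W, hW, lam, hlam⟩ := exists_joint_conjDiag (Q := fun _ : Unit => H) (fun _ => hH)
      fun _ _ => Commute.refl H
    have h1 := freeEntropy_le_of_macToMac hW hlam (canonical_mem_energyMicrostates hH he)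
      (isEnsemble_ensemble (fun _ => hH) (fun _ _ => Commute.refl H) he') h
    rw [freeEntropy_eq_mul_freeEnergy hβ, freeEntropy_eq_mul_freeEnergy hβ,
      mul_le_mul_iff_right₀ hβ] at h1
    exact h1
  tfae_have 4 → 1 := fun h => (energyMacReach_iff hH hβ he hmem.1).2 (hiff.1 h)
  tfae_finish

theorem isGreatest_extractableWorkTo (hH : H.IsHermitian) (hβ : 0 < β)
    (he : (energyMicrostates H e).Nonempty) {ρf : Matrix d d ℂ} (hf : IsDensity ρf) :
    IsGreatest (extractableWorkTo β H e ρf) (macroFreeEnergy β H e - freeEnergy β H ρf) := by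
  have hmem := canonical_mem_energyMicrostates hH he
  constructor
  · intro ε hε ε' hε'
    obtain ⟨W, hW, lam, hlam⟩ := exists_joint_conjDiag (Q := fun _ : Unit => H) (fun _ => hH)
      fun _ _ => Commute.refl H
    obtain ⟨E, U, h1⟩ := exists_process (β := fun _ : Unit => β)
      (w := fun _ => macroFreeEnergy β H e - freeEnergy β H ρf) ⟨(), hβ.ne'⟩ hW hlam
      (isEnsemble_ensemble (fun _ => hH) (fun _ _ => Commute.refl H) he) hf
      (by
        rw [freeEntropy_eq_mul_freeEnergy hβ, freeEntropy_eq_mul_freeEnergy hβ]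
        simp only [Finset.univ_unique, Finset.sum_singleton]
        rw [mul_sub]
        exact le_rfl) (lt_min hε hε')
    refine ⟨E, U, fun ρ hρ σ hσ => ?_⟩
    obtain ⟨h2, h3⟩ := h1 ρ hρ σ hσ
    exact ⟨h2.trans (min_le_left _ _), (h3 ()).trans (min_le_right _ _)⟩
  · intro w hw
    have key := le_freeEntropy_sub_freeEntropy (β := fun _ : Unit => β) (Q := fun _ => H)
      (w := fun _ => w) hmem.1 hf fun ε hε => by
        obtain ⟨E, U, h1⟩ := hw ε hε ε hε
        obtain ⟨h2, h3⟩ := h1 _ hmem _ (E.gibbsFamily_mem_thermalMicrostates _)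
        exact ⟨E, U, h2, fun _ => h3⟩
    rw [freeEntropy_eq_mul_freeEnergy hβ, freeEntropy_eq_mul_freeEnergy hβ, ← mul_sub] at key
    simp only [Finset.univ_unique, Finset.sum_singleton] at key
    exact (mul_le_mul_iff_right₀ hβ).1 key

/-- Whatever the final state of the system, its free energy is at least that of the thermal state.
-/
theorem work_gibbsFamily_le (hH : H.IsHermitian) (hβ : 0 < β) {ρ : Matrix d d ℂ}
    (hρ : IsDensity ρ) (E : Environment Unit) (U : Matrix.unitaryGroup (d × E.Idx) ℂ) :
    work H E U ρ (E.gibbsFamily fun _ => β) ≤ freeEnergy β H ρ - freeEnergy β H (thermal β H) := by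
  have h1 := E.sum_mul_decrease_le (fun _ => β) (fun _ => H) U hρ
  have hσ := E.isDensity_of_mem_thermalMicrostates
    (E.gibbsFamily_mem_thermalMicrostates fun _ => β)
  have h2 := freeEntropy_gibbs_le (Q := fun _ : Unit => H) (fun _ => hH) (fun _ => β)
    (E.isDensity_final U hρ hσ).partialTrace
  have h3 : freeEntropy (fun _ : Unit => β) (fun _ => H) (thermal β H) ≤ _ := h2
  rw [freeEntropy_eq_mul_freeEnergy hβ, freeEntropy_eq_mul_freeEnergy hβ] at h1 h3
  simp only [Finset.univ_unique, Finset.sum_singleton] at h1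
  rw [← mul_le_mul_iff_right₀ hβ, mul_sub]
  rw [work]
  change β * E.decrease (fun _ => H) U ρ (E.gibbsFamily fun _ => β) () ≤ _ at h1
  linarith

theorem isGreatest_extractableWork (hH : H.IsHermitian) (hβ : 0 < β)
    (he : (energyMicrostates H e).Nonempty) :
    IsGreatest (extractableWork β H e)
      (macroFreeEnergy β H e - freeEnergy β H (thermal β H)) := by
  have hmem := canonical_mem_energyMicrostates hH he
  have := hmem.1.nonempty
  constructor
  · intro ε hε
    obtain ⟨E, U, h⟩ :=
      (isGreatest_extractableWorkTo hH hβ he (isDensity_thermal hH β)).1 ε hε ε hε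
    exact ⟨E, U, fun ρ hρ σ hσ => (h ρ hρ σ hσ).2⟩
  · intro w hw
    refine le_of_forall_pos_le_add fun ε hε => ?_
    obtain ⟨E, U, h⟩ := hw ε hε
    have h1 := (abs_le.1 (h _ hmem _ (E.gibbsFamily_mem_thermalMicrostates _))).1
    have h2 := work_gibbsFamily_le hH hβ hmem.1 E U
    rw [macroFreeEnergy]
    linarith

/-- Knowing the microstate gives no advantage over the macrostate protocols: these already approach
the bound when evaluated at the canonical ensemble and the Gibbs states. -/
theorem isLUB_microWork (hH : H.IsHermitian) (hβ : 0 < β)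
    (he : (energyMicrostates H e).Nonempty) :
    IsLUB (microWork β H (canonical H e))
      (macroFreeEnergy β H e - freeEnergy β H (thermal β H)) := by
  have hmem := canonical_mem_energyMicrostates hH he
  constructor
  · rintro w ⟨E, U, rfl⟩
    exact work_gibbsFamily_le hH hβ hmem.1 E U
  · intro B hB
    refine le_of_forall_pos_le_add fun ε hε => ?_
    obtain ⟨E, U, h⟩ := (isGreatest_extractableWork hH hβ he).1 ε hε
    have h1 := (abs_le.1 (h _ hmem _ (E.gibbsFamily_mem_thermalMicrostates _))).1
    have h2 := hB ⟨E, U, rfl⟩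
    linarith

end Energy

end MacroThermo

end

theorem mainTheorem5 {d : Type*} [Fintype d] [DecidableEq d] :
    -- one observable, the energy
    (∀ (H : Matrix d d ℂ) (β : ℝ), H.IsHermitian → 0 < β →
      ∀ e : ℝ, (MacroThermo.energyMicrostates H e).Nonempty →
        -- the canonical ensemble exists and is unique, so that free energy and entropy are
        -- functions of the macrostate, and the latter is the entropy of the canonical ensemble
        (∃! γ, MacroThermo.IsCanonical H e γ) ∧
        MacroThermo.macroEntropy β H e =
          MacroThermo.vonNeumannEntropy (MacroThermo.canonical H e) ∧
        -- the second law
        (∀ ρf : Matrix d d ℂ, MacroThermo.IsDensity ρf →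
          (MacroThermo.EnergyMacReach β H e ρf ↔
            MacroThermo.freeEnergy β H (MacroThermo.canonical H e) ≥
              MacroThermo.freeEnergy β H ρf)) ∧
        -- the Clausius inequality for transitions between macrostates
        (∀ e' : ℝ, (MacroThermo.energyMicrostates H e').Nonempty →
          List.TFAE [
            MacroThermo.EnergyMacReach β H e (MacroThermo.canonical H e'),
            ∃ ρf ∈ MacroThermo.energyMicrostates H e', MacroThermo.EnergyMacReach β H e ρf,
            MacroThermo.EnergyMacToMac β H e e',
            e - e' ≥ 1 / β *
              (MacroThermo.macroEntropy β H e - MacroThermo.macroEntropy β H e')]) ∧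
        -- optimal work extraction, with prescribed and with arbitrary final state
        (∀ ρf : Matrix d d ℂ, MacroThermo.IsDensity ρf →
          IsGreatest (MacroThermo.extractableWorkTo β H e ρf)
            (MacroThermo.macroFreeEnergy β H e - MacroThermo.freeEnergy β H ρf)) ∧
        IsGreatest (MacroThermo.extractableWork β H e)
          (MacroThermo.macroFreeEnergy β H e -
            MacroThermo.freeEnergy β H (MacroThermo.thermal β H)) ∧
        IsLUB (MacroThermo.microWork β H (MacroThermo.canonical H e))
          (MacroThermo.macroFreeEnergy β H e -
            MacroThermo.freeEnergy β H (MacroThermo.thermal β H))) ∧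
    -- several commuting observables
    (∀ {ι : Type*} [Fintype ι] [Nonempty ι] (Q : ι → Matrix d d ℂ) (β v : ι → ℝ),
      (∀ j, (Q j).IsHermitian) → (∀ i j, Commute (Q i) (Q j)) → (∀ j, β j ≠ 0) →
      (MacroThermo.microstates Q v).Nonempty →
        (∃! γ, MacroThermo.IsEnsemble Q v γ) ∧
        ∀ ρf : Matrix d d ℂ, MacroThermo.IsDensity ρf →
          (MacroThermo.MacReach β Q v ρf ↔
            MacroThermo.freeEntropy β Q (MacroThermo.ensemble Q v) ≥
              MacroThermo.freeEntropy β Q ρf)) := by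
  refine ⟨fun H β hH hβ e he => ?_, fun Q β v hQ hc hβ hv => ?_⟩
  · exact ⟨MacroThermo.existsUnique_isEnsemble (fun _ => hH) (fun _ _ => Commute.refl H) he,
      MacroThermo.macroEntropy_eq hH hβ he,
      fun ρf hf => MacroThermo.energyMacReach_iff hH hβ he hf,
      fun e' he' => MacroThermo.clausius_tfae hH hβ he he',
      fun ρf hf => MacroThermo.isGreatest_extractableWorkTo hH hβ he hf,
      MacroThermo.isGreatest_extractableWork hH hβ he,
      MacroThermo.isLUB_microWork hH hβ he⟩
  · exact ⟨MacroThermo.existsUnique_isEnsemble hQ hc hv,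
      fun ρf hf => MacroThermo.macReach_iff hQ hc ⟨Classical.arbitrary _, hβ _⟩ hv hf⟩
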